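/- **Theorem (Upper bound on the MAP threshold).** Let $(\lambda,\rho)$ be a degree distribution pair (edge perspective): polynomials $\lambda(x)=\sum_d\lambda_d x^{d-1}$, $\rho(x)=\sum_d\rho_d x^{d-1}$ with non-negative coefficients and $\lambda(1)=\rho(1)=1$. Let $r=1-\int_0^1\rho/\int_0^1\lambda$ be its design rate. Consider a sequence of ensembles $\mathrm{LDPC}(n,\lambda,\rho)$, $n\to\infty$: the degrees are uniformly bounded, the fractions of variable and check nodes of each degree $d\ge1$ converge to $(\lambda_d/d)/\int_0^1\lambda$ and $(\rho_d/d)/\int_0^1\rho$, and the graph $\mathtt G$ is given by a uniformly random matching of variable and check sockets. Assume that the expected rate $\mathbb E_{\mathtt G}[\dim(C(\mathtt G))/n]$ of the associated binary linear code $C(\mathtt G)$ converges to $r$. Let $\{\mathrm{BMS}(h)\}_{h\in[0,1]}$ be a family of binary memoryless symmetric channels such that - $\mathrm{BMS}(h)$ has entropy $H(X|Y)=h$ (in bits, uniform input); - for $h\le h'$ the channel $\mathrm{BMS}(h')$ is degraded with respect to $\mathrm{BMS}(h)$; - the family is smooth on $(0,1)$: for each input $x=\pm1$ and each continuously differentiable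 function $f$ of the canonical channel output (the posterior $(p(+1|y),p(-1|y))$ under the uniform prior, a point of the one-dimensional simplex), $\mathbb E[f(Y(h))\mid X=x]$ is continuously differentiable in $h\in(0,1)$. Let $X$ be uniform on $C(\mathtt G)$ and let $Y(h)$ be the result of sending every bit of $X$ through $\mathrm{BMS}(h)$. Let $\Phi_i^{\mathrm{BP},\ell}$ be the extrinsic estimate of bit $i$ after $\ell$ rounds of belief propagation on $\mathtt G$ with the flooding schedule (a function of the outputs $Y_j$, $j\ne i$), let $g_i^{\mathrm{BP},\ell}(\mathtt G,h)=\partial H(X_i\mid\Phi_i^{\mathrm{BP},\ell},Y_i)/\partial h_i$, where $h_i$ is the parameter of the channel used for bit $i$ and the derivative is taken at the point where all parameters equal $h$, and let $$g^{\mathrm{BP}}(h)=\lim_{\ell\to\infty}\lim_{n\to\infty}\mathbb E_{\mathtt G}\Big[\frac1n\sum_{i=1}^n g_i^{\mathrm{BP},\ell}(\mathtt G,h)\Big]$$ be the BP GEXIT function (the limits being read as upper limits, which are the limits whenever these exist). Then $g^{\mathrm{BP}}$ is integrable on $[0,1]$ and, for every $h\in[0,1]$, $$\liminf_{n\to\infty}\frac1n\,\mathbb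 E_{\mathtt G}[H(X\mid Y(h))]\ \ge\ r-\int_h^1 g^{\mathrm{BP}}(h')\,dh'.$$ Furthermore, there is a largest number $\overline h\in[0,1]$ with $\int_{\overline h}^1 g^{\mathrm{BP}}(h')\,dh'=r$, and $h^{\mathrm{MAP}}\le\overline h$, where $$h^{\mathrm{MAP}}=\inf\Big\{h\in[0,1]:\ \liminf_{n\to\infty}\frac1n\,\mathbb E_{\mathtt G}[H(X\mid Y(h))]>0\Big\}$$ is the MAP threshold (infimum in $[0,1]$, so that $\inf\emptyset=1$). -/

import Mathlib

open MeasureTheory ProbabilityTheory Filter Topology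

namespace GEXIT

noncomputable section

/-! ### Conditional entropy (in bits) -/

/-- Conditional entropy `H(X | Y)`, in bits, of a random variable `X` with values in a finite set
given an arbitrary random variable `Y`: the expected value of
`-∑ s, P(X = s | Y) log₂ P(X = s | Y)`. -/
def condEntropy {Ω S T : Type*} [MeasurableSpace Ω] [MeasurableSpace T] [Fintype S]
    (P : Measure Ω) (X : Ω → S) (Y : Ω → T) : ℝ :=
  ∑ s, (∫ ω, Real.negMulLog
    ((P⟦X ⁻¹' {s} | MeasurableSpace.comap Y inferInstance⟧) ω) ∂P) / Real.log 2

/-! ### Binary memoryless symmetric channels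

The input bit is an element `b` of `ZMod 2`; `b = 0` stands for the input `+1` and `b = 1` for the
input `-1`.  The channel output is in canonical form: it is the point `(p(+1 | y), p(-1 | y))` of
the one-dimensional simplex (uniform prior), written as `d = p(+1 | y) - p(-1 | y) ∈ [-1, 1]`.
The log-likelihood ratio is `l = log ((1 + d) / (1 - d))`, that is `d = tanh (l / 2)`.
A channel is given by the law `c` of `d` when the input is `+1` (the "`L`-density", as a
measure). -/

/-- `c` is the law, given the input `+1`, of the canonical output of a binary memoryless symmetric
channel.  The last field is the symmetry `c(-l) = e^{-l} c(l)` of `L`-densities in the variable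
`d`: the likelihood ratio of the laws of the output `d` under the inputs `+1` and `-1` is
`(1 + d) / (1 - d)`. -/
structure IsBMS (c : Measure ℝ) : Prop where
  prob : IsProbabilityMeasure c
  support : c (Set.Icc (-1) 1)ᶜ = 0
  symm : c.withDensity (fun d => ENNReal.ofReal (1 - d)) =
    (c.map (fun d => -d)).withDensity (fun d => ENNReal.ofReal (1 + d))

/-- The law of the channel output when the input is the bit `b`. -/
def outputLaw (c : Measure ℝ) (b : ZMod 2) : Measure ℝ :=
  if b = 0 then c else c.map (fun d => -d)

/-- The entropy operator `H(c) = ∫ c(l) log₂ (1 + e^{-l}) dl`; one has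
`1 + e^{-l} = 2 / (1 + d)`. -/
def entropy (c : Measure ℝ) : ℝ := ∫ d, Real.logb 2 (2 / (1 + d)) ∂c

/-- `c'` is degraded with respect to `c`: the output of `c'` can be obtained by passing the output
of `c` through a further channel `Q`. -/
def IsDegraded (c c' : Measure ℝ) : Prop :=
  ∃ Q : Kernel ℝ ℝ, IsMarkovKernel Q ∧ ∀ b : ZMod 2, (outputLaw c b).bind Q = outputLaw c' b

/-- `{BMS(h)}`, `h ∈ [0, 1]`: a (complete) family of binary memoryless symmetric channels
parametrized by the channel entropy. -/
def IsBMSFamily (c : ℝ → Measure ℝ) : Prop :=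
  ∀ h ∈ Set.Icc (0 : ℝ) 1, IsBMS (c h) ∧ entropy (c h) = h

/-- The family is ordered by degradation. -/
def IsDegradedFamily (c : ℝ → Measure ℝ) : Prop :=
  ∀ h ∈ Set.Icc (0 : ℝ) 1, ∀ h' ∈ Set.Icc (0 : ℝ) 1, h ≤ h' → IsDegraded (c h) (c h')

/-- The family is smooth on the parameter set `I`: for both inputs, the expectation of every
continuously differentiable function of the canonical output is a continuously differentiable
function of the parameter. -/
def IsSmoothFamilyOn (c : ℝ → Measure ℝ) (I : Set ℝ) : Prop :=
  ∀ f : ℝ → ℝ, ContDiffOn ℝ 1 f (Set.Icc (-1) 1) → ∀ b : ZMod 2,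
    ContDiffOn ℝ 1 (fun h => ∫ y, f y ∂(outputLaw (c h) b)) I

/-! ### LDPC ensembles -/

/-- A degree distribution pair from the edge perspective: `λ(x) = ∑ λ_d x^{d-1}`,
`ρ(x) = ∑ ρ_d x^{d-1}`, where `λ_d` (`ρ_d`) is the fraction of edges attached to a variable (check)
node of degree `d`. -/
structure DegreePair where
  lam : Polynomial ℝ
  rho : Polynomial ℝ
  lam_nonneg : ∀ d, 0 ≤ lam.coeff d
  rho_nonneg : ∀ d, 0 ≤ rho.coeff d
  lam_one : lam.eval 1 = 1
  rho_one : rho.eval 1 = 1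

/-- The design rate `1 - ∫ρ / ∫λ`. -/
def DegreePair.designRate (D : DegreePair) : ℝ :=
  1 - (∫ x in (0 : ℝ)..1, D.rho.eval x) / (∫ x in (0 : ℝ)..1, D.lam.eval x)

/-- The parameters of a finite ensemble: `n` variable nodes (the blocklength) and `m` check nodes
with prescribed degrees, with equally many sockets on both sides. -/
structure DegreeProfile where
  n : ℕ
  m : ℕ
  varDeg : Fin n → ℕ
  chkDeg : Fin m → ℕ
  sockets : ∑ i, varDeg i = ∑ j, chkDeg j

/-- The sockets of the variable nodes. -/
abbrev DegreeProfile.VarSocket (E : DegreeProfile) : Type := Σ i : Fin E.n, Fin (E.varDeg i)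

/-- The sockets of the check nodes. -/
abbrev DegreeProfile.ChkSocket (E : DegreeProfile) : Type := Σ j : Fin E.m, Fin (E.chkDeg j)

/-- An element of the ensemble: a bipartite (multi)graph, given by a matching of the variable
sockets with the check sockets.  An edge is named by its variable socket. -/
abbrev DegreeProfile.Graph (E : DegreeProfile) : Type := E.VarSocket ≃ E.ChkSocket

/-- Expectation over a uniformly random element of the ensemble. -/
def DegreeProfile.expect (E : DegreeProfile) (f : E.Graph → ℝ) : ℝ :=
  (∑ G : E.Graph, f G) / Fintype.card E.Graph

/-- A sequence of ensembles `LDPC(n, λ, ρ)` with `n → ∞`: the degrees are uniformly bounded, and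
the fractions of variable and check nodes of each degree `d + 1` are asymptotically those
prescribed by `(λ, ρ)`, namely `(λ_{d+1} / (d+1)) / ∫λ` and `(ρ_{d+1} / (d+1)) / ∫ρ`.
(These fractions, multiplied by the number of nodes, need not be integers, hence the limit: every
rounding is allowed.) -/
structure IsLDPCSequence (D : DegreePair) (E : ℕ → DegreeProfile) : Prop where
  blocklength : Tendsto (fun k => (E k).n) atTop atTop
  bounded : ∃ M : ℕ, ∀ k, (∀ i, (E k).varDeg i ≤ M) ∧ (∀ j, (E k).chkDeg j ≤ M)
  var_frac : ∀ d : ℕ, Tendsto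
    (fun k => ((Finset.univ.filter fun i => (E k).varDeg i = d + 1).card : ℝ) / (E k).n) atTop
    (𝓝 (D.lam.coeff d / (d + 1) / ∫ x in (0 : ℝ)..1, D.lam.eval x))
  chk_frac : ∀ d : ℕ, Tendsto
    (fun k => ((Finset.univ.filter fun j => (E k).chkDeg j = d + 1).card : ℝ) / (E k).m) atTop
    (𝓝 (D.rho.coeff d / (d + 1) / ∫ x in (0 : ℝ)..1, D.rho.eval x))

variable {E : DegreeProfile}

/-- The binary linear code of the graph: at each check node the bits at its sockets sum to `0`
(so an edge counts with its multiplicity modulo `2`). -/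
def code (G : E.Graph) : Submodule (ZMod 2) (Fin E.n → ZMod 2) where
  carrier := {x | ∀ j : Fin E.m, ∑ s : Fin (E.chkDeg j), x (G.symm ⟨j, s⟩).1 = 0}
  zero_mem' := by intro j; simp
  add_mem' := by
    intro a b ha hb j
    simp only [Pi.add_apply, Finset.sum_add_distrib, ha j, hb j, add_zero]
  smul_mem' := by
    intro r a ha j
    simp only [Pi.smul_apply, ← Finset.smul_sum, ha j, smul_zero]

/-- The rate of the code of the graph. -/
def rate (G : E.Graph) : ℝ := (Module.finrank (ZMod 2) (code G) : ℝ) / E.n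

/-! ### Transmission -/

/-- The joint law of `(X, Y)`: `X` is uniform on the binary code `C` of length `n`, and, given
`X`, the outputs `Y_i` are independent, `Y_i` being the output of the channel `c i` with input
`X_i`. -/
def jointLaw {n : ℕ} (C : Submodule (ZMod 2) (Fin n → ZMod 2)) (c : Fin n → Measure ℝ) :
    Measure ((Fin n → ZMod 2) × (Fin n → ℝ)) :=
  open Classical in
  ((Fintype.card C : ENNReal)⁻¹) • ∑ x : C,
    (Measure.dirac (x : Fin n → ZMod 2)).prod (Measure.pi fun i => outputLaw (c i) (x.1 i))

/-- `H(X | Y(h))` when a uniformly random codeword of the code of `G` is sent and every bit is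
transmitted through `BMS(h)`. -/
def mapEntropy (c : ℝ → Measure ℝ) (G : E.Graph) (h : ℝ) : ℝ :=
  condEntropy (jointLaw (code G) fun _ => c h) (fun ω => ω.1) (fun ω => ω.2)

/-- `E_G[H(X | Y(h))] / n`. -/
def avgMapEntropy (c : ℝ → Measure ℝ) (E : DegreeProfile) (h : ℝ) : ℝ :=
  E.expect (fun G => mapEntropy c G h) / E.n

/-- The MAP threshold: the infimum in `[0, 1]` of the set of all `h` such that
`liminf_n E_G[H(X | Y(h))] / n > 0`.  The point `1` is added so that the infimum of the empty
subset of `[0, 1]` is `1`. -/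
def mapThreshold (c : ℝ → Measure ℝ) (E : ℕ → DegreeProfile) : ℝ :=
  sInf (insert 1
    {h : ℝ | h ∈ Set.Icc (0 : ℝ) 1 ∧ 0 < liminf (fun k => avgMapEntropy c (E k) h) atTop})

/-! ### Belief propagation

All messages are log-likelihood ratios `l`, represented by `d = tanh (l / 2) ∈ [-1, 1]`; `d = 0`
means no information (an erasure). -/

/-- The rule at a variable node: the sum of the log-likelihood ratios of `y` and of the `d a`,
`a ∈ s`. -/
def varRule {ι : Type*} (y : ℝ) (s : Finset ι) (d : ι → ℝ) : ℝ :=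
  ((1 + y) * ∏ a ∈ s, (1 + d a) - (1 - y) * ∏ a ∈ s, (1 - d a)) /
    ((1 + y) * ∏ a ∈ s, (1 + d a) + (1 - y) * ∏ a ∈ s, (1 - d a))

/-- The message sent along the edge `e` by its variable node, when the messages that the variable
nodes received last are `M`: it takes into account the channel output and the messages on all
other edges of the node. -/
def varToChk (y : Fin E.n → ℝ) (M : E.VarSocket → ℝ) (e : E.VarSocket) : ℝ :=
  varRule (y e.1) (Finset.univ.erase e.2) fun s => M ⟨e.1, s⟩

/-- The message received along the edge `e` by its variable node in round `l` of belief propagation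
(flooding schedule, no information in round `0`).  The rule at a check node is
`tanh (l / 2) = ∏ tanh (l_a / 2)` over all other edges of the check node. -/
def chkToVar (G : E.Graph) (y : Fin E.n → ℝ) : ℕ → E.VarSocket → ℝ
  | 0, _ => 0
  | l + 1, e => ∏ s ∈ Finset.univ.erase (G e).2,
      varToChk y (chkToVar G y l) (G.symm ⟨(G e).1, s⟩)

/-- The extrinsic estimate `Φ_i` of the bit `i` in round `l` of belief propagation.  It is computed
from the outputs `y_j`, `j ≠ i`, only: `y_i` is replaced by an erasure. -/
def bpExtrinsic (G : E.Graph) (l : ℕ) (i : Fin E.n) (y : Fin E.n → ℝ) : ℝ :=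
  varRule 0 Finset.univ fun s => chkToVar G (Function.update y i 0) l ⟨i, s⟩

/-- The BP GEXIT function of the bit `i`: the partial derivative
`∂ H(X_i | Φ_i, Y_i) / ∂ h_i` with respect to the parameter of the channel of the bit `i`, at the
point where all bits are transmitted through `BMS(h)`. -/
def bpGexitBit (c : ℝ → Measure ℝ) (G : E.Graph) (l : ℕ) (i : Fin E.n) (h : ℝ) : ℝ :=
  deriv (fun u => condEntropy (jointLaw (code G) (Function.update (fun _ => c h) i (c u)))
    (fun ω => ω.1 i) (fun ω => (bpExtrinsic G l i ω.2, ω.2 i))) h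

/-- `E_G[(1 / n) ∑ i, g_i^{BP,l}(G, h)]`. -/
def avgBpGexit (c : ℝ → Measure ℝ) (E : DegreeProfile) (l : ℕ) (h : ℝ) : ℝ :=
  E.expect fun G => (∑ i, bpGexitBit c G l i h) / E.n

/-- The asymptotic BP GEXIT function
`g^{BP}(h) = lim_{l → ∞} lim_{n → ∞} E_G[(1 / n) ∑ i, g_i^{BP,l}(G, h)]`.
Each limit is written as an upper limit, which is the limit whenever the latter exists. -/
def bpGexit (c : ℝ → Measure ℝ) (E : ℕ → DegreeProfile) (h : ℝ) : ℝ :=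
  limsup (fun l => limsup (fun k => avgBpGexit c (E k) l h) atTop) atTop

end

end GEXIT

namespace GEXIT

noncomputable section

/-! ### Conditional entropy through densities -/

/-! Fix a code C. Its word entropy H(X | Y(h)) equals dim C at h = 1, where the output is an
erasure, and vanishes at h = 0, where it is noiseless. It is Lipschitz in h, so dim C − H(X | Y(h))
is the integral of its derivative over [h, 1]. The theorem follows once that derivative is dominated
by the sum of the BP GEXIT functions of the bits: average over the ensemble, let n → ∞ and then l →
∞, and move each upper limit inside the integral by the reverse Fatou lemma.

The domination is a data-processing statement. If the bit i goes through a channel a and Z is an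
estimate not using Y_i, then the entropy of the word, or of the bit, given (Z, Y_i) is K + entropy a
− E[biasEntropy a δ] / log 2, where δ is the posterior bias of X_i given Z and neither K nor δ
depends on a (`exists_condEntropy_eq`, `exists_condEntropy_jointLaw`). Replacing a by a degraded a'
therefore changes this entropy by a constant minus E[biasGap a a' δ] / log 2. The gap is convex in δ
(`convexOn_biasGap`). Coarsening Z replaces δ by a conditional expectation, so by Jensen
(`integral_bias_le_of_bind`) the gap term shrinks and the entropy increment grows. Both the BP
estimate and extra noise on the other bits are coarsenings of the full extrinsic output; this is
`condEntropy_increment_le`.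

Degrading the bits one at a time and telescoping gives `wordEntropy_sub_le`, hence
`deriv_wordEntropy_le` and the area bound `finrank_sub_wordEntropy_le` for each graph. The bounds 0
≤ biasGap ≤ log 2 · (entropy difference) keep all GEXIT functions in [0, 1], which supplies every
dominating function. Measurability of the GEXIT functions in h needs its own argument
(`aestronglyMeasurable_deriv_bitEntropy`). -/

theorem mul_negMulLog_div (w W : ℝ) (h : W = 0 → w = 0) :
    W * Real.negMulLog (w / W) = Real.negMulLog w + w * Real.log W := by
  rcases eq_or_ne W 0 with hW | hW
  · simp [hW, h hW]
  rcases eq_or_ne w 0 with hw | hw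
  · simp [hw]
  rw [Real.negMulLog, Real.negMulLog, Real.log_div hw hW]
  field_simp
  ring

theorem map_eq_withDensity_sum {Ω S T : Type*} [MeasurableSpace Ω] [MeasurableSpace S]
    [MeasurableSingletonClass S] [MeasurableSpace T] [Fintype S]
    (P : Measure Ω) {X : Ω → S} {Y : Ω → T} (hX : Measurable X)
    (hY : Measurable Y) (μ : Measure T) (w : S → T → ℝ) (hw : ∀ s, Measurable (w s))
    (h0 : ∀ s t, 0 ≤ w s t)
    (h : ∀ s, (P.restrict (X ⁻¹' {s})).map Y = μ.withDensity fun t => ENNReal.ofReal (w s t)) :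
    P.map Y = μ.withDensity fun t => ENNReal.ofReal (∑ s, w s t) := by
  ext B hB
  have h1 : ∀ s, (P.restrict (Y ⁻¹' B)) (X ⁻¹' {s}) =
      ∫⁻ t in B, ENNReal.ofReal (w s t) ∂μ := by
    intro s
    rw [← withDensity_apply _ hB, ← h s, Measure.map_apply hY hB,
      Measure.restrict_apply (hY hB), Measure.restrict_apply (hX (measurableSet_singleton s)),
      Set.inter_comm]
  rw [withDensity_apply _ hB, Measure.map_apply hY hB]
  calc P (Y ⁻¹' B) = ∑ s, (P.restrict (Y ⁻¹' B)) (X ⁻¹' {s}) := by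
        rw [sum_measure_preimage_singleton Finset.univ
          (fun s _ => hX (measurableSet_singleton s))]
        simp
    _ = ∫⁻ t in B, ENNReal.ofReal (∑ s, w s t) ∂μ := by
        simp_rw [h1]
        rw [← lintegral_finsetSum _ (fun s _ => (hw s).ennreal_ofReal)]
        refine lintegral_congr fun t => ?_
        rw [ENNReal.ofReal_sum_of_nonneg fun s _ => h0 s t]

/-- Bayes' rule: Y has density ∑ w with respect to μ, so integrating the quotient over an event of Y
cancels the denominator and leaves the joint density w s. -/
theorem condExp_indicator_eq_div {Ω S T : Type*} [MeasurableSpace Ω] [MeasurableSpace S]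
    [MeasurableSingletonClass S] [MeasurableSpace T] [Fintype S]
    (P : Measure Ω) [IsProbabilityMeasure P] {X : Ω → S} {Y : Ω → T} (hX : Measurable X)
    (hY : Measurable Y) (μ : Measure T) (w : S → T → ℝ) (hw : ∀ s, Measurable (w s))
    (h0 : ∀ s t, 0 ≤ w s t)
    (h : ∀ s, (P.restrict (X ⁻¹' {s})).map Y = μ.withDensity fun t => ENNReal.ofReal (w s t))
    (s : S) :
    P⟦X ⁻¹' {s} | MeasurableSpace.comap Y inferInstance⟧ =ᵐ[P]
      fun ω => w s (Y ω) / ∑ s', w s' (Y ω) := by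
  have hle : MeasurableSpace.comap Y inferInstance ≤ (inferInstance : MeasurableSpace Ω) :=
    hY.comap_le
  have hg : Measurable fun t => w s t / ∑ s', w s' t :=
    (hw s).div (Finset.measurable_fun_sum _ fun s _ => hw s)
  have hsum : ∀ t, w s t ≤ ∑ s', w s' t := fun t =>
    Finset.single_le_sum (f := fun s' => w s' t) (fun s' _ => h0 s' t) (Finset.mem_univ s)
  have hg0 : ∀ t, 0 ≤ w s t / ∑ s', w s' t := fun t =>
    div_nonneg (h0 s t) ((h0 s t).trans (hsum t))
  have hg1 : ∀ t, w s t / ∑ s', w s' t ≤ 1 := fun t =>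
    div_le_one_of_le₀ (hsum t) ((h0 s t).trans (hsum t))
  have hgi : Integrable (fun ω => w s (Y ω) / ∑ s', w s' (Y ω)) P := by
    refine Integrable.of_bound (C := 1) (hg.comp hY).aestronglyMeasurable ?_
    refine Eventually.of_forall fun ω => ?_
    rw [Real.norm_eq_abs, abs_of_nonneg (hg0 _)]
    exact hg1 _
  refine (ae_eq_condExp_of_forall_setIntegral_eq hle ?_ ?_ ?_ ?_).symm
  · exact (integrable_const (1 : ℝ)).indicator (hX (measurableSet_singleton s))
  · intro B _ _
    exact hgi.integrableOn
  · rintro _ ⟨B, hB, rfl⟩ _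
    rw [integral_indicator (hX (measurableSet_singleton s)), Measure.restrict_restrict
      (hX (measurableSet_singleton s))]
    rw [setIntegral_const, smul_eq_mul, mul_one,
      integral_eq_lintegral_of_nonneg_ae (Eventually.of_forall fun ω => hg0 _)
      (hg.comp hY).aestronglyMeasurable, Measure.real]
    congr 1
    have e1 : ∫⁻ ω in Y ⁻¹' B, ENNReal.ofReal (w s (Y ω) / ∑ s', w s' (Y ω)) ∂P
        = ∫⁻ t in B, ENNReal.ofReal (w s t / ∑ s', w s' t) ∂(P.map Y) := by
      rw [setLIntegral_map hB hg.ennreal_ofReal hY]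
    rw [e1, map_eq_withDensity_sum P hX hY μ w hw h0 h,
      setLIntegral_withDensity_eq_setLIntegral_mul _
        (Finset.measurable_fun_sum _ fun s _ => hw s).ennreal_ofReal hg.ennreal_ofReal hB]
    have e2 : P (X ⁻¹' {s} ∩ Y ⁻¹' B) = ∫⁻ t in B, ENNReal.ofReal (w s t) ∂μ := by
      rw [← withDensity_apply _ hB, ← h s, Measure.map_apply hY hB,
        Measure.restrict_apply (hY hB), Set.inter_comm]
    rw [e2]
    refine lintegral_congr fun t => ?_
    rw [Pi.mul_apply, ← ENNReal.ofReal_mul ((h0 s t).trans (hsum t))]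
    congr 1
    -- Where the total density vanishes the quotient takes the default value 0, which is right
    -- because w s t vanishes there too.
    rcases eq_or_ne (∑ s', w s' t) 0 with hW | hW
    · have := hsum t
      rw [hW] at this ⊢
      simp [le_antisymm this (h0 s t)]
    · field_simp
  · exact ((hg.comp (comap_measurable Y)).stronglyMeasurable).aestronglyMeasurable

theorem abs_negMulLog_le {x M : ℝ} (h0 : 0 ≤ x) (hM : x ≤ M) :
    |Real.negMulLog x| ≤ 1 + M ^ 2 := by
  rw [abs_le]
  constructor
  · rcases h0.eq_or_lt with rfl | hx
    · rw [Real.negMulLog_zero]; nlinarith [sq_nonneg M]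
    · have : Real.log x ≤ x - 1 := Real.log_le_sub_one_of_pos hx
      rw [Real.negMulLog]
      nlinarith
  · have := Real.negMulLog_le_one_sub_self h0
    nlinarith [sq_nonneg M]

theorem integrable_negMulLog {T : Type*} [MeasurableSpace T] (μ : Measure T) [IsFiniteMeasure μ]
    {f : T → ℝ} (hf : Measurable f) {M : ℝ} (h0 : ∀ᵐ t ∂μ, 0 ≤ f t) (hM : ∀ᵐ t ∂μ, f t ≤ M) :
    Integrable (fun t => Real.negMulLog (f t)) μ := by
  refine Integrable.of_bound (C := 1 + M ^ 2)
    (Real.continuous_negMulLog.measurable.comp hf).aestronglyMeasurable ?_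
  filter_upwards [h0, hM] with t h0 hM
  exact abs_negMulLog_le h0 hM

/-- With W = ∑ w, the posterior is w / W and Y has density W, and W η(w / W) = η(w) + w log W.
Summed over the symbols, the last terms give W log W = −η(W). -/
theorem condEntropy_eq_integral {Ω S T : Type*} [MeasurableSpace Ω] [MeasurableSpace S]
    [MeasurableSingletonClass S] [MeasurableSpace T] [Fintype S]
    (P : Measure Ω) [IsProbabilityMeasure P] {X : Ω → S} {Y : Ω → T} (hX : Measurable X)
    (hY : Measurable Y) (μ : Measure T) [IsFiniteMeasure μ] (w : S → T → ℝ)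
    (hw : ∀ s, Measurable (w s)) (h0 : ∀ s t, 0 ≤ w s t) (M : ℝ) (hM : ∀ s t, w s t ≤ M)
    (h : ∀ s, (P.restrict (X ⁻¹' {s})).map Y = μ.withDensity fun t => ENNReal.ofReal (w s t)) :
    condEntropy P X Y =
      (∫ t, (∑ s, Real.negMulLog (w s t) - Real.negMulLog (∑ s, w s t)) ∂μ) / Real.log 2 := by
  have hW : Measurable fun t => ∑ s, w s t := Finset.measurable_fun_sum _ fun s _ => hw s
  have hW0 : ∀ t, 0 ≤ ∑ s, w s t := fun t => Finset.sum_nonneg fun s _ => h0 s t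
  have hle : ∀ s t, w s t ≤ ∑ s', w s' t := fun s t =>
    Finset.single_le_sum (f := fun s' => w s' t) (fun s' _ => h0 s' t) (Finset.mem_univ s)
  have key : ∀ s, ∫ ω, Real.negMulLog
      ((P⟦X ⁻¹' {s} | MeasurableSpace.comap Y inferInstance⟧) ω) ∂P =
      ∫ t, (∑ s', w s' t) * Real.negMulLog (w s t / ∑ s', w s' t) ∂μ := by
    intro s
    have hg : Measurable fun t => Real.negMulLog (w s t / ∑ s', w s' t) :=
      Real.continuous_negMulLog.measurable.comp ((hw s).div hW)
    have e : (fun ω => Real.negMulLog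
        ((P⟦X ⁻¹' {s} | MeasurableSpace.comap Y inferInstance⟧) ω)) =ᵐ[P]
        fun ω => Real.negMulLog (w s (Y ω) / ∑ s', w s' (Y ω)) := by
      filter_upwards [condExp_indicator_eq_div P hX hY μ w hw h0 h s] with ω hω
      rw [hω]
    rw [integral_congr_ae e, ← integral_map (φ := Y)
      (f := fun t => Real.negMulLog (w s t / ∑ s', w s' t)) hY.aemeasurable
      hg.aestronglyMeasurable, map_eq_withDensity_sum P hX hY μ w hw h0 h,
      integral_withDensity_eq_integral_toReal_smul hW.ennreal_ofReal
      (Eventually.of_forall fun t => ENNReal.ofReal_lt_top)]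
    refine integral_congr_ae (Eventually.of_forall fun t => ?_)
    simp only [smul_eq_mul, ENNReal.toReal_ofReal (hW0 t)]
  rw [condEntropy, ← Finset.sum_div, Finset.sum_congr rfl fun s _ => key s, ← integral_finsetSum]
  · congr 1
    refine integral_congr_ae (Eventually.of_forall fun t => ?_)
    have : ∀ s, (∑ s', w s' t) * Real.negMulLog (w s t / ∑ s', w s' t) =
        Real.negMulLog (w s t) + w s t * Real.log (∑ s', w s' t) := fun s =>
      mul_negMulLog_div _ _ fun h => le_antisymm (h ▸ hle s t) (h0 s t)
    simp only [this, Finset.sum_add_distrib, ← Finset.sum_mul]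
    rw [Real.negMulLog.eq_1 (∑ s, w s t)]
    ring
  · intro s _
    refine Integrable.of_bound (C := (Fintype.card S * M) * (1 + 1 ^ 2))
      (hW.mul (Real.continuous_negMulLog.measurable.comp
        ((hw s).div hW))).aestronglyMeasurable ?_
    refine Eventually.of_forall fun t => ?_
    have h1 : ∑ s', w s' t ≤ Fintype.card S * M := by
      calc ∑ s', w s' t ≤ ∑ s' : S, M := Finset.sum_le_sum fun s' _ => hM s' t
        _ = _ := by simp
    rw [norm_mul, Real.norm_eq_abs, Real.norm_eq_abs, abs_of_nonneg (hW0 t)]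
    exact mul_le_mul h1 (abs_negMulLog_le (div_nonneg (h0 s t) (hW0 t))
      (div_le_one_of_le₀ (hle s t) (hW0 t))) (abs_nonneg _) ((hW0 t).trans h1)

/-! ### Posterior biases and data processing -/

/-- The sign `(-1)^b`. -/
def sgn (b : ZMod 2) : ℝ := if b = 0 then 1 else -1

theorem abs_sgn (b : ZMod 2) : |sgn b| = 1 := by
  unfold sgn; split_ifs <;> simp

@[simp] theorem sgn_zero : sgn 0 = 1 := by simp [sgn]

@[simp] theorem sgn_one : sgn 1 = -1 := by simp [sgn]

/-- For the pair of measures `α` of mixture `μ = α 0 + α 1`, the function `δ` is the posterior bias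
`P(0 | t) - P(1 | t)`. -/
structure IsBias {T : Type*} [MeasurableSpace T] (α : ZMod 2 → Measure T) (μ : Measure T)
    (δ : T → ℝ) : Prop where
  meas : Measurable δ
  bound : ∀ t, |δ t| ≤ 1
  eq : ∀ b, α b = μ.withDensity fun t => ENNReal.ofReal ((1 + sgn b * δ t) / 2)

theorem IsBias.mem {T : Type*} [MeasurableSpace T] {α : ZMod 2 → Measure T} {μ : Measure T}
    {δ : T → ℝ} (h : IsBias α μ δ) (t : T) : δ t ∈ Set.Icc (-1 : ℝ) 1 := abs_le.1 (h.bound t)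

theorem IsBias.add_eq {T : Type*} [MeasurableSpace T] {α : ZMod 2 → Measure T} {μ : Measure T}
    {δ : T → ℝ} (h : IsBias α μ δ) : α 0 + α 1 = μ := by
  rw [h.eq 0, h.eq 1, ← withDensity_add_left]
  · have : ((fun t => ENNReal.ofReal ((1 + sgn 0 * δ t) / 2)) +
        fun t => ENNReal.ofReal ((1 + sgn 1 * δ t) / 2)) = 1 := by
      funext t
      have := h.mem t
      simp only [Pi.add_apply, sgn_zero, sgn_one, Pi.one_apply]
      rw [← ENNReal.ofReal_add (by linarith [this.1]) (by linarith [this.2])]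
      rw [← ENNReal.ofReal_one]; congr 1; ring
    rw [this, withDensity_one]
  · have := h.meas
    fun_prop

/-- Data processing: on the joint law of an observation and its image under the kernel, the bias of
the image is the conditional expectation of the original bias, and conditional Jensen applies to J.
-/
theorem integral_bias_le_of_bind {T T' : Type*} [MeasurableSpace T] [MeasurableSpace T']
    {α : ZMod 2 → Measure T} {μ : Measure T} {δ : T → ℝ} {β : ZMod 2 → Measure T'}
    {ν : Measure T'} {δ' : T' → ℝ} [IsFiniteMeasure μ] (hα : IsBias α μ δ) (hβ : IsBias β ν δ')
    (K : Kernel T T') [IsMarkovKernel K] (hK : ∀ b, (α b).bind K = β b) {J : ℝ → ℝ}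
    (hJ : ConvexOn ℝ (Set.Icc (-1) 1) J) (hJc : Continuous J) :
    ∫ t, J (δ' t) ∂ν ≤ ∫ t, J (δ t) ∂μ := by
  have hδ := hα.meas
  have hδ' := hβ.meas
  set π : Measure (T × T') := μ ⊗ₘ K with hπ
  have hfst : π.map Prod.fst = μ := Measure.fst_compProd μ K
  have hsnd : π.map Prod.snd = ν := by
    have : π.map Prod.snd = μ.bind K := Measure.snd_compProd μ K
    rw [this, ← hα.add_eq, ← hβ.add_eq, ← hK 0, ← hK 1]
    ext s hs
    simp [Measure.bind_apply hs K.aemeasurable]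
  have hsm : Measurable (Prod.snd : T × T' → T') := measurable_snd
  have hbound : ∀ {f : T × T' → ℝ} (g : ℝ → ℝ), Continuous g → Measurable f →
      (∀ x, |f x| ≤ 1) → Integrable (fun x => g (f x)) π := by
    intro f g hg hf hf1
    obtain ⟨C, hC⟩ := (isCompact_Icc (a := (-1 : ℝ)) (b := 1)).exists_bound_of_continuousOn
      hg.continuousOn
    exact Integrable.of_bound (C := C) (hg.measurable.comp hf).aestronglyMeasurable
      (Eventually.of_forall fun x => hC _ (abs_le.1 (hf1 x)))
  have h1 : Integrable (fun x : T × T' => δ x.1) π :=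
    hbound (f := fun x : T × T' => δ x.1) id continuous_id (by fun_prop) fun x => hα.bound _
  have h2 : Integrable (fun x : T × T' => δ' x.2) π :=
    hbound (f := fun x : T × T' => δ' x.2) id continuous_id (by fun_prop) fun x => hβ.bound _
  have h3 : Integrable (J ∘ fun x : T × T' => δ x.1) π :=
    hbound (f := fun x : T × T' => δ x.1) J hJc (by fun_prop) fun x => hα.bound _
  have hcond : π[fun x => δ x.1 | MeasurableSpace.comap Prod.snd inferInstance] =ᵐ[π]
      fun x => δ' x.2 := by
    refine (ae_eq_condExp_of_forall_setIntegral_eq hsm.comap_le h1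
      (fun _ _ _ => h2.integrableOn) ?_ ?_).symm
    · rintro _ ⟨B, hB, rfl⟩ _
      have hB' : MeasurableSet (Prod.snd ⁻¹' B : Set (T × T')) := hsm hB
      -- The biases are compared through the nonnegative posteriors (1 + δ) / 2, whose integrals
      -- over the event are both the mass `β 0 B`.
      have e : ∫ x in Prod.snd ⁻¹' B, (1 + δ' x.2) / 2 ∂π =
          ∫ x in Prod.snd ⁻¹' B, (1 + δ x.1) / 2 ∂π := by
        rw [integral_eq_lintegral_of_nonneg_ae
            (Eventually.of_forall fun x => by
              have := (hβ.mem x.2).1; simp only [Pi.zero_apply]; linarith)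
            (Measurable.aestronglyMeasurable (by fun_prop)),
          integral_eq_lintegral_of_nonneg_ae
            (Eventually.of_forall fun x => by
              have := (hα.mem x.1).1; simp only [Pi.zero_apply]; linarith)
            (Measurable.aestronglyMeasurable (by fun_prop))]
        congr 1
        have e1 : ∫⁻ x in Prod.snd ⁻¹' B, ENNReal.ofReal ((1 + δ' x.2) / 2) ∂π = β 0 B := by
          rw [hβ.eq 0, withDensity_apply _ hB, ← hsnd,
            setLIntegral_map hB (by fun_prop) hsm]
          simp
        have e2 : ∫⁻ x in Prod.snd ⁻¹' B, ENNReal.ofReal ((1 + δ x.1) / 2) ∂π = β 0 B := by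
          rw [← hK 0, Measure.bind_apply hB K.aemeasurable, hα.eq 0,
            lintegral_withDensity_eq_lintegral_mul _ (by fun_prop) (K.measurable_coe hB),
            ← lintegral_indicator hB', hπ, Measure.lintegral_compProd
              ((by fun_prop : Measurable fun x : T × T' =>
                ENNReal.ofReal ((1 + δ x.1) / 2)).indicator hB')]
          refine lintegral_congr fun t => ?_
          have : ∀ t' : T', (Prod.snd ⁻¹' B : Set (T × T')).indicator
              (fun x => ENNReal.ofReal ((1 + δ x.1) / 2)) (t, t') =
              B.indicator (fun _ => ENNReal.ofReal ((1 + δ t) / 2)) t' := fun t' => rfl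
          simp_rw [this]
          rw [lintegral_indicator hB, setLIntegral_const]
          simp
        rw [e1, e2]
      rw [integral_div, integral_div, integral_add (integrable_const _) h1.integrableOn,
        integral_add (integrable_const _) h2.integrableOn] at e
      linarith
    · exact ((hδ'.comp (comap_measurable Prod.snd)).stronglyMeasurable).aestronglyMeasurable
  have hjensen := ConvexOn.map_condExp_le (μ := π) hsm.comap_le hJ
    (hJc.lowerSemicontinuous.lowerSemicontinuousOn _)
    (Eventually.of_forall fun x : T × T' => hα.mem x.1) isClosed_Icc h1 h3
  have h4 : ∫ x, J (δ' x.2) ∂π ≤ ∫ x, J (δ x.1) ∂π := by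
    calc ∫ x, J (δ' x.2) ∂π
        ≤ ∫ x, (π[J ∘ fun x => δ x.1 | MeasurableSpace.comap Prod.snd inferInstance]) x ∂π := by
          refine integral_mono_ae (hbound (f := fun x : T × T' => δ' x.2) J hJc (by fun_prop)
            fun x => hβ.bound _) integrable_condExp ?_
          filter_upwards [hcond, hjensen] with x hx hx'
          rw [← hx]; exact hx'
      _ = _ := integral_condExp hsm.comap_le
  calc ∫ t, J (δ' t) ∂ν = ∫ x, J (δ' x.2) ∂π := by
        rw [← hsnd, integral_map (f := fun t => J (δ' t)) hsm.aemeasurable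
          (hJc.measurable.comp hδ').aestronglyMeasurable]
    _ ≤ ∫ x, J (δ x.1) ∂π := h4
    _ = ∫ t, J (δ t) ∂μ := by
        rw [← hfst, integral_map (f := fun t => J (δ t)) measurable_fst.aemeasurable
          (hJc.measurable.comp hδ).aestronglyMeasurable]

/-! ### Channels -/

/-- The projection onto `[-1, 1]`. -/
def clamp (y : ℝ) : ℝ := max (-1) (min 1 y)

theorem continuous_clamp : Continuous clamp := by unfold clamp; fun_prop

@[fun_prop] theorem measurable_clamp : Measurable clamp := continuous_clamp.measurable

theorem abs_clamp_le (y : ℝ) : |clamp y| ≤ 1 := by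
  rw [abs_le]; unfold clamp
  exact ⟨le_max_left _ _, max_le (by norm_num) (min_le_left _ _)⟩

theorem clamp_of_mem {y : ℝ} (h : y ∈ Set.Icc (-1 : ℝ) 1) : clamp y = y := by
  unfold clamp; rw [min_eq_right h.2, max_eq_right h.1]

theorem clamp_neg (y : ℝ) : clamp (-y) = -clamp y := by
  unfold clamp
  rw [max_def, max_def, min_def, min_def]
  split_ifs <;> linarith

theorem one_add_mul_nonneg {x y : ℝ} (hx : |x| ≤ 1) (hy : |y| ≤ 1) : 0 ≤ 1 + x * y := by
  have : |x * y| ≤ 1 := by rw [abs_mul]; exact mul_le_one₀ hx (abs_nonneg _) hy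
  linarith [(abs_le.1 this).1]

theorem one_add_mul_le {x y : ℝ} (hx : |x| ≤ 1) (hy : |y| ≤ 1) : 1 + x * y ≤ 2 := by
  have : |x * y| ≤ 1 := by rw [abs_mul]; exact mul_le_one₀ hx (abs_nonneg _) hy
  linarith [(abs_le.1 this).2]

/-- The law of the output for a uniform input bit. -/
def symmLaw (c : Measure ℝ) : Measure ℝ := (2⁻¹ : ENNReal) • (c + c.map fun d => -d)

@[simp] theorem outputLaw_zero (c : Measure ℝ) : outputLaw c 0 = c := by simp [outputLaw]

@[simp] theorem outputLaw_one (c : Measure ℝ) : outputLaw c 1 = c.map fun d => -d := by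
  simp [outputLaw]

theorem zmod_two_cases (b : ZMod 2) : b = 0 ∨ b = 1 := by revert b; decide

theorem isProbabilityMeasure_outputLaw {c : Measure ℝ} [IsProbabilityMeasure c] (b : ZMod 2) :
    IsProbabilityMeasure (outputLaw c b) := by
  rcases zmod_two_cases b with rfl | rfl
  · simpa
  · simpa using Measure.isProbabilityMeasure_map (by fun_prop)

theorem IsBMS.outputLaw_prob {c : Measure ℝ} (hc : IsBMS c) (b : ZMod 2) :
    IsProbabilityMeasure (outputLaw c b) := by
  have := hc.prob
  exact isProbabilityMeasure_outputLaw b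

theorem isProbabilityMeasure_symmLaw {c : Measure ℝ} [IsProbabilityMeasure c] :
    IsProbabilityMeasure (symmLaw c) := by
  have : IsProbabilityMeasure (c.map fun d => -d) :=
    Measure.isProbabilityMeasure_map (by fun_prop)
  constructor
  simp only [symmLaw, Measure.smul_apply, Measure.add_apply, measure_univ, smul_eq_mul]
  rw [one_add_one_eq_two, ENNReal.inv_mul_cancel (by norm_num) (by norm_num)]

theorem IsBMS.symmLaw_prob {c : Measure ℝ} (hc : IsBMS c) : IsProbabilityMeasure (symmLaw c) := by
  have := hc.prob
  exact isProbabilityMeasure_symmLaw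

theorem map_neg_symmLaw (c : Measure ℝ) : (symmLaw c).map (fun d => -d) = symmLaw c := by
  unfold symmLaw
  rw [Measure.map_smul, Measure.map_add _ _ (by fun_prop), Measure.map_map (by fun_prop)
    (by fun_prop)]
  have : ((fun d : ℝ => -d) ∘ fun d => -d) = id := by funext d; simp
  rw [this, Measure.map_id, add_comm]

theorem IsBMS.ae_mem {c : Measure ℝ} (hc : IsBMS c) : ∀ᵐ y ∂c, y ∈ Set.Icc (-1 : ℝ) 1 :=
  hc.support

theorem IsBMS.ae_mem_neg {c : Measure ℝ} (hc : IsBMS c) :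
    ∀ᵐ y ∂(c.map fun d => -d), y ∈ Set.Icc (-1 : ℝ) 1 := by
  refine (ae_map_iff (by fun_prop) measurableSet_Icc).2 ?_
  filter_upwards [hc.ae_mem] with y hy
  exact ⟨by linarith [hy.2], by linarith [hy.1]⟩

theorem ae_symmLaw_iff {c : Measure ℝ} {p : ℝ → Prop} :
    (∀ᵐ y ∂(symmLaw c), p y) ↔ (∀ᵐ y ∂c, p y) ∧ ∀ᵐ y ∂(c.map fun d => -d), p y := by
  have h2 : (2⁻¹ : ENNReal) ≠ 0 := ENNReal.inv_ne_zero.2 (by norm_num)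
  rw [symmLaw, Measure.ae_ennreal_smul_measure_iff h2, ae_add_measure_iff]

theorem IsBMS.ae_symmLaw_mem {c : Measure ℝ} (hc : IsBMS c) :
    ∀ᵐ y ∂(symmLaw c), y ∈ Set.Icc (-1 : ℝ) 1 :=
  ae_symmLaw_iff.2 ⟨hc.ae_mem, hc.ae_mem_neg⟩

/-- The canonical output is its own posterior bias. -/
theorem IsBMS.isBias {c : Measure ℝ} (hc : IsBMS c) :
    IsBias (fun b => (2⁻¹ : ENNReal) • outputLaw c b) (symmLaw c) clamp where
  meas := measurable_clamp
  bound := abs_clamp_le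
  eq := by
    have := hc.prob
    have h0 : ∀ μ : Measure ℝ, (∀ᵐ y ∂μ, y ∈ Set.Icc (-1 : ℝ) 1) → ∀ s : ℝ, |s| = 1 →
        μ.withDensity (fun t => ENNReal.ofReal ((1 + s * clamp t) / 2)) =
          (2⁻¹ : ENNReal) • μ.withDensity (fun t => ENNReal.ofReal (1 + s * t)) := by
      intro μ hμ s hs
      rw [← withDensity_smul _ (by fun_prop)]
      refine withDensity_congr_ae ?_
      filter_upwards [hμ] with y hy
      rw [clamp_of_mem hy, Pi.smul_apply, smul_eq_mul, div_eq_inv_mul,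
        ENNReal.ofReal_mul (by norm_num), ENNReal.ofReal_inv_of_pos (by norm_num)]
      simp
    have hsum : ∀ μ : Measure ℝ, (∀ᵐ y ∂μ, y ∈ Set.Icc (-1 : ℝ) 1) →
        μ.withDensity (fun t => ENNReal.ofReal (1 - t)) +
          μ.withDensity (fun t => ENNReal.ofReal (1 + t)) = (2 : ENNReal) • μ := by
      intro μ hμ
      rw [← withDensity_add_left (by fun_prop)]
      rw [← withDensity_const]
      refine withDensity_congr_ae ?_
      filter_upwards [hμ] with y hy
      rw [Pi.add_apply, ← ENNReal.ofReal_add (by linarith [hy.2]) (by linarith [hy.1])]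
      norm_num
    have h2 : (2⁻¹ : ENNReal) * 2 = 1 := ENNReal.inv_mul_cancel (by norm_num) (by norm_num)
    intro b
    unfold symmLaw
    rw [withDensity_smul_measure, withDensity_add_measure, h0 c hc.ae_mem _ (abs_sgn b),
      h0 _ hc.ae_mem_neg _ (abs_sgn b), ← smul_add]
    congr 1
    -- The channel symmetry moves one of the two weighted laws onto the base measure of the other,
    -- where the weights 1 − t and 1 + t add up to 2.
    rcases zmod_two_cases b with rfl | rfl
    · simp only [sgn_zero, one_mul, outputLaw_zero]
      rw [← hc.symm, add_comm, hsum c hc.ae_mem, smul_smul, h2, one_smul]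
    · simp only [sgn_one, neg_mul, one_mul, outputLaw_one, ← sub_eq_add_neg]
      rw [hc.symm, add_comm, hsum _ hc.ae_mem_neg, smul_smul, h2, one_smul]

theorem IsBMS.outputLaw_eq {c : Measure ℝ} (hc : IsBMS c) (b : ZMod 2) :
    outputLaw c b = (symmLaw c).withDensity fun y => ENNReal.ofReal (1 + sgn b * clamp y) := by
  have h := congrArg (fun μ => (2 : ENNReal) • μ) (hc.isBias.eq b)
  rw [smul_smul, ENNReal.mul_inv_cancel (by norm_num) (by norm_num), one_smul,
    ← withDensity_smul _ (by fun_prop)] at h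
  rw [h]
  congr 1
  funext y
  rw [Pi.smul_apply, smul_eq_mul, ← ENNReal.ofReal_ofNat, ← ENNReal.ofReal_mul (by norm_num)]
  congr 1; ring

theorem outputLaw_dirac_zero (b : ZMod 2) :
    outputLaw (Measure.dirac (0 : ℝ)) b = Measure.dirac 0 := by
  rcases zmod_two_cases b with rfl | rfl
  · simp
  · rw [outputLaw_one, Measure.map_dirac' (by fun_prop)]; simp

/-- The erasure is itself a channel, so removing one output stays within the class of words of
channel outputs. -/
theorem isBMS_dirac_zero : IsBMS (Measure.dirac (0 : ℝ)) where
  prob := inferInstance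
  support := by
    rw [Measure.dirac_apply' _ measurableSet_Icc.compl]; simp
  symm := by
    rw [Measure.map_dirac' (by fun_prop), neg_zero]
    refine withDensity_congr_ae ?_
    rw [Filter.EventuallyEq, ae_dirac_iff (measurableSet_eq_fun (by fun_prop) (by fun_prop))]
    simp

/-! ### The entropy of a bit of given bias, seen through a channel -/

/-- The integral `∫ η(1 + δ y) dν(y)`, `η(x) = -x log x`, where `ν` is the law of the output `y` for
a uniform input bit. -/
def biasEntropy (c : Measure ℝ) (δ : ℝ) : ℝ :=
  ∫ y, Real.negMulLog (1 + δ * clamp y) ∂(symmLaw c)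

theorem continuous_biasEntropy (c : Measure ℝ) [IsProbabilityMeasure c] :
    Continuous (biasEntropy c) := by
  have := isProbabilityMeasure_symmLaw (c := c)
  have h1 : Continuous fun p : ℝ × ℝ => Real.negMulLog (1 + p.1 * clamp p.2) := by
    have := continuous_clamp
    fun_prop
  rw [continuous_iff_continuousAt]
  intro δ₀
  obtain ⟨C, hC⟩ := ((isCompact_Icc (a := δ₀ - 1) (b := δ₀ + 1)).prod
    (isCompact_Icc (a := (-1 : ℝ)) (b := 1))).exists_bound_of_continuousOn h1.continuousOn
  refine continuousAt_of_dominated (bound := fun _ => C) ?_ ?_ (integrable_const _) ?_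
  · refine Eventually.of_forall fun δ => ?_
    exact (h1.comp (by fun_prop : Continuous fun y : ℝ => (δ, y))).aestronglyMeasurable
  · filter_upwards [Icc_mem_nhds (by linarith : δ₀ - 1 < δ₀) (by linarith : δ₀ < δ₀ + 1)] with δ hδ
    refine Eventually.of_forall fun y => ?_
    have := hC (δ, clamp y) ⟨hδ, abs_le.1 (abs_clamp_le y)⟩
    simpa only [clamp_of_mem (abs_le.1 (abs_clamp_le y))] using this
  · refine Eventually.of_forall fun y => ?_
    exact (h1.comp (by fun_prop : Continuous fun δ : ℝ => (δ, y))).continuousAt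

theorem integrable_biasEntropy_comp {T : Type*} [MeasurableSpace T] (μ : Measure T)
    [IsFiniteMeasure μ] (c : Measure ℝ) [IsProbabilityMeasure c] {δ : T → ℝ} (hδ : Measurable δ)
    (h1 : ∀ t, |δ t| ≤ 1) : Integrable (fun t => biasEntropy c (δ t)) μ := by
  obtain ⟨C, hC⟩ := (isCompact_Icc (a := (-1 : ℝ)) (b := 1)).exists_bound_of_continuousOn
    (continuous_biasEntropy c).continuousOn
  exact Integrable.of_bound (C := C)
    ((continuous_biasEntropy c).measurable.comp hδ).aestronglyMeasurable
    (Eventually.of_forall fun t => hC _ (abs_le.1 (h1 t)))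

@[simp] theorem biasEntropy_zero (c : Measure ℝ) : biasEntropy c 0 = 0 := by
  simp [biasEntropy]

theorem biasEntropy_neg (c : Measure ℝ) (δ : ℝ) : biasEntropy c (-δ) = biasEntropy c δ := by
  unfold biasEntropy
  have hm : Measurable fun y => Real.negMulLog (1 + δ * clamp y) :=
    Real.continuous_negMulLog.measurable.comp (by fun_prop)
  conv_rhs => rw [← map_neg_symmLaw c]
  rw [integral_map (by fun_prop) hm.aestronglyMeasurable]
  simp [clamp_neg]

theorem biasEntropy_sgn (c : Measure ℝ) (b : ZMod 2) :
    biasEntropy c (sgn b) = biasEntropy c 1 := by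
  rcases zmod_two_cases b with rfl | rfl
  · simp
  · rw [sgn_one, biasEntropy_neg]

theorem integrable_biasEntropy (c : Measure ℝ) [IsProbabilityMeasure c] {δ : ℝ} (hδ : |δ| ≤ 1) :
    Integrable (fun y => Real.negMulLog (1 + δ * clamp y)) (symmLaw c) := by
  have := isProbabilityMeasure_symmLaw (c := c)
  exact integrable_negMulLog _ (by fun_prop)
    (Eventually.of_forall fun y => one_add_mul_nonneg hδ (abs_clamp_le y))
    (Eventually.of_forall fun y => one_add_mul_le hδ (abs_clamp_le y))

theorem integrable_clamp (μ : Measure ℝ) [IsFiniteMeasure μ] : Integrable clamp μ :=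
  Integrable.of_bound (C := 1) measurable_clamp.aestronglyMeasurable
    (Eventually.of_forall fun y => abs_clamp_le y)

theorem integral_clamp_symmLaw (c : Measure ℝ) : ∫ y, clamp y ∂(symmLaw c) = 0 := by
  have h : ∫ y, clamp y ∂(symmLaw c) = ∫ y, clamp (-y) ∂(symmLaw c) := by
    conv_lhs => rw [← map_neg_symmLaw c]
    rw [integral_map (by fun_prop) measurable_clamp.aestronglyMeasurable]
  simp only [clamp_neg, integral_neg] at h
  linarith

/-- Relative to the symmetrized law, c has density 1 + y, and (1 + y) log₂(2 / (1 + y)) = 1 + y +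
η(1 + y) / log 2, where y has mean zero. Parametrizing by entropy thus makes the value at bias ±1
affine in the parameter. -/
theorem IsBMS.biasEntropy_one {c : Measure ℝ} (hc : IsBMS c) :
    biasEntropy c 1 = Real.log 2 * (entropy c - 1) := by
  have := hc.prob
  have := hc.symmLaw_prob
  have h2 : Real.log 2 ≠ 0 := (Real.log_pos (by norm_num)).ne'
  have h1 : entropy c = ∫ y, (1 + clamp y + (Real.log 2)⁻¹ * Real.negMulLog (1 + 1 * clamp y))
      ∂(symmLaw c) := by
    have e : c = (symmLaw c).withDensity fun y => ENNReal.ofReal (1 + clamp y) := by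
      simpa using hc.outputLaw_eq 0
    rw [entropy]
    conv_lhs => rw [e]
    rw [integral_withDensity_eq_integral_toReal_smul (by fun_prop)
      (Eventually.of_forall fun t => ENNReal.ofReal_lt_top)]
    refine integral_congr_ae ?_
    filter_upwards [hc.ae_symmLaw_mem] with y hy
    rw [clamp_of_mem hy, ENNReal.toReal_ofReal (by linarith [hy.1]), smul_eq_mul, Real.logb,
      one_mul]
    rcases eq_or_ne (1 + y) 0 with h0 | h0
    · simp [h0]
    · rw [Real.log_div (by norm_num) h0, Real.negMulLog]
      field_simp
      ring
  have hi : Integrable (fun y => 1 + clamp y) (symmLaw c) :=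
    (integrable_const _).add (integrable_clamp _)
  rw [h1, integral_add hi
    ((integrable_biasEntropy c (by simp)).const_mul _), integral_add (integrable_const _)
    (integrable_clamp _), integral_clamp_symmLaw, integral_const_mul]
  simp only [integral_const, probReal_univ, smul_eq_mul, mul_one]
  rw [← biasEntropy]
  field_simp
  ring

/-! ### Degradation -/

/-- The log-sum inequality: the perspective A η(a / A) of the concave η is superadditive. -/
theorem negMulLog_add_mul_log_le {a a' A A' : ℝ} (ha : 0 ≤ a) (ha' : 0 ≤ a') (hA : a ≤ A)
    (hA' : a' ≤ A') :
    Real.negMulLog a + a * Real.log A + (Real.negMulLog a' + a' * Real.log A') ≤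
      Real.negMulLog (a + a') + (a + a') * Real.log (A + A') := by
  rw [← mul_negMulLog_div a A (by intro h; linarith),
    ← mul_negMulLog_div a' A' (by intro h; linarith),
    ← mul_negMulLog_div (a + a') (A + A') (by intro h; linarith)]
  rcases (add_nonneg (ha.trans hA) (ha'.trans hA')).eq_or_lt with h | h
  · have h1 : A = 0 := by linarith
    have h2 : A' = 0 := by linarith
    simp [h1, h2]
  have hw : A / (A + A') + A' / (A + A') = 1 := by field_simp
  have hc := Real.concaveOn_negMulLog.2
    (show a / A ∈ Set.Ici (0 : ℝ) from div_nonneg ha (ha.trans hA))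
    (show a' / A' ∈ Set.Ici (0 : ℝ) from div_nonneg ha' (ha'.trans hA'))
    (div_nonneg (ha.trans hA) h.le) (div_nonneg (ha'.trans hA') h.le) hw
  have e : (A / (A + A')) • (a / A) + (A' / (A + A')) • (a' / A') = (a + a') / (A + A') := by
    have e1 : ∀ {a A : ℝ}, 0 ≤ a → a ≤ A → A * (a / A) = a := by
      intro a A ha hA
      rcases eq_or_ne A 0 with h | h
      · rw [h] at hA ⊢; simp [le_antisymm hA ha]
      · field_simp
    rw [smul_eq_mul, smul_eq_mul, div_mul_eq_mul_div, div_mul_eq_mul_div, e1 ha hA, e1 ha' hA',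
      add_div]
  rw [e, smul_eq_mul, smul_eq_mul] at hc
  calc _ = (A + A') * (A / (A + A') * Real.negMulLog (a / A) +
        A' / (A + A') * Real.negMulLog (a' / A')) := by field_simp
    _ ≤ _ := mul_le_mul_of_nonneg_left hc h.le

/-- Superadditivity of the (unnormalized) binary entropy `η(a) + η(b) - η(a + b)`. -/
theorem negMulLog_superadditive {a b a' b' : ℝ} (ha : 0 ≤ a) (hb : 0 ≤ b) (ha' : 0 ≤ a')
    (hb' : 0 ≤ b') :
    Real.negMulLog a + Real.negMulLog b - Real.negMulLog (a + b) +
      (Real.negMulLog a' + Real.negMulLog b' - Real.negMulLog (a' + b')) ≤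
    Real.negMulLog (a + a') + Real.negMulLog (b + b') - Real.negMulLog (a + a' + (b + b')) := by
  have h1 := negMulLog_add_mul_log_le ha ha' (A := a + b) (A' := a' + b') (by linarith)
    (by linarith)
  have h2 := negMulLog_add_mul_log_le hb hb' (A := a + b) (A' := a' + b') (by linarith)
    (by linarith)
  have e : a + a' + (b + b') = a + b + (a' + b') := by ring
  rw [e]
  simp only [Real.negMulLog] at *
  linarith

/-- The unnormalized binary entropy is superadditive and homogeneous of degree one, hence concave,
and it is evaluated at the affine functions s(1 + δ₁y) and t(1 + δ₂y). The terms in η(s) and η(t)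
from expanding η of a product are affine in y and do not matter. -/
theorem concaveOn_negMulLog_defect {s t δ₁ δ₂ : ℝ} (hs : 0 ≤ s) (ht : 0 ≤ t)
    (h₁ : |δ₁| ≤ 1) (h₂ : |δ₂| ≤ 1) :
    ConcaveOn ℝ (Set.Icc (-1) 1) fun y => s * Real.negMulLog (1 + δ₁ * y) +
      t * Real.negMulLog (1 + δ₂ * y) - Real.negMulLog (s * (1 + δ₁ * y) + t * (1 + δ₂ * y)) := by
  refine ⟨convex_Icc _ _, ?_⟩
  intro x hx y hy p q hp hq hpq
  have hx' := abs_le.2 hx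
  have hy' := abs_le.2 hy
  have key := negMulLog_superadditive (mul_nonneg hp (mul_nonneg hs (one_add_mul_nonneg h₁ hx')))
    (mul_nonneg hp (mul_nonneg ht (one_add_mul_nonneg h₂ hx')))
    (mul_nonneg hq (mul_nonneg hs (one_add_mul_nonneg h₁ hy')))
    (mul_nonneg hq (mul_nonneg ht (one_add_mul_nonneg h₂ hy')))
  have e1 : p * (s * (1 + δ₁ * x)) + q * (s * (1 + δ₁ * y)) = s * (1 + δ₁ * (p * x + q * y)) := by
    linear_combination s * hpq
  have e2 : p * (t * (1 + δ₂ * x)) + q * (t * (1 + δ₂ * y)) = t * (1 + δ₂ * (p * x + q * y)) := by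
    linear_combination t * hpq
  rw [e1, e2, ← mul_add, ← mul_add] at key
  simp only [smul_eq_mul, Real.negMulLog_mul] at key ⊢
  linear_combination key - (Real.negMulLog s + Real.negMulLog t) * hpq

theorem integral_symmLaw_le_of_isDegraded {c c' : Measure ℝ} (hc : IsBMS c) (hc' : IsBMS c')
    (h : IsDegraded c c') {J : ℝ → ℝ} (hJ : ConvexOn ℝ (Set.Icc (-1) 1) J) (hJc : Continuous J) :
    ∫ y, J (clamp y) ∂(symmLaw c') ≤ ∫ y, J (clamp y) ∂(symmLaw c) := by
  obtain ⟨Q, hQ, hb⟩ := h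
  have := hc.symmLaw_prob
  refine integral_bias_le_of_bind hc.isBias hc'.isBias Q (fun b => ?_) hJ hJc
  rw [← hb b]
  ext s hs
  simp [Measure.bind_apply hs Q.aemeasurable]

/-- The increase of `biasEntropy` under degradation of the channel. -/
def biasGap (c c' : Measure ℝ) (δ : ℝ) : ℝ := biasEntropy c' δ - biasEntropy c δ

theorem continuous_biasGap {c c' : Measure ℝ} (hc : IsBMS c) (hc' : IsBMS c') :
    Continuous (biasGap c c') := by
  have := hc.prob
  have := hc'.prob
  exact (continuous_biasEntropy c').sub (continuous_biasEntropy c)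

/-- The Jensen defect of `biasEntropy` in δ is the mean of a concave function of the output y.
Degradation replaces the bias y by a conditional mean and so raises this average; the defect is
larger for c' than for c, which is convexity of the difference. -/
theorem convexOn_biasGap {c c' : Measure ℝ} (hc : IsBMS c) (hc' : IsBMS c')
    (h : IsDegraded c c') : ConvexOn ℝ (Set.Icc (-1) 1) (biasGap c c') := by
  refine ⟨convex_Icc _ _, ?_⟩
  intro δ₁ h₁ δ₂ h₂ s t hs ht hst
  have := hc.prob
  have := hc'.prob
  have h₁' := abs_le.2 h₁
  have h₂' := abs_le.2 h₂
  have h₃ : |s * δ₁ + t * δ₂| ≤ 1 := abs_le.2 (convex_Icc (-1 : ℝ) 1 h₁ h₂ hs ht hst)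
  have key := integral_symmLaw_le_of_isDegraded hc hc' h
    (concaveOn_negMulLog_defect hs ht h₁' h₂').neg (by
      simp only [Pi.neg_def]
      fun_prop)
  have e : ∀ d : Measure ℝ, IsProbabilityMeasure d → ∫ y, (-fun y => s * Real.negMulLog (1 + δ₁ * y)
      + t * Real.negMulLog (1 + δ₂ * y) -
      Real.negMulLog (s * (1 + δ₁ * y) + t * (1 + δ₂ * y))) (clamp y) ∂(symmLaw d) =
      -(s * biasEntropy d δ₁ + t * biasEntropy d δ₂ - biasEntropy d (s * δ₁ + t * δ₂)) := by
    intro d _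
    simp only [Pi.neg_apply]
    have e' : ∀ y, s * (1 + δ₁ * y) + t * (1 + δ₂ * y) = 1 + (s * δ₁ + t * δ₂) * y := by
      intro y; linear_combination hst
    simp only [e']
    have hi : Integrable (fun y => s * Real.negMulLog (1 + δ₁ * clamp y) +
        t * Real.negMulLog (1 + δ₂ * clamp y)) (symmLaw d) :=
      ((integrable_biasEntropy d h₁').const_mul s).add
        ((integrable_biasEntropy d h₂').const_mul t)
    rw [integral_neg, integral_sub hi (integrable_biasEntropy d h₃),
      integral_add ((integrable_biasEntropy d h₁').const_mul s)
      ((integrable_biasEntropy d h₂').const_mul t), integral_const_mul, integral_const_mul]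
    rfl
  rw [e c' inferInstance, e c inferInstance] at key
  simp only [biasGap, smul_eq_mul]
  linarith

/-- The gap is convex and even and vanishes at 0, the midpoint of δ and −δ. -/
theorem biasGap_nonneg {c c' : Measure ℝ} (hc : IsBMS c) (hc' : IsBMS c')
    (h : IsDegraded c c') {δ : ℝ} (hδ : |δ| ≤ 1) : 0 ≤ biasGap c c' δ := by
  have h1 := (convexOn_biasGap hc hc' h).2 (show δ ∈ Set.Icc (-1 : ℝ) 1 from abs_le.1 hδ)
    (show -δ ∈ Set.Icc (-1 : ℝ) 1 from abs_le.1 (by rwa [abs_neg]))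
    (show (0 : ℝ) ≤ 1 / 2 by norm_num) (show (0 : ℝ) ≤ 1 / 2 by norm_num) (by norm_num)
  have e : biasGap c c' (-δ) = biasGap c c' δ := by simp [biasGap, biasEntropy_neg]
  have e0 : (1 / 2 : ℝ) • δ + (1 / 2 : ℝ) • -δ = 0 := by simp
  rw [e0, e] at h1
  simp only [biasGap, biasEntropy_zero, smul_eq_mul] at h1 ⊢
  linarith

/-- A convex function lies below its chord, and at both endpoints ±1 the gap is the scaled entropy
difference. -/
theorem biasGap_le {c c' : Measure ℝ} (hc : IsBMS c) (hc' : IsBMS c')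
    (h : IsDegraded c c') {δ : ℝ} (hδ : |δ| ≤ 1) :
    biasGap c c' δ ≤ Real.log 2 * (entropy c' - entropy c) := by
  have hδ' := abs_le.1 hδ
  have h1 := (convexOn_biasGap hc hc' h).2 (show (1 : ℝ) ∈ Set.Icc (-1 : ℝ) 1 by norm_num)
    (show (-1 : ℝ) ∈ Set.Icc (-1 : ℝ) 1 by norm_num) (show 0 ≤ (1 + δ) / 2 by linarith)
    (show 0 ≤ (1 - δ) / 2 by linarith) (by ring)
  have e0 : ((1 + δ) / 2) • (1 : ℝ) + ((1 - δ) / 2) • (-1 : ℝ) = δ := by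
    simp only [smul_eq_mul]; ring
  have e : biasGap c c' 1 = Real.log 2 * (entropy c' - entropy c) := by
    rw [biasGap, hc.biasEntropy_one, hc'.biasEntropy_one]; ring
  have e' : biasGap c c' (-1) = Real.log 2 * (entropy c' - entropy c) := by
    rw [← e, biasGap, biasEntropy_neg, biasEntropy_neg, biasGap]
  rw [e0, e, e'] at h1
  simp only [smul_eq_mul] at h1
  linarith

/-! ### Conditional entropy as a function of the channel of one bit -/

theorem exists_density_le_one {T : Type*} [MeasurableSpace T] {α μ : Measure T}
    [IsFiniteMeasure μ] (h : α ≤ μ) :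
    ∃ p : T → ℝ, Measurable p ∧ (∀ t, 0 ≤ p t ∧ p t ≤ 1) ∧
      α = μ.withDensity fun t => ENNReal.ofReal (p t) := by
  have : IsFiniteMeasure α := isFiniteMeasure_of_le μ h
  -- The cap at 1 changes the density only on a null set and makes the bound hold everywhere.
  refine ⟨fun t => min 1 (α.rnDeriv μ t).toReal, by fun_prop, fun t =>
    ⟨le_min zero_le_one ENNReal.toReal_nonneg, min_le_left _ _⟩, ?_⟩
  conv_lhs => rw [← Measure.withDensity_rnDeriv_eq α μ h.absolutelyContinuous]
  refine withDensity_congr_ae ?_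
  filter_upwards [Measure.rnDeriv_le_one_of_le h, Measure.rnDeriv_lt_top α μ] with t h1 h2
  rw [min_eq_right, ENNReal.ofReal_toReal h2.ne]
  exact ENNReal.toReal_mono ENNReal.one_ne_top h1

theorem sum_density_ae_eq_one {S T : Type*} [Fintype S] [MeasurableSpace T] {α : S → Measure T}
    [IsFiniteMeasure (∑ s, α s)] {p : S → T → ℝ} (hp : ∀ s, Measurable (p s))
    (h0 : ∀ s t, 0 ≤ p s t)
    (h : ∀ s, α s = (∑ s, α s).withDensity fun t => ENNReal.ofReal (p s t)) :
    ∀ᵐ t ∂(∑ s, α s), ∑ s, p s t = 1 := by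
  have h1 : (∑ s, α s).withDensity (fun t => ENNReal.ofReal (∑ s, p s t)) =
      (∑ s, α s).withDensity 1 := by
    rw [withDensity_one]
    ext B hB
    rw [withDensity_apply _ hB]
    simp_rw [ENNReal.ofReal_sum_of_nonneg fun s _ => h0 s _]
    rw [lintegral_finsetSum _ fun s _ => (hp s).ennreal_ofReal]
    simp_rw [← withDensity_apply _ hB, ← h]
    simp
  have h2 := (withDensity_eq_iff (μ := ∑ s, α s)
    (Finset.measurable_fun_sum _ fun s _ => hp s).ennreal_ofReal.aemeasurable
    measurable_one.aemeasurable (by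
      rw [← setLIntegral_univ, ← withDensity_apply _ MeasurableSet.univ, h1, withDensity_one]
      exact measure_ne_top _ _)).1 h1
  filter_upwards [h2] with t ht
  rw [Pi.one_apply, ENNReal.ofReal_eq_one] at ht
  exact ht

/-- K and δ are chosen before the channel a, so a can vary with everything else fixed. The joint
density is p_s(z)(1 ± y); by η(pq) = pη(q) + qη(p) its symbolwise entropies split into a part free
of a and `biasEntropy a 1`, which does not see the sign. The total density is 1 + δ(z)y and
contributes `biasEntropy a (δ z)`. -/
theorem exists_condEntropy_eq {Ω S Z : Type*} [MeasurableSpace Ω] [MeasurableSpace S]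
    [MeasurableSingletonClass S] [Fintype S] [MeasurableSpace Z]
    (bit : S → ZMod 2) (α : S → Measure Z) [IsProbabilityMeasure (∑ s, α s)] :
    ∃ (K : ℝ) (δ : Z → ℝ),
      IsBias (fun b => ∑ s with bit s = b, α s) (∑ s, α s) δ ∧
      ∀ (P : Measure Ω) (a : Measure ℝ) (X : Ω → S) (V : Ω → Z × ℝ), IsProbabilityMeasure P →
        IsBMS a → Measurable X → Measurable V →
        (∀ s, (P.restrict (X ⁻¹' {s})).map V = (α s).prod (outputLaw a (bit s))) →
        condEntropy P X V =
          K + entropy a - (∫ z, biasEntropy a (δ z) ∂(∑ s, α s)) / Real.log 2 := by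
  have hle : ∀ s, α s ≤ ∑ s, α s := fun s =>
    Finset.single_le_sum (fun _ _ => Measure.zero_le _) (Finset.mem_univ s)
  choose p hpm hp01 hp using fun s => exists_density_le_one (hle s)
  have hsum := sum_density_ae_eq_one hpm (fun s t => (hp01 s t).1) hp
  set μ := ∑ s, α s with hμ
  have hdm : Measurable fun z => ∑ s, sgn (bit s) * p s z :=
    Finset.measurable_fun_sum _ fun s _ => (hpm s).const_mul _
  have hd1 : ∀ᵐ z ∂μ, |∑ s, sgn (bit s) * p s z| ≤ 1 := by
    filter_upwards [hsum] with z hz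
    calc |∑ s, sgn (bit s) * p s z| ≤ ∑ s, |sgn (bit s) * p s z| :=
          Finset.abs_sum_le_sum_abs _ _
      _ = 1 := by
          rw [← hz]
          refine Finset.sum_congr rfl fun s _ => ?_
          rw [abs_mul, abs_sgn, one_mul, abs_of_nonneg (hp01 s z).1]
  -- The −1 is the constant in `biasEntropy a 1 = log 2 · (entropy a − 1)`.
  refine ⟨(∫ z, ∑ s, Real.negMulLog (p s z) ∂μ) / Real.log 2 - 1,
    fun z => clamp (∑ s, sgn (bit s) * p s z), ⟨by fun_prop, fun z => abs_clamp_le _, ?_⟩, ?_⟩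
  · intro b
    have e : ∀ᵐ z ∂μ, ENNReal.ofReal ((1 + sgn b * clamp (∑ s, sgn (bit s) * p s z)) / 2) =
        ∑ s with bit s = b, ENNReal.ofReal (p s z) := by
      filter_upwards [hsum, hd1] with z hz h1
      rw [clamp_of_mem (abs_le.1 h1), ← ENNReal.ofReal_sum_of_nonneg fun s _ => (hp01 s z).1]
      congr 1
      rw [← hz, Finset.mul_sum, ← Finset.sum_add_distrib, Finset.sum_div, Finset.sum_filter]
      refine Finset.sum_congr rfl fun s _ => ?_
      rcases zmod_two_cases b with rfl | rfl <;> rcases zmod_two_cases (bit s) with h | h <;>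
        simp [h]
    rw [withDensity_congr_ae e]
    ext B hB
    rw [withDensity_apply _ hB, lintegral_finsetSum _ fun s _ => (hpm s).ennreal_ofReal]
    simp_rw [← withDensity_apply _ hB, ← hp]
    simp
  · intro P a X V hP ha hX hV hlaw
    have := ha.prob
    have := ha.symmLaw_prob
    set ν := symmLaw a with hν
    set w : S → Z × ℝ → ℝ := fun s t => p s t.1 * (1 + sgn (bit s) * clamp t.2) with hw
    have hs1 : ∀ s, |sgn (bit s)| ≤ 1 := fun s => (abs_sgn _).le
    have hw0 : ∀ s t, 0 ≤ w s t := fun s t =>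
      mul_nonneg (hp01 s _).1 (one_add_mul_nonneg (hs1 s) (abs_clamp_le _))
    have hw2 : ∀ s t, w s t ≤ 2 := fun s t => by
      have h1 := one_add_mul_le (hs1 s) (abs_clamp_le t.2)
      have h2 := one_add_mul_nonneg (hs1 s) (abs_clamp_le t.2)
      have := hp01 s t.1
      simp only [hw]
      nlinarith
    have hwm : ∀ s, Measurable (w s) := fun s => by
      have := hpm s
      fun_prop
    rw [condEntropy_eq_integral P hX hV (μ.prod ν) w hwm hw0 2 hw2 (by
      intro s
      rw [hlaw s, hp s, ha.outputLaw_eq, prod_withDensity ((hpm s).ennreal_ofReal) (by fun_prop)]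
      congr 1
      funext t
      rw [← ENNReal.ofReal_mul (hp01 s _).1])]
    have hlog : Real.log 2 ≠ 0 := (Real.log_pos (by norm_num)).ne'
    have hp_int : ∀ s, Integrable (fun z => p s z) μ := fun s =>
      Integrable.of_bound (C := 1) (hpm s).aestronglyMeasurable
        (Eventually.of_forall fun z => by
          rw [Real.norm_eq_abs, abs_of_nonneg (hp01 s z).1]; exact (hp01 s z).2)
    have hη_int : ∀ s, Integrable (fun z => Real.negMulLog (p s z)) μ := fun s =>
      integrable_negMulLog μ (hpm s) (M := 1) (Eventually.of_forall fun z => (hp01 s z).1)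
        (Eventually.of_forall fun z => (hp01 s z).2)
    have hinner : ∀ᵐ z ∂μ, ∫ y, (∑ s, Real.negMulLog (w s (z, y)) -
        Real.negMulLog (∑ s, w s (z, y))) ∂ν =
        biasEntropy a 1 + ∑ s, Real.negMulLog (p s z) -
          biasEntropy a (clamp (∑ s, sgn (bit s) * p s z)) := by
      filter_upwards [hsum, hd1] with z hz h1
      have e1 : ∀ y, ∑ s, w s (z, y) = 1 + clamp (∑ s, sgn (bit s) * p s z) * clamp y := by
        intro y
        rw [clamp_of_mem (abs_le.1 h1), ← hz, Finset.sum_mul, ← Finset.sum_add_distrib]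
        refine Finset.sum_congr rfl fun s _ => ?_
        simp only [hw]; ring
      have e2 : ∀ y s, Real.negMulLog (w s (z, y)) =
          p s z * Real.negMulLog (1 + sgn (bit s) * clamp y) +
            (1 + sgn (bit s) * clamp y) * Real.negMulLog (p s z) := by
        intro y s
        simp only [hw, Real.negMulLog_mul]; ring
      simp only [e1, e2]
      have i1 : ∀ s, Integrable
          (fun y => p s z * Real.negMulLog (1 + sgn (bit s) * clamp y)) ν := fun s =>
        (integrable_biasEntropy a (hs1 s)).const_mul _
      have i2 : ∀ s, Integrable
          (fun y => (1 + sgn (bit s) * clamp y) * Real.negMulLog (p s z)) ν := fun s =>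
        ((integrable_const _).add ((integrable_clamp ν).const_mul _)).mul_const _
      have i3 : ∀ s, Integrable
          (fun y => p s z * Real.negMulLog (1 + sgn (bit s) * clamp y) +
            (1 + sgn (bit s) * clamp y) * Real.negMulLog (p s z)) ν := fun s =>
        (i1 s).add (i2 s)
      rw [integral_sub (integrable_finsetSum _ fun s _ => i3 s)
        (integrable_biasEntropy a (abs_clamp_le _)), integral_finsetSum _ fun s _ => i3 s]
      congr 1
      have : ∀ s, ∫ y, (p s z * Real.negMulLog (1 + sgn (bit s) * clamp y) +
            (1 + sgn (bit s) * clamp y) * Real.negMulLog (p s z)) ∂ν =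
          p s z * biasEntropy a 1 + Real.negMulLog (p s z) := by
        intro s
        rw [integral_add (i1 s) (i2 s), integral_const_mul, integral_mul_const,
          integral_add (integrable_const _) ((integrable_clamp ν).const_mul _),
          integral_const_mul, hν, integral_clamp_symmLaw, ← biasEntropy, biasEntropy_sgn]
        simp
      rw [Finset.sum_congr rfl fun s _ => this s, Finset.sum_add_distrib, ← Finset.sum_mul, hz,
        one_mul]
    have hint : Integrable (fun t : Z × ℝ => ∑ s, Real.negMulLog (w s t) -
        Real.negMulLog (∑ s, w s t)) (μ.prod ν) := by
      refine Integrable.sub (integrable_finsetSum _ fun s _ => integrable_negMulLog _ (hwm s)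
        (Eventually.of_forall (hw0 s)) (Eventually.of_forall (hw2 s))) ?_
      refine integrable_negMulLog _ (Finset.measurable_fun_sum _ fun s _ => hwm s)
        (M := ∑ _s : S, 2)
        (Eventually.of_forall fun t => Finset.sum_nonneg fun s _ => hw0 s t)
        (Eventually.of_forall fun t => Finset.sum_le_sum fun s _ => hw2 s t)
    have hb_int : Integrable (fun z => biasEntropy a (clamp (∑ s, sgn (bit s) * p s z))) μ :=
      integrable_biasEntropy_comp μ a (by fun_prop) fun z => abs_clamp_le _
    have hs_int : Integrable (fun z => ∑ s, Real.negMulLog (p s z)) μ :=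
      integrable_finsetSum _ fun s _ => hη_int s
    have hc_int : Integrable (fun z => biasEntropy a 1 + ∑ s, Real.negMulLog (p s z)) μ :=
      (integrable_const _).add hs_int
    rw [integral_prod _ hint, integral_congr_ae hinner, integral_sub hc_int hb_int,
      integral_add (integrable_const _) hs_int, ha.biasEntropy_one]
    simp only [integral_const, probReal_univ, smul_eq_mul, one_mul]
    field_simp
    ring

/-! ### Product laws with one coordinate singled out -/

/-- The coordinate i drawn from ρ is overwritten, so ρ is immaterial; it will be the erasure. -/
theorem map_update_prod_pi {ι : Type*} [Fintype ι] [DecidableEq ι] (μ : ι → Measure ℝ)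
    [∀ j, IsProbabilityMeasure (μ j)] (i : ι) (ρ : Measure ℝ) [IsProbabilityMeasure ρ] :
    ((Measure.pi (Function.update μ i ρ)).prod (μ i)).map
      (fun t : (ι → ℝ) × ℝ => Function.update t.1 i t.2) = Measure.pi μ := by
  have hu : ∀ j, IsProbabilityMeasure (Function.update μ i ρ j) := by
    intro j
    rcases eq_or_ne j i with rfl | h
    · simpa
    · rw [Function.update_of_ne h]; infer_instance
  have hm : Measurable fun t : (ι → ℝ) × ℝ => Function.update t.1 i t.2 := by
    refine measurable_pi_iff.2 fun j => ?_
    rcases eq_or_ne j i with rfl | h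
    · simpa using measurable_snd
    · simp only [Function.update_of_ne h]; fun_prop
  refine (Measure.pi_eq fun s hs => ?_).symm
  rw [Measure.map_apply hm (MeasurableSet.univ_pi hs)]
  have e : (fun t : (ι → ℝ) × ℝ => Function.update t.1 i t.2) ⁻¹' Set.univ.pi s =
      (Set.univ.pi (Function.update s i Set.univ)) ×ˢ s i := by
    ext ⟨z, t⟩
    simp only [Set.mem_preimage, Set.mem_pi, Set.mem_univ, true_implies, Set.mem_prod]
    constructor
    · intro h
      refine ⟨fun j => ?_, by simpa using h i⟩
      rcases eq_or_ne j i with rfl | hj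
      · simp
      · have := h j
        rw [Function.update_of_ne hj] at this ⊢
        exact this
    · rintro ⟨h, h'⟩ j
      rcases eq_or_ne j i with rfl | hj
      · simpa
      · have := h j
        rw [Function.update_of_ne hj] at this ⊢
        exact this
  rw [e, Measure.prod_prod, Measure.pi_pi, ← Finset.prod_erase_mul _ _ (Finset.mem_univ i),
    ← Finset.prod_erase_mul (a := i) _ _ (Finset.mem_univ i)]
  congr 1
  simp only [Function.update_self, measure_univ, mul_one]
  refine Finset.prod_congr rfl fun j hj => ?_
  rw [Function.update_of_ne (Finset.ne_of_mem_erase hj),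
    Function.update_of_ne (Finset.ne_of_mem_erase hj)]

theorem ae_pi_update_dirac {ι : Type*} [Fintype ι] [DecidableEq ι] (μ : ι → Measure ℝ)
    [∀ j, IsProbabilityMeasure (μ j)] (i : ι) (r : ℝ) :
    ∀ᵐ z ∂(Measure.pi (Function.update μ i (Measure.dirac r))), z i = r := by
  have hu : ∀ j, IsProbabilityMeasure (Function.update μ i (Measure.dirac r) j) := by
    intro j
    rcases eq_or_ne j i with rfl | h
    · simp only [Function.update_self]; infer_instance
    · rw [Function.update_of_ne h]; infer_instance
  have h := (measurePreserving_eval (Function.update μ i (Measure.dirac r)) i)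
  have h2 : ∀ᵐ x ∂(Function.update μ i (Measure.dirac r) i), x = r := by
    rw [Function.update_self]
    exact (ae_dirac_iff (measurableSet_eq)).2 rfl
  exact h.quasiMeasurePreserving.ae h2

theorem measurable_update_right {ι : Type*} [DecidableEq ι] (i : ι) (r : ℝ) :
    Measurable fun y : ι → ℝ => Function.update y i r := by
  refine measurable_pi_iff.2 fun j => ?_
  rcases eq_or_ne j i with rfl | h
  · simp
  · simp only [Function.update_of_ne h]; fun_prop

/-- A statistic computed after overwriting coordinate i is independent of that coordinate. This
supplies the product form required by `exists_condEntropy_eq`. -/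
theorem map_pi_prodMk {ι Z : Type*} [Fintype ι] [DecidableEq ι] [MeasurableSpace Z]
    (μ : ι → Measure ℝ) [∀ j, IsProbabilityMeasure (μ j)] (i : ι) (r : ℝ)
    {ψ : (ι → ℝ) → Z} (hψ : Measurable ψ) :
    (Measure.pi μ).map (fun y => (ψ (Function.update y i r), y i)) =
      ((Measure.pi (Function.update μ i (Measure.dirac r))).map ψ).prod (μ i) := by
  have hu : ∀ j, IsProbabilityMeasure (Function.update μ i (Measure.dirac r) j) := by
    intro j
    rcases eq_or_ne j i with rfl | h
    · simp only [Function.update_self]; infer_instance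
    · rw [Function.update_of_ne h]; infer_instance
  have hm : Measurable fun t : (ι → ℝ) × ℝ => Function.update t.1 i t.2 := by
    refine measurable_pi_iff.2 fun j => ?_
    rcases eq_or_ne j i with rfl | h
    · simpa using measurable_snd
    · simp only [Function.update_of_ne h]; fun_prop
  have hm' := measurable_update_right i r
  conv_lhs => rw [← map_update_prod_pi μ i (Measure.dirac r)]
  rw [Measure.map_map (by fun_prop) hm]
  have e : ((fun y : ι → ℝ => (ψ (Function.update y i r), y i)) ∘
      fun t : (ι → ℝ) × ℝ => Function.update t.1 i t.2) =ᵐ[(Measure.pi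
        (Function.update μ i (Measure.dirac r))).prod (μ i)] Prod.map ψ id := by
    have := Measure.quasiMeasurePreserving_fst (μ := Measure.pi
        (Function.update μ i (Measure.dirac r))) (ν := μ i)
    filter_upwards [this.ae (ae_pi_update_dirac μ i r)] with t ht
    simp only [Function.comp_apply, Function.update_idem, Function.update_self, Prod.map, id]
    rw [← ht, Function.update_eq_self]
  rw [Measure.map_congr e, ← Measure.map_prod_map _ _ hψ measurable_id, Measure.map_id]

/-! ### The joint law of codeword and outputs -/

/-- The law of the outputs given that the word `x` is sent. -/
def wordLaw {n : ℕ} (c : Fin n → Measure ℝ) (x : Fin n → ZMod 2) : Measure (Fin n → ℝ) :=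
  Measure.pi fun j => outputLaw (c j) (x j)

theorem isProbabilityMeasure_wordLaw {n : ℕ} {c : Fin n → Measure ℝ}
    (hc : ∀ j, IsProbabilityMeasure (c j)) (x : Fin n → ZMod 2) :
    IsProbabilityMeasure (wordLaw c x) := by
  have : ∀ j, IsProbabilityMeasure (outputLaw (c j) (x j)) := fun j =>
    isProbabilityMeasure_outputLaw _
  unfold wordLaw; infer_instance

/-- The channels `c`, with the bit `i` erased. -/
def eraseAt {n : ℕ} (c : Fin n → Measure ℝ) (i : Fin n) : Fin n → Measure ℝ :=
  Function.update c i (Measure.dirac 0)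

theorem eraseAt_update {n : ℕ} (c : Fin n → Measure ℝ) (i : Fin n) (a : Measure ℝ) :
    eraseAt (Function.update c i a) i = eraseAt c i := by
  simp [eraseAt]

theorem forall_update {ι β : Type*} [DecidableEq ι] {p : β → Prop} {c : ι → β}
    (hc : ∀ j, p (c j)) {i : ι} {a : β} (ha : p a) (j : ι) : p (Function.update c i a j) := by
  rcases eq_or_ne j i with rfl | h
  · simpa
  · rw [Function.update_of_ne h]; exact hc j

theorem isBMS_eraseAt {n : ℕ} {c : Fin n → Measure ℝ} (hc : ∀ j, IsBMS (c j)) (i j : Fin n) :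
    IsBMS (eraseAt c i j) :=
  forall_update hc isBMS_dirac_zero j

theorem outputLaw_eraseAt {n : ℕ} (c : Fin n → Measure ℝ) (i : Fin n) (x : Fin n → ZMod 2) :
    (fun j => outputLaw (eraseAt c i j) (x j)) =
      Function.update (fun j => outputLaw (c j) (x j)) i (Measure.dirac 0) := by
  funext j
  rcases eq_or_ne j i with rfl | h
  · simp [eraseAt, outputLaw_dirac_zero]
  · simp [eraseAt, h]

open Classical in
/-- The part with `X_i = b` of the law of the outputs of a uniformly random codeword, the output
`i` being erased. -/
def erasedPart {n : ℕ} (C : Submodule (ZMod 2) (Fin n → ZMod 2)) (c : Fin n → Measure ℝ)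
    (i : Fin n) (b : ZMod 2) : Measure (Fin n → ℝ) :=
  ((Fintype.card C : ENNReal)⁻¹) • ∑ x : C with x.1 i = b, wordLaw (eraseAt c i) x.1

/-- The law of the outputs of a uniformly random codeword, the output `i` being erased. -/
def erasedLaw {n : ℕ} (C : Submodule (ZMod 2) (Fin n → ZMod 2)) (c : Fin n → Measure ℝ)
    (i : Fin n) : Measure (Fin n → ℝ) := erasedPart C c i 0 + erasedPart C c i 1

theorem sum_filter_zmod_two {ι M : Type*} [Fintype ι] [AddCommMonoid M] (f : ι → ZMod 2)
    (F : ι → M) : ∑ x with f x = 0, F x + ∑ x with f x = 1, F x = ∑ x, F x := by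
  rw [← Finset.sum_filter_add_sum_filter_not Finset.univ (fun x => f x = 0) F]
  congr 2
  ext x
  rcases zmod_two_cases (f x) with h | h <;> simp [h]

open Classical in
theorem erasedLaw_eq {n : ℕ} (C : Submodule (ZMod 2) (Fin n → ZMod 2)) (c : Fin n → Measure ℝ)
    (i : Fin n) :
    erasedLaw C c i = ((Fintype.card C : ENNReal)⁻¹) • ∑ x : C, wordLaw (eraseAt c i) x.1 := by
  rw [erasedLaw, erasedPart, erasedPart, ← smul_add,
    ← sum_filter_zmod_two (fun x : C => x.1 i) fun x => wordLaw (eraseAt c i) x.1]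

theorem isProbabilityMeasure_smul_sum {ι T : Type*} [Fintype ι] [Nonempty ι] [MeasurableSpace T]
    (μ : ι → Measure T) [∀ x, IsProbabilityMeasure (μ x)] :
    IsProbabilityMeasure (((Fintype.card ι : ENNReal)⁻¹) • ∑ x, μ x) := by
  constructor
  simp only [Measure.smul_apply, Measure.coe_finsetSum, Finset.sum_apply, measure_univ,
    Finset.sum_const, Finset.card_univ, nsmul_eq_mul, mul_one, smul_eq_mul]
  exact ENNReal.inv_mul_cancel (by simp) (by simp)

theorem isProbabilityMeasure_erasedLaw {n : ℕ} (C : Submodule (ZMod 2) (Fin n → ZMod 2))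
    {c : Fin n → Measure ℝ} (hc : ∀ j, IsProbabilityMeasure (c j)) (i : Fin n) :
    IsProbabilityMeasure (erasedLaw C c i) := by
  classical
  have : ∀ x : C, IsProbabilityMeasure (wordLaw (eraseAt c i) x.1) := fun x =>
    isProbabilityMeasure_wordLaw (forall_update hc inferInstance) _
  rw [erasedLaw_eq]
  exact isProbabilityMeasure_smul_sum _

theorem isProbabilityMeasure_jointLaw {n : ℕ} (C : Submodule (ZMod 2) (Fin n → ZMod 2))
    {c : Fin n → Measure ℝ} (hc : ∀ j, IsProbabilityMeasure (c j)) :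
    IsProbabilityMeasure (jointLaw C c) := by
  classical
  have : ∀ x : C, IsProbabilityMeasure (wordLaw c x.1) := fun x =>
    isProbabilityMeasure_wordLaw hc _
  have h : ∀ x : C, IsProbabilityMeasure ((Measure.dirac (x : Fin n → ZMod 2)).prod
      (Measure.pi fun i => outputLaw (c i) (x.1 i))) := fun x => by
    have := this x
    unfold wordLaw at this
    infer_instance
  unfold jointLaw
  convert isProbabilityMeasure_smul_sum fun x : C =>
    (Measure.dirac (x : Fin n → ZMod 2)).prod (Measure.pi fun i => outputLaw (c i) (x.1 i))

open Classical in
theorem restrict_map_jointLaw {n : ℕ} (C : Submodule (ZMod 2) (Fin n → ZMod 2))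
    {c : Fin n → Measure ℝ} (hc : ∀ j, IsProbabilityMeasure (c j)) {S T : Type*}
    [MeasurableSpace S] [MeasurableSingletonClass S] [MeasurableSpace T]
    (g : (Fin n → ZMod 2) → S) {V : (Fin n → ℝ) → T} (hV : Measurable V) (s : S) :
    ((jointLaw C c).restrict ((fun ω : (Fin n → ZMod 2) × (Fin n → ℝ) => g ω.1) ⁻¹' {s})).map
      (fun ω => V ω.2) =
    ((Fintype.card C : ENNReal)⁻¹) • ∑ x : C with g x.1 = s, (wordLaw c x.1).map V := by
  have hg : Measurable g := measurable_of_finite g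
  ext A hA
  rw [Measure.map_apply (by fun_prop) hA, Measure.restrict_apply (by measurability)]
  simp only [jointLaw, Measure.smul_apply, Measure.coe_finsetSum, Finset.sum_apply]
  congr 1
  · rw [Finset.sum_filter]
    refine Finset.sum_congr rfl fun x _ => ?_
    have := isProbabilityMeasure_wordLaw hc x.1
    unfold wordLaw at this ⊢
    rw [Measure.dirac_prod, Measure.map_apply (by fun_prop) (by measurability)]
    split_ifs with h
    · rw [Measure.map_apply hV hA]
      congr 1
      ext y; simp [h]
    · convert measure_empty (μ := Measure.pi fun i => outputLaw (c i) (x.1 i))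
      ext y; simp [h]

theorem map_finset_sum {ι T T' : Type*} [MeasurableSpace T] [MeasurableSpace T'] (s : Finset ι)
    (μ : ι → Measure T) {f : T → T'} (hf : Measurable f) :
    (∑ x ∈ s, μ x).map f = ∑ x ∈ s, (μ x).map f := by
  ext A hA
  simp [Measure.map_apply hf hA]

theorem sum_prod_measure {ι T T' : Type*} [MeasurableSpace T] [MeasurableSpace T'] (s : Finset ι)
    (μ : ι → Measure T) [∀ i, IsFiniteMeasure (μ i)] (ν : Measure T') [IsFiniteMeasure ν] :
    (∑ x ∈ s, μ x).prod ν = ∑ x ∈ s, (μ x).prod ν := by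
  ext A hA
  simp [Measure.prod_apply hA]

/-- The map g may be the identity or the evaluation at i, so the entropy of the word and that of the
bit get the same dependence on the channel a. The bias is computed from outputs with i erased, so a
does not enter it. -/
theorem exists_condEntropy_jointLaw {n : ℕ} (C : Submodule (ZMod 2) (Fin n → ZMod 2))
    {c : Fin n → Measure ℝ} (hc : ∀ j, IsBMS (c j)) (i : Fin n) {S Z : Type*}
    [MeasurableSpace S] [MeasurableSingletonClass S] [Fintype S] [MeasurableSpace Z]
    (g : (Fin n → ZMod 2) → S) (bit : S → ZMod 2) (hg : ∀ x, bit (g x) = x i)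
    {ψ : (Fin n → ℝ) → Z} (hψ : Measurable ψ) :
    ∃ (K : ℝ) (δ : Z → ℝ),
      IsBias (fun b => (erasedPart C c i b).map ψ) ((erasedLaw C c i).map ψ) δ ∧
      ∀ a, IsBMS a → condEntropy (jointLaw C (Function.update c i a)) (fun ω => g ω.1)
        (fun ω => (ψ (Function.update ω.2 i 0), ω.2 i)) =
          K + entropy a - (∫ z, biasEntropy a (δ z) ∂((erasedLaw C c i).map ψ)) / Real.log 2 := by
  classical
  have hce : ∀ j, IsProbabilityMeasure (eraseAt c i j) := fun j => (isBMS_eraseAt hc i j).prob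
  have hw : ∀ x, IsProbabilityMeasure (wordLaw (eraseAt c i) x) := isProbabilityMeasure_wordLaw hce
  have hwf : ∀ x, IsProbabilityMeasure ((wordLaw (eraseAt c i) x).map ψ) := fun x =>
    Measure.isProbabilityMeasure_map hψ.aemeasurable
  set α : S → Measure Z := fun s => ((Fintype.card C : ENNReal)⁻¹) •
    ∑ x : C with g x.1 = s, (wordLaw (eraseAt c i) x.1).map ψ with hα
  have hsum : ∀ b, ∑ s with bit s = b, α s = (erasedPart C c i b).map ψ := by
    intro b
    rw [erasedPart, Measure.map_smul, map_finset_sum _ _ hψ, hα]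
    simp only
    rw [← Finset.smul_sum]
    congr 1
    simp only [Finset.sum_filter]
    simp_rw [← Finset.sum_filter (fun s => bit s = b), Finset.sum_comm (t := Finset.univ)]
    refine Finset.sum_congr rfl fun x _ => ?_
    rw [Finset.sum_ite_eq]
    simp [hg]
  have htot : ∑ s, α s = (erasedLaw C c i).map ψ := by
    rw [erasedLaw, Measure.map_add _ _ hψ, ← hsum, ← hsum, sum_filter_zmod_two]
  have hprob : IsProbabilityMeasure (∑ s, α s) := by
    rw [htot]
    have := isProbabilityMeasure_erasedLaw C (fun j => (hc j).prob) i
    exact Measure.isProbabilityMeasure_map hψ.aemeasurable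
  obtain ⟨K, δ, hδ, hK⟩ := exists_condEntropy_eq
    (Ω := (Fin n → ZMod 2) × (Fin n → ℝ)) bit α
  rw [htot] at hδ hK
  simp only [hsum] at hδ
  refine ⟨K, δ, hδ, fun a ha => ?_⟩
  have hca : ∀ j, IsBMS (Function.update c i a j) := forall_update hc ha
  have hm := measurable_update_right i (0 : ℝ) (ι := Fin n)
  refine hK _ a _ _ (isProbabilityMeasure_jointLaw C fun j => (hca j).prob) ha
    ((measurable_of_finite g).comp measurable_fst) (by fun_prop) fun s => ?_
  rw [restrict_map_jointLaw C (fun j => (hca j).prob) g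
    (V := fun y => (ψ (Function.update y i 0), y i)) (by fun_prop), hα]
  have := ha.outputLaw_prob (bit s)
  rw [Measure.prod_smul_left, sum_prod_measure]
  congr 1
  refine Finset.sum_congr rfl fun x hx => ?_
  have hx' : g x.1 = s := (Finset.mem_filter.1 hx).2
  have hp : ∀ j, IsProbabilityMeasure (outputLaw (Function.update c i a j) (x.1 j)) := fun j =>
    (hca j).outputLaw_prob _
  rw [wordLaw, map_pi_prodMk _ i 0 hψ, wordLaw, ← outputLaw_eraseAt, eraseAt_update]
  simp [← hx', hg]

theorem condEntropy_congr_comap {Ω S T T' : Type*} [MeasurableSpace Ω] [MeasurableSpace T]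
    [MeasurableSpace T'] [Fintype S] (P : Measure Ω) (X : Ω → S) {Y : Ω → T} {Y' : Ω → T'}
    (h : MeasurableSpace.comap Y inferInstance = MeasurableSpace.comap Y' inferInstance) :
    condEntropy P X Y = condEntropy P X Y' := by
  rw [condEntropy, condEntropy, h]

/-- Splitting off one coordinate loses no information, which brings the word entropy into the form
of `exists_condEntropy_jointLaw`. -/
theorem condEntropy_jointLaw_eq {n : ℕ} (P : Measure ((Fin n → ZMod 2) × (Fin n → ℝ)))
    (i : Fin n) :
    condEntropy P (fun ω => ω.1) (fun ω => ω.2) =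
      condEntropy P (fun ω => ω.1) (fun ω => (Function.update ω.2 i 0, ω.2 i)) := by
  have hm := measurable_update_right i (0 : ℝ) (ι := Fin n)
  refine condEntropy_congr_comap P _ (le_antisymm ?_ ?_)
  · rintro _ ⟨A, hA, rfl⟩
    have hu : Measurable fun t : (Fin n → ℝ) × ℝ => Function.update t.1 i t.2 := by
      refine measurable_pi_iff.2 fun j => ?_
      rcases eq_or_ne j i with rfl | h
      · simpa using measurable_snd
      · simp only [Function.update_of_ne h]; fun_prop
    refine ⟨_, hu hA, ?_⟩
    ext ω
    simp
  · rintro _ ⟨A, hA, rfl⟩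
    have hu : Measurable fun y : Fin n → ℝ => (Function.update y i 0, y i) := by fun_prop
    exact ⟨_, hu hA, rfl⟩

/-! ### Degradation of all outputs -/

/-- The outputs through `c'` can be obtained from the outputs through `c` by a Markov kernel. -/
def IsDegradedWord {n : ℕ} (c c' : Fin n → Measure ℝ) : Prop :=
  ∃ K : Kernel (Fin n → ℝ) (Fin n → ℝ), IsMarkovKernel K ∧
    ∀ x, (wordLaw c x).bind K = wordLaw c' x

theorem IsDegradedWord.refl {n : ℕ} (c : Fin n → Measure ℝ) : IsDegradedWord c c :=
  ⟨Kernel.id, inferInstance, fun _ => Measure.id_comp⟩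

theorem IsDegradedWord.trans {n : ℕ} {c c' c'' : Fin n → Measure ℝ} (h : IsDegradedWord c c')
    (h' : IsDegradedWord c' c'') : IsDegradedWord c c'' := by
  obtain ⟨K, hK, hx⟩ := h
  obtain ⟨K', hK', hx'⟩ := h'
  refine ⟨K' ∘ₖ K, inferInstance, fun x => ?_⟩
  rw [← Measure.comp_assoc, hx, hx']

/-- The kernel keeps all coordinates except i, which it resamples from `Q (y i)`. -/
theorem isDegradedWord_update {n : ℕ} {c : Fin n → Measure ℝ}
    (hc : ∀ j, IsProbabilityMeasure (c j)) (i : Fin n) {a a' : Measure ℝ}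
    (ha : IsProbabilityMeasure a) (ha' : IsProbabilityMeasure a') (h : IsDegraded a a') :
    IsDegradedWord (Function.update c i a) (Function.update c i a') := by
  obtain ⟨Q, hQ, hb⟩ := h
  have hu : Measurable fun t : (Fin n → ℝ) × ℝ => Function.update t.1 i t.2 := by
    refine measurable_pi_iff.2 fun j => ?_
    rcases eq_or_ne j i with rfl | h
    · simpa using measurable_snd
    · simp only [Function.update_of_ne h]; fun_prop
  set K : Kernel (Fin n → ℝ) (Fin n → ℝ) :=
    (Kernel.id ×ₖ (Q.comap (fun y : Fin n → ℝ => y i) (measurable_pi_apply i))).map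
      (fun t => Function.update t.1 i t.2) with hK
  have hKm : IsMarkovKernel K := Kernel.IsMarkovKernel.map _ hu
  have hKA : ∀ y A, MeasurableSet A → K y A = Q (y i) ((fun t => Function.update y i t) ⁻¹' A) := by
    intro y A hA
    rw [hK, Kernel.map_apply' _ hu _ hA, Kernel.prod_apply, Kernel.id_apply, Kernel.comap_apply,
      Measure.dirac_prod, Measure.map_apply (by fun_prop) (hu hA)]
    rfl
  refine ⟨K, hKm, fun x => ?_⟩
  have hp : ∀ j, IsProbabilityMeasure (outputLaw (c j) (x j)) := fun j =>
    isProbabilityMeasure_outputLaw _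
  have e : ∀ d, IsProbabilityMeasure d → wordLaw (Function.update c i d) x =
      ((wordLaw (eraseAt c i) x).prod (outputLaw d (x i))).map
        (fun t : (Fin n → ℝ) × ℝ => Function.update t.1 i t.2) := by
    intro d hd
    have hp' : ∀ j, IsProbabilityMeasure (outputLaw (Function.update c i d j) (x j)) := fun j => by
      have := forall_update (p := fun d => IsProbabilityMeasure d) hc hd (i := i) j
      exact isProbabilityMeasure_outputLaw _
    have h1 := map_update_prod_pi (fun j => outputLaw (Function.update c i d j) (x j)) i
      (Measure.dirac 0)
    rw [wordLaw, ← h1, wordLaw, ← outputLaw_eraseAt, eraseAt_update]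
    simp
  have he := isProbabilityMeasure_wordLaw (c := eraseAt c i)
    (forall_update (p := fun d => IsProbabilityMeasure d) hc inferInstance) x
  have := isProbabilityMeasure_outputLaw (c := a) (x i)
  have := isProbabilityMeasure_outputLaw (c := a') (x i)
  ext A hA
  rw [Measure.bind_apply hA K.aemeasurable, e a ha, lintegral_map (K.measurable_coe hA) hu, e a' ha',
    Measure.map_apply hu hA, Measure.prod_apply (hu hA),
    lintegral_prod (fun t : (Fin n → ℝ) × ℝ => K (Function.update t.1 i t.2) A)
      ((K.measurable_coe hA).comp hu).aemeasurable]
  refine lintegral_congr fun y => ?_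
  have hy : Measurable fun t : ℝ => (y, t) := by fun_prop
  rw [← hb, Measure.bind_apply (hy (hu hA)) Q.aemeasurable]
  refine lintegral_congr fun t => ?_
  rw [hKA _ _ hA]
  simp only [Function.update_self, Function.update_idem]
  rfl

theorem isDegradedWord_of_forall {n : ℕ} {c c' : Fin n → Measure ℝ}
    (hc : ∀ j, IsProbabilityMeasure (c j)) (hc' : ∀ j, IsProbabilityMeasure (c' j))
    (h : ∀ j, IsDegraded (c j) (c' j)) : IsDegradedWord c c' := by
  classical
  have key : ∀ s : Finset (Fin n), IsDegradedWord c (s.piecewise c' c) := by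
    intro s
    induction s using Finset.induction_on with
    | empty => simpa using IsDegradedWord.refl c
    | insert j s hj ih =>
      refine ih.trans ?_
      rw [Finset.piecewise_insert]
      have e : s.piecewise c' c = Function.update (s.piecewise c' c) j (c j) := by
        conv_rhs => rw [← Finset.piecewise_eq_of_notMem s c' c hj]
        rw [Function.update_eq_self]
      conv => arg 1; rw [e]
      refine isDegradedWord_update (fun k => ?_) j (hc j) (hc' j) (h j)
      by_cases hk : k ∈ s
      · rw [Finset.piecewise_eq_of_mem _ _ _ hk]; exact hc' k
      · rw [Finset.piecewise_eq_of_notMem _ _ _ hk]; exact hc k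
  simpa using key Finset.univ

theorem isDegraded_refl (a : Measure ℝ) : IsDegraded a a :=
  ⟨Kernel.id, inferInstance, fun _ => Measure.id_comp⟩

theorem bind_erasedPart {n : ℕ} (C : Submodule (ZMod 2) (Fin n → ZMod 2))
    {c c' : Fin n → Measure ℝ} (i : Fin n) {T : Type*} [MeasurableSpace T]
    {K : Kernel (Fin n → ℝ) T} {ψ : (Fin n → ℝ) → T}
    (h : ∀ x, (wordLaw (eraseAt c i) x).bind K = (wordLaw (eraseAt c' i) x).map ψ)
    (hψ : Measurable ψ) (b : ZMod 2) :
    (erasedPart C c i b).bind K = (erasedPart C c' i b).map ψ := by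
  rw [erasedPart, erasedPart, Measure.map_smul, map_finset_sum _ _ hψ]
  simp_rw [← h]
  ext A hA
  simp [Measure.bind_apply hA K.aemeasurable]

/-- Comparison of the increments of the entropy of a codeword given all outputs and of the entropy
of the bit `i` given an extrinsic estimate and the output `i`, when the channel `a` of the bit `i`
is degraded to `a'`.  The extrinsic estimate may be based on further degraded outputs. -/
theorem condEntropy_increment_le {n : ℕ} (C : Submodule (ZMod 2) (Fin n → ZMod 2))
    {c c' : Fin n → Measure ℝ} (hc : ∀ j, IsBMS (c j)) (hc' : ∀ j, IsBMS (c' j)) (i : Fin n)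
    (hcc' : ∀ j, j ≠ i → IsDegraded (c j) (c' j)) {a a' : Measure ℝ} (ha : IsBMS a)
    (ha' : IsBMS a') (haa' : IsDegraded a a') {Z : Type*} [MeasurableSpace Z]
    {ψ : (Fin n → ℝ) → Z} (hψ : Measurable ψ) :
    0 ≤ condEntropy (jointLaw C (Function.update c i a')) (fun ω => ω.1) (fun ω => ω.2) -
      condEntropy (jointLaw C (Function.update c i a)) (fun ω => ω.1) (fun ω => ω.2) ∧
    condEntropy (jointLaw C (Function.update c i a')) (fun ω => ω.1) (fun ω => ω.2) -
      condEntropy (jointLaw C (Function.update c i a)) (fun ω => ω.1) (fun ω => ω.2) ≤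
    condEntropy (jointLaw C (Function.update c' i a')) (fun ω => ω.1 i)
        (fun ω => (ψ (Function.update ω.2 i 0), ω.2 i)) -
      condEntropy (jointLaw C (Function.update c' i a)) (fun ω => ω.1 i)
        (fun ω => (ψ (Function.update ω.2 i 0), ω.2 i)) := by
  have := ha.prob
  have := ha'.prob
  -- δ is the bias of bit i given all other outputs through c; δ' below is its bias given ψ of the
  -- outputs through c'.
  obtain ⟨K₁, δ, hδ, h₁⟩ := exists_condEntropy_jointLaw C hc i (fun x => x) (fun x => x i)
    (fun _ => rfl) (ψ := fun y => y) measurable_id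
  obtain ⟨K₂, δ', hδ', h₂⟩ := exists_condEntropy_jointLaw C hc' i (fun x => x i) (fun x => x)
    (fun _ => rfl) hψ
  simp only [Measure.map_id'] at hδ h₁
  have hm := measurable_update_right i (0 : ℝ) (ι := Fin n)
  have hp := isProbabilityMeasure_erasedLaw C (fun j => (hc j).prob) i
  have hp' := isProbabilityMeasure_erasedLaw C (fun j => (hc' j).prob) i
  have hp'' : IsProbabilityMeasure ((erasedLaw C c' i).map ψ) :=
    Measure.isProbabilityMeasure_map hψ.aemeasurable
  have hdeg : IsDegradedWord (eraseAt c i) (eraseAt c' i) := by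
    refine isDegradedWord_of_forall (fun j => (isBMS_eraseAt hc i j).prob)
      (fun j => (isBMS_eraseAt hc' i j).prob) fun j => ?_
    rcases eq_or_ne j i with rfl | h
    · simp only [eraseAt, Function.update_self]; exact isDegraded_refl _
    · simpa only [eraseAt, Function.update_of_ne h] using hcc' j h
  obtain ⟨K, hK, hx⟩ := hdeg
  have hKm : IsMarkovKernel (K.map ψ) := Kernel.IsMarkovKernel.map _ hψ
  -- Degrading c to c' and then applying ψ is a single kernel, so δ' is a coarsening of δ and the
  -- mean of the convex gap decreases. The gap enters the entropies with a minus sign.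
  have hgap := integral_bias_le_of_bind hδ hδ' (K.map ψ) (fun b => bind_erasedPart C i (fun x => by
    rw [← hx]
    ext A hA
    rw [Measure.bind_apply hA (Kernel.aemeasurable _), Measure.map_apply hψ hA,
      Measure.bind_apply (hψ hA) K.aemeasurable]
    exact lintegral_congr fun t => Kernel.map_apply' _ hψ _ hA) hψ b)
    (convexOn_biasGap ha ha' haa') (continuous_biasGap ha ha')
  -- This bound is the nonnegativity of the word increment.
  have hgap' : ∫ t, biasGap a a' (δ t) ∂(erasedLaw C c i) ≤
      Real.log 2 * (entropy a' - entropy a) := by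
    calc ∫ t, biasGap a a' (δ t) ∂(erasedLaw C c i)
        ≤ ∫ t, Real.log 2 * (entropy a' - entropy a) ∂(erasedLaw C c i) :=
          integral_mono ((integrable_biasEntropy_comp _ _ hδ.meas hδ.bound).sub (integrable_biasEntropy_comp _ _ hδ.meas hδ.bound))
            (integrable_const _) fun t => biasGap_le ha ha' haa' (hδ.bound t)
      _ = _ := by simp
  simp only [biasGap] at hgap hgap'
  rw [integral_sub (integrable_biasEntropy_comp _ _ hδ.meas hδ.bound) (integrable_biasEntropy_comp _ _ hδ.meas hδ.bound)] at hgap hgap'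
  rw [integral_sub (integrable_biasEntropy_comp _ _ hδ'.meas hδ'.bound) (integrable_biasEntropy_comp _ _ hδ'.meas hδ'.bound)] at hgap
  rw [condEntropy_jointLaw_eq _ i, condEntropy_jointLaw_eq _ i, h₁ a ha, h₁ a' ha', h₂ a ha,
    h₂ a' ha']
  have hlog : 0 < Real.log 2 := Real.log_pos (by norm_num)
  have h3 := div_le_div_of_nonneg_right hgap hlog.le
  have h4 := div_le_div_of_nonneg_right hgap' hlog.le
  rw [mul_div_cancel_left₀ _ hlog.ne'] at h4
  rw [sub_div, sub_div] at h3
  rw [sub_div] at h4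
  constructor <;> linarith

/-! ### Extrinsic estimates -/

theorem measurable_varRule {Ω ι : Type*} [MeasurableSpace Ω] {y : Ω → ℝ} (s : Finset ι)
    {d : Ω → ι → ℝ} (hy : Measurable y) (hd : ∀ a, Measurable fun ω => d ω a) :
    Measurable fun ω => varRule (y ω) s (d ω) := by
  unfold varRule
  have h1 : Measurable fun ω => ∏ a ∈ s, (1 + d ω a) :=
    Finset.measurable_fun_prod _ fun a _ => (hd a).const_add _
  have h2 : Measurable fun ω => ∏ a ∈ s, (1 - d ω a) :=
    Finset.measurable_fun_prod _ fun a _ => (hd a).const_sub _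
  fun_prop

theorem measurable_chkToVar {E : DegreeProfile} (G : E.Graph) (l : ℕ) (e : E.VarSocket) :
    Measurable fun y => chkToVar G y l e := by
  induction l generalizing e with
  | zero => simp only [chkToVar]; exact measurable_const
  | succ l ih =>
    simp only [chkToVar]
    refine Finset.measurable_fun_prod _ fun s _ => ?_
    unfold varToChk
    exact measurable_varRule _ (measurable_pi_apply _) fun s => ih _

theorem measurable_bpExtrinsic {E : DegreeProfile} (G : E.Graph) (l : ℕ) (i : Fin E.n) :
    Measurable (bpExtrinsic G l i) := by
  unfold bpExtrinsic
  exact measurable_varRule _ measurable_const fun s =>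
    (measurable_chkToVar G l _).comp (measurable_update_right i 0)

/-- The BP estimate never reads y_i, so it is an admissible ψ in `condEntropy_increment_le`. -/
theorem bpExtrinsic_update {E : DegreeProfile} (G : E.Graph) (l : ℕ) (i : Fin E.n)
    (y : Fin E.n → ℝ) : bpExtrinsic G l i (Function.update y i 0) = bpExtrinsic G l i y := by
  simp [bpExtrinsic]

/-! ### The entropy of a bit given a fixed extrinsic estimate -/

/-- `H(X_i | ψ, Y_i)` when the bit `i` is sent through `c u` and all others through `c h`. -/
def bitEntropy {n : ℕ} {Z : Type*} [MeasurableSpace Z] (c : ℝ → Measure ℝ)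
    (C : Submodule (ZMod 2) (Fin n → ZMod 2)) (ψ : (Fin n → ℝ) → Z) (i : Fin n) (h u : ℝ) : ℝ :=
  condEntropy (jointLaw C (Function.update (fun _ => c h) i (c u))) (fun ω => ω.1 i)
    (fun ω => (ψ (Function.update ω.2 i 0), ω.2 i))

theorem bpGexitBit_eq {E : DegreeProfile} (c : ℝ → Measure ℝ) (G : E.Graph) (l : ℕ)
    (i : Fin E.n) (h : ℝ) :
    bpGexitBit c G l i h = deriv (bitEntropy c (code G) (bpExtrinsic G l i) i h) h := by
  unfold bpGexitBit bitEntropy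
  simp only [bpExtrinsic_update]

theorem IsBMSFamily.biasEntropy_one {c : ℝ → Measure ℝ} (hc : IsBMSFamily c) {u : ℝ}
    (hu : u ∈ Set.Icc (0 : ℝ) 1) : biasEntropy (c u) 1 = Real.log 2 * (u - 1) := by
  rw [(hc u hu).1.biasEntropy_one, (hc u hu).2]

/-- The two bounds on `biasGap` give a Lipschitz constant uniform in δ, as needed to differentiate
under the integral over δ. -/
theorem abs_biasEntropy_sub_le {c : ℝ → Measure ℝ} (hc : IsBMSFamily c)
    (hdeg : IsDegradedFamily c) {u v : ℝ} (hu : u ∈ Set.Icc (0 : ℝ) 1)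
    (hv : v ∈ Set.Icc (0 : ℝ) 1) {δ : ℝ} (hδ : |δ| ≤ 1) :
    |biasEntropy (c u) δ - biasEntropy (c v) δ| ≤ Real.log 2 * |u - v| := by
  wlog huv : v ≤ u generalizing u v
  · rw [abs_sub_comm, abs_sub_comm u]
    exact this hv hu (le_of_not_ge huv)
  have h1 := biasGap_nonneg (hc v hv).1 (hc u hu).1 (hdeg v hv u hu huv) hδ
  have h2 := biasGap_le (hc v hv).1 (hc u hu).1 (hdeg v hv u hu huv) hδ
  rw [(hc v hv).2, (hc u hu).2] at h2
  unfold biasGap at h1 h2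
  rwa [abs_of_nonneg h1, abs_of_nonneg (by linarith)]

theorem integral_symmLaw {c : Measure ℝ} [IsProbabilityMeasure c] {f : ℝ → ℝ}
    (hf : Integrable f (symmLaw c)) :
    ∫ y, f y ∂(symmLaw c) = (∫ y, f y ∂(outputLaw c 0) + ∫ y, f y ∂(outputLaw c 1)) / 2 := by
  have h1 : Integrable f (c + c.map fun d => -d) := by
    rw [symmLaw] at hf
    exact (integrable_smul_measure (by simp) (by simp)).1 hf
  rw [symmLaw, integral_smul_measure, integral_add_measure h1.left_of_add_measure
    h1.right_of_add_measure, outputLaw_zero, outputLaw_one]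
  simp only [ENNReal.toReal_inv, ENNReal.toReal_ofNat, smul_eq_mul]
  ring

/-- For |δ| < 1 the argument 1 + δy avoids 0 on [−1, 1], so the integrand is a smooth test function.
For |δ| = 1 it has a logarithmic singularity in its derivative, but then the value is affine in the
parameter. -/
theorem differentiableAt_biasEntropy {c : ℝ → Measure ℝ} (hc : IsBMSFamily c)
    (hsmooth : IsSmoothFamilyOn c (Set.Ioo 0 1)) {u : ℝ} (hu : u ∈ Set.Ioo (0 : ℝ) 1) {δ : ℝ}
    (hδ : |δ| ≤ 1) : DifferentiableAt ℝ (fun u => biasEntropy (c u) δ) u := by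
  have hnhds : Set.Ioo (0 : ℝ) 1 ∈ 𝓝 u := isOpen_Ioo.mem_nhds hu
  rcases hδ.eq_or_lt with h | h
  · have hlin : DifferentiableAt ℝ (fun u => Real.log 2 * (u - 1)) u := by fun_prop
    refine hlin.congr_of_eventuallyEq ?_
    filter_upwards [hnhds] with v hv
    rw [← hc.biasEntropy_one (Set.Ioo_subset_Icc_self hv)]
    rcases (abs_eq zero_le_one).1 h with rfl | rfl
    · rfl
    · rw [biasEntropy_neg]
  · set f : ℝ → ℝ := fun y => Real.negMulLog (1 + δ * y) with hf
    have hfc : ContDiffOn ℝ 1 f (Set.Icc (-1) 1) := by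
      have hpos : ∀ y ∈ Set.Icc (-1 : ℝ) 1, 1 + δ * y ≠ 0 := by
        intro y hy
        have h1 : |δ * y| < 1 := by
          rw [abs_mul]
          calc |δ| * |y| ≤ |δ| * 1 := mul_le_mul_of_nonneg_left (abs_le.2 hy) (abs_nonneg _)
            _ < 1 := by linarith
        have := (abs_lt.1 h1).1
        linarith
      have hl : ContDiffOn ℝ 1 (fun y : ℝ => 1 + δ * y) (Set.Icc (-1) 1) := by fun_prop
      have := hl.neg.mul (hl.log hpos)
      exact this
    have hd : ∀ b, DifferentiableAt ℝ (fun u => ∫ y, f y ∂(outputLaw (c u) b)) u := fun b =>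
      ((hsmooth f hfc b).differentiableOn (by norm_num)).differentiableAt hnhds
    refine (((hd 0).add (hd 1)).div_const 2).congr_of_eventuallyEq ?_
    filter_upwards [hnhds] with v hv
    have hb := (hc v (Set.Ioo_subset_Icc_self hv)).1
    have := hb.prob
    rw [biasEntropy, integral_symmLaw (integrable_biasEntropy _ hδ)]
    simp only [outputLaw_zero, outputLaw_one, Pi.add_apply]
    congr 2
    · refine integral_congr_ae ?_
      filter_upwards [hb.ae_mem] with y hy
      rw [clamp_of_mem hy]
    · refine integral_congr_ae ?_
      filter_upwards [hb.ae_mem_neg] with y hy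
      rw [clamp_of_mem hy]

theorem differentiableAt_integral_biasEntropy {c : ℝ → Measure ℝ} (hc : IsBMSFamily c)
    (hdeg : IsDegradedFamily c) (hsmooth : IsSmoothFamilyOn c (Set.Ioo 0 1)) {T : Type*}
    [MeasurableSpace T] (μ : Measure T) [IsFiniteMeasure μ] {δ : T → ℝ} (hδ : Measurable δ)
    (h1 : ∀ t, |δ t| ≤ 1) {u : ℝ} (hu : u ∈ Set.Ioo (0 : ℝ) 1) :
    DifferentiableAt ℝ (fun u => ∫ t, biasEntropy (c u) (δ t) ∂μ) u := by
  have hnhds : Set.Ioo (0 : ℝ) 1 ∈ 𝓝 u := isOpen_Ioo.mem_nhds hu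
  obtain ⟨ε, hε, hball⟩ := Metric.mem_nhds_iff.1 hnhds
  have hd := fun t => (differentiableAt_biasEntropy hc hsmooth hu (h1 t)).hasDerivAt
  have hmeas : ∀ v ∈ Set.Ioo (0 : ℝ) 1, Integrable (fun t => biasEntropy (c v) (δ t)) μ := by
    intro v hv
    have := (hc v (Set.Ioo_subset_Icc_self hv)).1.prob
    exact integrable_biasEntropy_comp μ (c v) hδ h1
  -- The sequence serves only to show that the derivative is measurable in t, as a limit of slopes;
  -- the denominator k + 2 > 1 keeps its points inside the ball of radius ε.
  have hseq : Tendsto (fun k : ℕ => u + ε / (k + 2)) atTop (𝓝[≠] u) := by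
    refine tendsto_nhdsWithin_iff.2 ⟨?_, Eventually.of_forall fun k => ?_⟩
    · have : Tendsto (fun k : ℕ => ε / ((k : ℝ) + 2)) atTop (𝓝 0) :=
        Tendsto.div_atTop tendsto_const_nhds
          (tendsto_atTop_add_const_right _ _ tendsto_natCast_atTop_atTop)
      simpa using this.const_add u
    · have : 0 < ε / ((k : ℝ) + 2) := by positivity
      simp only [Set.mem_compl_iff, Set.mem_singleton_iff]
      linarith
  refine (hasDerivAt_integral_of_dominated_loc_of_lip (bound := fun _ => Real.log 2)
    (F' := fun t => deriv (fun u => biasEntropy (c u) (δ t)) u) hnhds ?_ (hmeas u hu) ?_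
    ?_ (integrable_const _) ?_).2.differentiableAt
  · filter_upwards [hnhds] with v hv using (hmeas v hv).aestronglyMeasurable
  · refine aestronglyMeasurable_of_tendsto_ae atTop (f := fun (k : ℕ) t =>
      slope (fun u => biasEntropy (c u) (δ t)) u (u + ε / (k + 2))) (fun k => ?_)
      (Eventually.of_forall fun t => (hasDerivAt_iff_tendsto_slope.1 (hd t)).comp hseq)
    have hk : u + ε / ((k : ℝ) + 2) ∈ Set.Ioo (0 : ℝ) 1 := by
      refine hball ?_
      rw [Metric.mem_ball, Real.dist_eq, add_sub_cancel_left, abs_of_pos (by positivity)]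
      exact div_lt_self hε (by have : (0 : ℝ) ≤ k := Nat.cast_nonneg k; linarith)
    simp only [slope_def_field]
    exact (((hmeas _ hk).sub (hmeas u hu)).div_const _).aestronglyMeasurable
  · refine Eventually.of_forall fun t => ?_
    refine LipschitzOnWith.of_dist_le_mul fun v hv w hw => ?_
    rw [Real.dist_eq, Real.dist_eq, Real.coe_nnabs,
      abs_of_pos (Real.log_pos (by norm_num : (1 : ℝ) < 2))]
    exact abs_biasEntropy_sub_le hc hdeg (Set.Ioo_subset_Icc_self hv)
      (Set.Ioo_subset_Icc_self hw) (h1 t)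
  · exact Eventually.of_forall hd

section Bit

variable {c : ℝ → Measure ℝ} {n : ℕ} (C : Submodule (ZMod 2) (Fin n → ZMod 2)) {Z : Type*}
  [MeasurableSpace Z] {ψ : (Fin n → ℝ) → Z} (i : Fin n)

theorem exists_bitEntropy_eq (hc : IsBMSFamily c) (hψ : Measurable ψ) {h : ℝ}
    (hh : h ∈ Set.Icc (0 : ℝ) 1) :
    ∃ (K : ℝ) (δ : Z → ℝ),
      IsBias (fun b => (erasedPart C (fun _ => c h) i b).map ψ)
        ((erasedLaw C (fun _ => c h) i).map ψ) δ ∧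
      ∀ u ∈ Set.Icc (0 : ℝ) 1, bitEntropy c C ψ i h u = K + u -
        (∫ z, biasEntropy (c u) (δ z) ∂((erasedLaw C (fun _ => c h) i).map ψ)) / Real.log 2 := by
  obtain ⟨K, δ, hδ, hK⟩ := exists_condEntropy_jointLaw C (c := fun _ => c h)
    (fun _ => (hc h hh).1) i (fun x => x i) (fun x => x) (fun _ => rfl) hψ
  refine ⟨K, δ, hδ, fun u hu => ?_⟩
  have := hK (c u) (hc u hu).1
  rwa [(hc u hu).2] at this

theorem isProbabilityMeasure_map_erasedLaw (hc : IsBMSFamily c) (hψ : Measurable ψ) {h : ℝ}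
    (hh : h ∈ Set.Icc (0 : ℝ) 1) :
    IsProbabilityMeasure ((erasedLaw C (fun _ => c h) i).map ψ) := by
  have := isProbabilityMeasure_erasedLaw C (fun _ => (hc h hh).1.prob) i
  exact Measure.isProbabilityMeasure_map hψ.aemeasurable

theorem differentiableAt_bitEntropy (hc : IsBMSFamily c) (hdeg : IsDegradedFamily c)
    (hsmooth : IsSmoothFamilyOn c (Set.Ioo 0 1)) (hψ : Measurable ψ) {h : ℝ}
    (hh : h ∈ Set.Icc (0 : ℝ) 1) {u : ℝ} (hu : u ∈ Set.Ioo (0 : ℝ) 1) :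
    DifferentiableAt ℝ (bitEntropy c C ψ i h) u := by
  obtain ⟨K, δ, hδ, hK⟩ := exists_bitEntropy_eq C i hc hψ hh
  have := isProbabilityMeasure_map_erasedLaw C i hc hψ hh
  have hd := differentiableAt_integral_biasEntropy hc hdeg hsmooth
    ((erasedLaw C (fun _ => c h) i).map ψ) hδ.meas hδ.bound hu
  have h2 : DifferentiableAt ℝ (fun u => K + u -
      (∫ z, biasEntropy (c u) (δ z) ∂((erasedLaw C (fun _ => c h) i).map ψ)) / Real.log 2) u :=
    (differentiableAt_id.const_add K).sub (hd.div_const _)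
  refine h2.congr_of_eventuallyEq ?_
  filter_upwards [isOpen_Ioo.mem_nhds hu] with v hv
  exact hK v (Set.Ioo_subset_Icc_self hv)

theorem bitEntropy_sub_mem (hc : IsBMSFamily c) (hdeg : IsDegradedFamily c) (hψ : Measurable ψ)
    {h : ℝ} (hh : h ∈ Set.Icc (0 : ℝ) 1) {u v : ℝ} (hu : u ∈ Set.Icc (0 : ℝ) 1)
    (hv : v ∈ Set.Icc (0 : ℝ) 1) (huv : u ≤ v) :
    bitEntropy c C ψ i h v - bitEntropy c C ψ i h u ∈ Set.Icc 0 (v - u) := by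
  obtain ⟨K, δ, hδ, hK⟩ := exists_bitEntropy_eq C i hc hψ hh
  have := isProbabilityMeasure_map_erasedLaw C i hc hψ hh
  have := (hc u hu).1.prob
  have := (hc v hv).1.prob
  set μ := (erasedLaw C (fun _ => c h) i).map ψ
  have hlog : 0 < Real.log 2 := Real.log_pos (by norm_num)
  have i1 := integrable_biasEntropy_comp μ (c u) hδ.meas hδ.bound
  have i2 := integrable_biasEntropy_comp μ (c v) hδ.meas hδ.bound
  have h1 : 0 ≤ ∫ z, biasGap (c u) (c v) (δ z) ∂μ := integral_nonneg fun z =>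
    biasGap_nonneg (hc u hu).1 (hc v hv).1 (hdeg u hu v hv huv) (hδ.bound z)
  have h2 : ∫ z, biasGap (c u) (c v) (δ z) ∂μ ≤ Real.log 2 * (v - u) := by
    calc ∫ z, biasGap (c u) (c v) (δ z) ∂μ ≤ ∫ _, Real.log 2 * (v - u) ∂μ := by
          refine integral_mono (i2.sub i1) (integrable_const _) fun z => ?_
          have := biasGap_le (hc u hu).1 (hc v hv).1 (hdeg u hu v hv huv) (hδ.bound z)
          rwa [(hc u hu).2, (hc v hv).2] at this
      _ = _ := by simp
  simp only [biasGap] at h1 h2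
  rw [integral_sub i2 i1] at h1 h2
  have h3 := div_le_div_of_nonneg_right h2 hlog.le
  have h4 := div_nonneg h1 hlog.le
  rw [mul_div_cancel_left₀ _ hlog.ne', sub_div] at h3
  rw [sub_div] at h4
  rw [hK v hv, hK u hu]
  constructor <;> linarith

/-- Left slopes are used because `wordEntropy_sub_le` takes the upper, noisier parameter as the
reference for all other bits. -/
theorem tendsto_bitEntropy_slope (hc : IsBMSFamily c) (hdeg : IsDegradedFamily c)
    (hsmooth : IsSmoothFamilyOn c (Set.Ioo 0 1)) (hψ : Measurable ψ) {h : ℝ}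
    (hh : h ∈ Set.Ioo (0 : ℝ) 1) :
    Tendsto (slope (bitEntropy c C ψ i h) h) (𝓝[<] h) (𝓝 (deriv (bitEntropy c C ψ i h) h)) :=
  (hasDerivAt_iff_tendsto_slope.1 (differentiableAt_bitEntropy C i hc hdeg hsmooth hψ
    (Set.Ioo_subset_Icc_self hh) hh).hasDerivAt).mono_left
    (nhdsWithin_mono _ fun _ hx => ne_of_lt hx)

theorem eventually_mem_Ioo {h : ℝ} (hh : h ∈ Set.Ioo (0 : ℝ) 1) :
    ∀ᶠ u in 𝓝[<] h, u < h ∧ u ∈ Set.Ioo (0 : ℝ) 1 :=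
  (eventually_mem_nhdsWithin (s := Set.Iio h)).and
    (nhdsWithin_le_nhds (isOpen_Ioo.mem_nhds hh))

theorem deriv_bitEntropy_mem (hc : IsBMSFamily c) (hdeg : IsDegradedFamily c)
    (hsmooth : IsSmoothFamilyOn c (Set.Ioo 0 1)) (hψ : Measurable ψ) {h : ℝ}
    (hh : h ∈ Set.Ioo (0 : ℝ) 1) : deriv (bitEntropy c C ψ i h) h ∈ Set.Icc (0 : ℝ) 1 := by
  refine isClosed_Icc.mem_of_tendsto (tendsto_bitEntropy_slope C i hc hdeg hsmooth hψ hh) ?_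
  filter_upwards [eventually_mem_Ioo hh] with u hu
  have := bitEntropy_sub_mem C i hc hdeg hψ (Set.Ioo_subset_Icc_self hh)
    (Set.Ioo_subset_Icc_self hu.2) (Set.Ioo_subset_Icc_self hh) hu.1.le
  rw [slope_comm, slope_def_field]
  have hpos : 0 < h - u := sub_pos.2 hu.1
  exact ⟨div_nonneg this.1 hpos.le, div_le_one_of_le₀ this.2 hpos.le⟩

end Bit

/-! ### The entropy of the codeword -/

/-- `H(X | Y)` when every bit is sent through `c h`. -/
def wordEntropy {n : ℕ} (c : ℝ → Measure ℝ) (C : Submodule (ZMod 2) (Fin n → ZMod 2)) (h : ℝ) : ℝ :=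
  condEntropy (jointLaw C fun _ => c h) (fun ω => ω.1) (fun ω => ω.2)

section Word

variable {c : ℝ → Measure ℝ} {n : ℕ} (C : Submodule (ZMod 2) (Fin n → ZMod 2)) {Z : Type*}
  [MeasurableSpace Z] {ψ : Fin n → (Fin n → ℝ) → Z}

/-- Bits are switched from v to u one at a time. At every stage the remaining bits see c u or c v,
both of which degrade to c v, so each increment is bounded by the one-bit increment with all other
bits at v. -/
theorem wordEntropy_sub_le (hc : IsBMSFamily c) (hdeg : IsDegradedFamily c)
    (hψ : ∀ i, Measurable (ψ i)) {u v : ℝ} (hu : u ∈ Set.Icc (0 : ℝ) 1)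
    (hv : v ∈ Set.Icc (0 : ℝ) 1) (huv : u ≤ v) :
    0 ≤ wordEntropy c C v - wordEntropy c C u ∧
    wordEntropy c C v - wordEntropy c C u ≤
      ∑ i, (bitEntropy c C (ψ i) i v v - bitEntropy c C (ψ i) i v u) := by
  classical
  have key : ∀ s : Finset (Fin n), 0 ≤ wordEntropy c C v -
      condEntropy (jointLaw C (s.piecewise (fun _ => c u) (fun _ => c v))) (fun ω => ω.1)
        (fun ω => ω.2) ∧
      wordEntropy c C v -
      condEntropy (jointLaw C (s.piecewise (fun _ => c u) (fun _ => c v))) (fun ω => ω.1)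
        (fun ω => ω.2) ≤
      ∑ i ∈ s, (bitEntropy c C (ψ i) i v v - bitEntropy c C (ψ i) i v u) := by
    intro s
    induction s using Finset.induction_on with
    | empty => simp [wordEntropy]
    | insert i s hi ih =>
      rw [Finset.piecewise_insert, Finset.sum_insert hi]
      set d := s.piecewise (fun _ => c u) (fun _ => c v) with hd
      have e : d = Function.update d i (c v) := by
        conv_rhs => rw [← Finset.piecewise_eq_of_notMem s (fun _ => c u) (fun _ => c v) hi]
        rw [← hd, Function.update_eq_self]
      have hdB : ∀ j, IsBMS (d j) ∧ IsDegraded (d j) (c v) := by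
        intro j
        by_cases hj : j ∈ s
        · rw [hd, Finset.piecewise_eq_of_mem _ _ _ hj]
          exact ⟨(hc u hu).1, hdeg u hu v hv huv⟩
        · rw [hd, Finset.piecewise_eq_of_notMem _ _ _ hj]
          exact ⟨(hc v hv).1, isDegraded_refl _⟩
      have h1 := condEntropy_increment_le C (c := d) (c' := fun _ => c v) (fun j => (hdB j).1)
        (fun _ => (hc v hv).1) i (fun j _ => (hdB j).2) (hc u hu).1 (hc v hv).1
        (hdeg u hu v hv huv) (hψ i)
      rw [← e] at h1
      change _ ∧ _ ≤ bitEntropy c C (ψ i) i v v - bitEntropy c C (ψ i) i v u at h1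
      constructor <;> linarith [h1.1, h1.2, ih.1, ih.2]
  simpa [wordEntropy] using key Finset.univ

/-- Each of the n one-bit increments is at most u − v, already with ψ the identity. -/
theorem lipschitzOnWith_wordEntropy (hc : IsBMSFamily c) (hdeg : IsDegradedFamily c) :
    LipschitzOnWith (n : NNReal) (wordEntropy c C) (Set.Icc 0 1) := by
  refine LipschitzOnWith.of_dist_le_mul fun u hu v hv => ?_
  wlog huv : v ≤ u generalizing u v
  · rw [dist_comm, dist_comm u]
    exact this v hv u hu (le_of_not_ge huv)
  obtain ⟨h1, h2⟩ := wordEntropy_sub_le C hc hdeg (ψ := fun _ (y : Fin n → ℝ) => y)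
    (fun _ => measurable_id) hv hu huv
  rw [Real.dist_eq, Real.dist_eq, abs_of_nonneg h1, abs_of_nonneg (by linarith)]
  refine h2.trans ?_
  calc _ ≤ ∑ _i : Fin n, (u - v) := Finset.sum_le_sum fun i _ =>
        (bitEntropy_sub_mem C i hc hdeg measurable_id hu hv hu huv).2
    _ = _ := by simp [mul_sub]

theorem deriv_wordEntropy_le (hc : IsBMSFamily c) (hdeg : IsDegradedFamily c)
    (hsmooth : IsSmoothFamilyOn c (Set.Ioo 0 1)) (hψ : ∀ i, Measurable (ψ i)) {h : ℝ}
    (hh : h ∈ Set.Ioo (0 : ℝ) 1) (hd : DifferentiableAt ℝ (wordEntropy c C) h) :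
    deriv (wordEntropy c C) h ≤ ∑ i, deriv (bitEntropy c C (ψ i) i h) h := by
  have h1 : Tendsto (slope (wordEntropy c C) h) (𝓝[<] h) (𝓝 (deriv (wordEntropy c C) h)) :=
    (hasDerivAt_iff_tendsto_slope.1 hd.hasDerivAt).mono_left
      (nhdsWithin_mono _ fun _ hx => ne_of_lt hx)
  have h2 := tendsto_finsetSum Finset.univ fun i (_ : i ∈ Finset.univ) =>
    tendsto_bitEntropy_slope C i hc hdeg hsmooth (hψ i) hh
  refine le_of_tendsto_of_tendsto h1 h2 ?_
  filter_upwards [eventually_mem_Ioo hh] with u hu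
  have h3 := (wordEntropy_sub_le C hc hdeg hψ (Set.Ioo_subset_Icc_self hu.2)
    (Set.Ioo_subset_Icc_self hh) hu.1.le).2
  have hpos : 0 < h - u := sub_pos.2 hu.1
  rw [slope_comm, slope_def_field]
  calc _ ≤ (∑ i, (bitEntropy c C (ψ i) i h h - bitEntropy c C (ψ i) i h u)) / (h - u) :=
        div_le_div_of_nonneg_right h3 hpos.le
    _ = _ := by
        rw [Finset.sum_div]
        refine Finset.sum_congr rfl fun i _ => ?_
        rw [slope_comm, slope_def_field]

end Word

/-! ### Measurability in the channel parameter -/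

open Classical in
/-- The family `c` on `(0, 1)`, extended by the erasure. -/
def extendFamily (c : ℝ → Measure ℝ) (h : ℝ) : Measure ℝ :=
  if h ∈ Set.Ioo (0 : ℝ) 1 then c h else Measure.dirac 0

theorem extendFamily_of_mem {c : ℝ → Measure ℝ} {h : ℝ} (hh : h ∈ Set.Ioo (0 : ℝ) 1) :
    extendFamily c h = c h := if_pos hh

theorem isBMS_extendFamily {c : ℝ → Measure ℝ} (hc : IsBMSFamily c) (h : ℝ) :
    IsBMS (extendFamily c h) := by
  unfold extendFamily
  split_ifs with hh
  · exact (hc h (Set.Ioo_subset_Icc_self hh)).1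
  · exact isBMS_dirac_zero

theorem measurable_integral_extendFamily {c : ℝ → Measure ℝ}
    (hsmooth : IsSmoothFamilyOn c (Set.Ioo 0 1)) {f : ℝ → ℝ} (hf : ContDiff ℝ 1 f) :
    Measurable fun h => ∫ y, f y ∂(extendFamily c h) := by
  classical
  have h1 : ContinuousOn (fun h => ∫ y, f y ∂(c h)) (Set.Ioo 0 1) := by
    simpa using (hsmooth f hf.contDiffOn 0).continuousOn
  have h2 := ContinuousOn.measurable_piecewise h1
    (continuousOn_const (c := ∫ y, f y ∂(Measure.dirac (0 : ℝ))) (s := (Set.Ioo (0 : ℝ) 1)ᶜ))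
    measurableSet_Ioo
  convert h2 using 1
  funext h
  by_cases hh : h ∈ Set.Ioo (0 : ℝ) 1
  · rw [Set.piecewise_eq_of_mem _ _ _ hh, extendFamily_of_mem hh]
  · rw [Set.piecewise_eq_of_notMem _ _ _ hh, extendFamily, if_neg hh]

/-- Smoothness controls only C¹ test functions. The indicator of a half-line is a pointwise limit of
smooth transitions, whose means are measurable in h, and half-lines generate the Borel sets. -/
theorem measurable_extendFamily {c : ℝ → Measure ℝ} (hc : IsBMSFamily c)
    (hsmooth : IsSmoothFamilyOn c (Set.Ioo 0 1)) : Measurable (extendFamily c) := by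
  have := fun h => (isBMS_extendFamily hc h).prob
  refine Measurable.measure_of_isPiSystem_of_isProbabilityMeasure
    (S := Set.range Set.Ioi) (borel_eq_generateFrom_Ioi ℝ ▸ BorelSpace.measurable_eq) isPiSystem_Ioi ?_
  rintro _ ⟨a, rfl⟩
  have hlim : ∀ h, Tendsto (fun k : ℕ => ∫ y, Real.smoothTransition (k * (y - a))
      ∂(extendFamily c h)) atTop (𝓝 ((extendFamily c h).real (Set.Ioi a))) := by
    intro h
    rw [← integral_indicator_one measurableSet_Ioi]
    refine tendsto_integral_of_dominated_convergence (fun _ => 1) (fun k => ?_)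
      (integrable_const _) (fun k => ?_) ?_
    · exact (Real.smoothTransition.continuous.comp (by fun_prop)).aestronglyMeasurable
    · refine Eventually.of_forall fun y => ?_
      rw [Real.norm_eq_abs, abs_of_nonneg (Real.smoothTransition.nonneg _)]
      exact Real.smoothTransition.le_one _
    · refine Eventually.of_forall fun y => ?_
      by_cases hy : a < y
      · have h0 : 0 < y - a := sub_pos.2 hy
        rw [Set.indicator_of_mem (show y ∈ Set.Ioi a from hy)]
        refine tendsto_const_nhds.congr' ?_
        filter_upwards [(tendsto_natCast_atTop_atTop (R := ℝ)).eventually_ge_atTop (y - a)⁻¹]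
          with k hk
        rw [Real.smoothTransition.one_of_one_le]
        · rfl
        · calc 1 = (y - a)⁻¹ * (y - a) := by field_simp
            _ ≤ _ := by gcongr
      · rw [Set.indicator_of_notMem (by simpa using hy)]
        refine tendsto_const_nhds.congr fun k => ?_
        rw [Real.smoothTransition.zero_of_nonpos]
        exact mul_nonpos_of_nonneg_of_nonpos (Nat.cast_nonneg k) (by linarith)
  have hm : Measurable fun h => (extendFamily c h).real (Set.Ioi a) := by
    refine measurable_of_tendsto_metrizable (fun k : ℕ =>
      measurable_integral_extendFamily hsmooth
        (f := fun y => Real.smoothTransition (k * (y - a))) ?_) (tendsto_pi_nhds.2 hlim)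
    exact Real.smoothTransition.contDiff.comp (by fun_prop)
  have e : (fun h => extendFamily c h (Set.Ioi a)) =
      fun h => ENNReal.ofReal ((extendFamily c h).real (Set.Ioi a)) := by
    funext h
    rw [ofReal_measureReal]
  rw [e]
  exact hm.ennreal_ofReal

theorem measurable_outputLaw {c : ℝ → Measure ℝ} (hc : Measurable c) (b : ZMod 2) :
    Measurable fun h => outputLaw (c h) b := by
  rcases zmod_two_cases b with rfl | rfl
  · simpa
  · simp only [outputLaw_one]
    exact (Measure.measurable_map _ (by fun_prop)).comp hc

theorem measurable_wordLaw {n : ℕ} {c : ℝ → Fin n → Measure ℝ}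
    (hp : ∀ h j, IsProbabilityMeasure (c h j)) (hc : ∀ j, Measurable fun h => c h j)
    (x : Fin n → ZMod 2) : Measurable fun h => wordLaw (c h) x := by
  have := fun h => isProbabilityMeasure_wordLaw (hp h) x
  refine Measurable.measure_of_isPiSystem_of_isProbabilityMeasure
    generateFrom_pi.symm isPiSystem_pi ?_
  rintro _ ⟨s, hs, rfl⟩
  have : ∀ h j, IsProbabilityMeasure (outputLaw (c h j) (x j)) := fun h j =>
    isProbabilityMeasure_outputLaw _
  simp only [wordLaw, Measure.pi_pi]
  exact Finset.measurable_fun_prod _ fun j _ =>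
    (Measure.measurable_coe (show MeasurableSet (s j) from hs j (Set.mem_univ j))).comp
      (measurable_outputLaw (hc j) (x j))

theorem measurable_erasedPart {n : ℕ} (C : Submodule (ZMod 2) (Fin n → ZMod 2))
    {c : ℝ → Measure ℝ} (hp : ∀ h, IsProbabilityMeasure (c h)) (hc : Measurable c)
    (i : Fin n) (b : ZMod 2) : Measurable fun h => erasedPart C (fun _ => c h) i b := by
  classical
  refine Measure.measurable_of_measurable_coe _ fun s hs => ?_
  simp only [erasedPart, Measure.smul_apply, Measure.coe_finsetSum, Finset.sum_apply, smul_eq_mul]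
  refine Measurable.const_mul (Finset.measurable_fun_sum _ fun x _ => ?_) _
  refine (Measure.measurable_coe hs).comp (measurable_wordLaw (fun h j => ?_) (fun j => ?_) x.1)
  · exact forall_update (p := fun d => IsProbabilityMeasure d) (fun _ => hp h) inferInstance j
  · rcases eq_or_ne j i with rfl | h
    · simp [eraseAt]
    · simpa [eraseAt, h]

theorem IsBias.ae_eq {T : Type*} [MeasurableSpace T] {α : ZMod 2 → Measure T} {μ : Measure T}
    [IsFiniteMeasure μ] {δ δ' : T → ℝ} (h : IsBias α μ δ) (h' : IsBias α μ δ') : δ =ᵐ[μ] δ' := by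
  have hm := h.meas
  have hm' := h'.meas
  have e := (withDensity_eq_iff (μ := μ)
    (f := fun t => ENNReal.ofReal ((1 + sgn 0 * δ t) / 2))
    (g := fun t => ENNReal.ofReal ((1 + sgn 0 * δ' t) / 2)) (by fun_prop) (by fun_prop) (by
      have : ∫⁻ t, ENNReal.ofReal ((1 + sgn 0 * δ t) / 2) ∂μ ≤ ∫⁻ _, 1 ∂μ := by
        refine lintegral_mono fun t => ?_
        rw [← ENNReal.ofReal_one]
        refine ENNReal.ofReal_le_ofReal ?_
        have := (h.mem t).2
        rw [sgn_zero]; linarith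
      refine (this.trans_lt ?_).ne
      simp)).1 ((h.eq 0).symm.trans (h'.eq 0))
  filter_upwards [e] with t ht
  have h1 := (h.mem t).1
  have h2 := (h'.mem t).1
  rw [sgn_zero, ENNReal.ofReal_eq_ofReal_iff (by linarith) (by linarith)] at ht
  linarith

/-- The density r of α 0 is the posterior of the bit 0, so the bias is 2r − 1. Any measurable
version r is allowed, because the kernel derivative agrees with the measure derivative only almost
everywhere. -/
theorem isBias_of_ae_eq_rnDeriv {T : Type*} [MeasurableSpace T] {α : ZMod 2 → Measure T}
    (h0 : IsFiniteMeasure (α 0)) (h1 : IsFiniteMeasure (α 1)) {r : T → ENNReal}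
    (hr : Measurable r) (h : r =ᵐ[α 0 + α 1] (α 0).rnDeriv (α 0 + α 1)) :
    IsBias α (α 0 + α 1) fun t => clamp (2 * (r t).toReal - 1) := by
  have hle : α 0 ≤ α 0 + α 1 := Measure.le_add_right le_rfl
  have hm : Measurable fun t => clamp (2 * (r t).toReal - 1) := by fun_prop
  have e0 : α 0 = (α 0 + α 1).withDensity
      fun t => ENNReal.ofReal ((1 + clamp (2 * (r t).toReal - 1)) / 2) := by
    conv_lhs => rw [← Measure.withDensity_rnDeriv_eq _ _ hle.absolutelyContinuous]
    refine withDensity_congr_ae ?_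
    filter_upwards [h, Measure.rnDeriv_le_one_of_le hle, Measure.rnDeriv_lt_top (α 0) (α 0 + α 1)]
      with t ht h1 h2
    rw [ht]
    have h3 : ((α 0).rnDeriv (α 0 + α 1) t).toReal ≤ 1 := ENNReal.toReal_mono ENNReal.one_ne_top h1
    have h4 : 0 ≤ ((α 0).rnDeriv (α 0 + α 1) t).toReal := ENNReal.toReal_nonneg
    rw [clamp_of_mem ⟨by linarith, by linarith⟩, add_sub_cancel,
      mul_div_cancel_left₀ _ (by norm_num), ENNReal.ofReal_toReal h2.ne]
  refine ⟨hm, fun t => abs_clamp_le _, fun b => ?_⟩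
  rcases zmod_two_cases b with rfl | rfl
  · simpa using e0
  · simp only [sgn_one]
    have e1 : (α 0 + α 1).withDensity
        (fun t => ENNReal.ofReal ((1 + clamp (2 * (r t).toReal - 1)) / 2)) +
        (α 0 + α 1).withDensity
        (fun t => ENNReal.ofReal ((1 + -1 * clamp (2 * (r t).toReal - 1)) / 2)) = α 0 + α 1 := by
      rw [← withDensity_add_left (by fun_prop)]
      conv_rhs => rw [← withDensity_one (μ := α 0 + α 1)]
      congr 1
      funext t
      have := abs_le.1 (abs_clamp_le (2 * (r t).toReal - 1))
      rw [Pi.add_apply, ← ENNReal.ofReal_add (by linarith [this.1]) (by linarith [this.2]),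
        Pi.one_apply, ← ENNReal.ofReal_one]
      congr 1; ring
    rw [← e0] at e1
    ext s hs
    have e2 := congrArg (fun μ : Measure T => μ s) e1
    simp only [Measure.add_apply] at e2
    exact ((ENNReal.add_right_inj (measure_ne_top (α 0) s)).1 e2).symm

/-- The Radon–Nikodym derivative of kernels selects posterior biases jointly measurably in the
parameter and the observation. -/
theorem exists_measurable_isBias (κ : ZMod 2 → Kernel ℝ ℝ) [∀ b, IsFiniteKernel (κ b)] :
    ∃ δ : ℝ → ℝ → ℝ, (Measurable fun p : ℝ × ℝ => δ p.1 p.2) ∧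
      ∀ h, IsBias (fun b => κ b h) (κ 0 h + κ 1 h) (δ h) := by
  refine ⟨fun h z => clamp (2 * (Kernel.rnDeriv (κ 0) (κ 0 + κ 1) h z).toReal - 1), ?_, fun h =>
    isBias_of_ae_eq_rnDeriv (α := fun b => κ b h) inferInstance inferInstance
      (Kernel.measurable_rnDeriv_right _ _ h) Kernel.rnDeriv_eq_rnDeriv_measure⟩
  have := Kernel.measurable_rnDeriv (κ 0) (κ 0 + κ 1)
  fun_prop

theorem measurable_biasEntropy {c : ℝ → Measure ℝ} (hp : ∀ h, IsProbabilityMeasure (c h))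
    (hc : Measurable c) : Measurable fun p : ℝ × ℝ => biasEntropy (c p.1) p.2 := by
  have hs : Measurable fun p : ℝ × ℝ => symmLaw (c p.1) := by
    refine Measure.measurable_of_measurable_coe _ fun s hs => ?_
    simp only [symmLaw, Measure.smul_apply, Measure.add_apply, smul_eq_mul]
    have h1 := (Measure.measurable_coe hs).comp hc
    have h2 := (Measure.measurable_coe hs).comp
      ((Measure.measurable_map (fun d : ℝ => -d) (by fun_prop)).comp hc)
    exact ((h1.add h2).comp measurable_fst).const_mul _
  let κ : Kernel (ℝ × ℝ) ℝ := ⟨_, hs⟩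
  have : IsMarkovKernel κ := ⟨fun p => isProbabilityMeasure_symmLaw⟩
  have hf : StronglyMeasurable fun q : (ℝ × ℝ) × ℝ =>
      Real.negMulLog (1 + q.1.2 * clamp q.2) :=
    (Real.continuous_negMulLog.measurable.comp (by fun_prop)).stronglyMeasurable
  exact (hf.integral_kernel_prod_right' (κ := κ)).measurable

/-- The differentiated function itself changes with h, so measurability of an ordinary derivative
does not apply. The diagonal derivative is instead a limit of left difference quotients, each an
integral against a kernel of a jointly measurable function of h and the observation. -/
theorem aestronglyMeasurable_deriv_bitEntropy {c : ℝ → Measure ℝ} (hc : IsBMSFamily c)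
    (hdeg : IsDegradedFamily c) (hsmooth : IsSmoothFamilyOn c (Set.Ioo 0 1)) {n : ℕ}
    (C : Submodule (ZMod 2) (Fin n → ZMod 2)) (i : Fin n) {ψ : (Fin n → ℝ) → ℝ}
    (hψ : Measurable ψ) :
    AEStronglyMeasurable (fun h => deriv (bitEntropy c C ψ i h) h)
      (volume.restrict (Set.Ioo 0 1)) := by
  have hp := fun h => (isBMS_extendFamily hc h).prob
  have hcm := measurable_extendFamily hc hsmooth
  let κ : ZMod 2 → Kernel ℝ ℝ := fun b =>
    ⟨fun h => (erasedPart C (fun _ => extendFamily c h) i b).map ψ,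
      (Measure.measurable_map ψ hψ).comp (measurable_erasedPart C hp hcm i b)⟩
  have hκ : ∀ h, κ 0 h + κ 1 h = (erasedLaw C (fun _ => extendFamily c h) i).map ψ := fun h => by
    rw [erasedLaw, Measure.map_add _ _ hψ]; rfl
  have hκp : ∀ h, IsProbabilityMeasure (κ 0 h + κ 1 h) := fun h => by
    rw [hκ]
    have := isProbabilityMeasure_erasedLaw C (fun _ => hp h) i
    exact Measure.isProbabilityMeasure_map hψ.aemeasurable
  have hκ01 : IsMarkovKernel (κ 0 + κ 1) := ⟨hκp⟩
  have hκb : ∀ b, IsFiniteKernel (κ b) := fun b => by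
    refine ⟨1, ENNReal.one_lt_top, fun h => ?_⟩
    rw [← (hκp h).measure_univ, Measure.add_apply]
    rcases zmod_two_cases b with rfl | rfl
    · exact le_self_add
    · exact le_add_self
  obtain ⟨δ, hδm, hbias⟩ := exists_measurable_isBias κ
  set ε : ℕ → ℝ := fun k => 1 / ((k : ℝ) + 1) with hε
  have hεpos : ∀ k, 0 < ε k := fun k => by positivity
  set F : ℕ → ℝ → ℝ := fun k h => (ε k - (∫ z, (biasEntropy (extendFamily c h) (δ h z) -
    biasEntropy (extendFamily c (h - ε k)) (δ h z)) ∂((κ 0 + κ 1) h)) / Real.log 2) / ε k with hF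
  have hFm : ∀ k, Measurable (F k) := fun k => by
    have hb := measurable_biasEntropy hp hcm
    have h1 : StronglyMeasurable fun p : ℝ × ℝ => biasEntropy (extendFamily c p.1) (δ p.1 p.2) -
        biasEntropy (extendFamily c (p.1 - ε k)) (δ p.1 p.2) := by
      refine Measurable.stronglyMeasurable (Measurable.sub ?_ ?_)
      · exact Measurable.comp (g := fun p : ℝ × ℝ => biasEntropy (extendFamily c p.1) p.2)
          (f := fun p : ℝ × ℝ => (p.1, δ p.1 p.2)) hb (measurable_fst.prodMk hδm)
      · exact Measurable.comp (g := fun p : ℝ × ℝ => biasEntropy (extendFamily c p.1) p.2)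
          (f := fun p : ℝ × ℝ => (p.1 - ε k, δ p.1 p.2)) hb
          ((measurable_fst.sub_const _).prodMk hδm)
    have h2 := (h1.integral_kernel_prod_right' (κ := κ 0 + κ 1)).measurable
    exact ((h2.div_const _).const_sub _).div_const _
  refine aestronglyMeasurable_of_tendsto_ae atTop (f := F)
    (fun k => (hFm k).aestronglyMeasurable) ?_
  rw [ae_restrict_iff' measurableSet_Ioo]
  refine Eventually.of_forall fun h hh => ?_
  have hseq : Tendsto (fun k : ℕ => h - ε k) atTop (𝓝[<] h) := by
    refine tendsto_nhdsWithin_iff.2 ⟨?_, Eventually.of_forall fun k => ?_⟩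
    · simpa [hε] using (tendsto_one_div_add_atTop_nhds_zero_nat (𝕜 := ℝ)).const_sub h
    · simp only [Set.mem_Iio]; linarith [hεpos k]
  refine ((tendsto_bitEntropy_slope C i hc hdeg hsmooth hψ hh).comp hseq).congr' ?_
  filter_upwards [hseq.eventually (eventually_mem_Ioo hh)] with k hk
  obtain ⟨K, δ', hδ', hK⟩ := exists_bitEntropy_eq C i hc hψ (Set.Ioo_subset_Icc_self hh)
  have hb := hbias h
  rw [hκ] at hb
  simp only [κ, Kernel.coe_mk, extendFamily_of_mem hh] at hb
  have := isProbabilityMeasure_map_erasedLaw C i hc hψ (Set.Ioo_subset_Icc_self hh)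
  -- The bias in the entropy formula is chosen separately for each h; almost sure uniqueness
  -- replaces it by the jointly measurable one.
  have hae := hb.ae_eq hδ'
  have := (hc h (Set.Ioo_subset_Icc_self hh)).1.prob
  have := (hc _ (Set.Ioo_subset_Icc_self hk.2)).1.prob
  rw [Function.comp_apply, slope_comm, slope_def_field, hK h (Set.Ioo_subset_Icc_self hh),
    hK _ (Set.Ioo_subset_Icc_self hk.2), hF]
  simp only [FunLike.coe_add, Pi.add_apply]
  rw [hκ, extendFamily_of_mem hh, extendFamily_of_mem hk.2, integral_sub
    (integrable_biasEntropy_comp _ _ hb.meas hb.bound)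
    (integrable_biasEntropy_comp _ _ hb.meas hb.bound)]
  have e : ∀ d, ∫ z, biasEntropy d (δ h z) ∂((erasedLaw C (fun _ => c h) i).map ψ) =
      ∫ z, biasEntropy d (δ' z) ∂((erasedLaw C (fun _ => c h) i).map ψ) := fun d =>
    integral_congr_ae (hae.mono fun z hz => by simp only [hz])
  rw [e, e]
  congr 1
  · ring
  · ring

/-! ### The extreme channels -/

theorem eq_dirac_of_ae_eq {T : Type*} [MeasurableSpace T] {μ : Measure T} [IsProbabilityMeasure μ]
    {r : T} (h : ∀ᵐ y ∂μ, y = r) : μ = Measure.dirac r := by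
  have h1 : μ.map id = μ.map fun _ => r := Measure.map_congr h
  rw [Measure.map_id, Measure.map_const, measure_univ, one_smul] at h1
  exact h1

theorem negMulLog_add_negMulLog_eq (y : ℝ) :
    Real.negMulLog (1 + y) + Real.negMulLog (1 - y) =
      2 * (Real.binEntropy ((1 + y) / 2) - Real.log 2) := by
  have h1 : 1 + y = 2 * ((1 + y) / 2) := by ring
  have h2 : 1 - y = 2 * (1 - (1 + y) / 2) := by ring
  rw [Real.binEntropy_eq_negMulLog_add_negMulLog_one_sub]
  conv_lhs => rw [h1, h2, Real.negMulLog_mul, Real.negMulLog_mul]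
  simp only [Real.negMulLog]
  ring

/-- The average of η(1 + y) and η(1 − y) is binary entropy minus log 2, and both have mean
`biasEntropy c 1`. -/
theorem IsBMS.integral_binEntropy {c : Measure ℝ} (hc : IsBMS c) :
    ∫ y, Real.binEntropy ((1 + clamp y) / 2) ∂(symmLaw c) = Real.log 2 * entropy c := by
  have := hc.prob
  have := hc.symmLaw_prob
  have h1 := integrable_biasEntropy c (δ := 1) (by simp)
  have h2 := integrable_biasEntropy c (δ := -1) (by simp)
  have e : ∀ y, Real.binEntropy ((1 + clamp y) / 2) = (Real.negMulLog (1 + 1 * clamp y) +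
      Real.negMulLog (1 + -1 * clamp y)) / 2 + Real.log 2 := by
    intro y
    have := negMulLog_add_negMulLog_eq (clamp y)
    rw [one_mul, neg_one_mul, ← sub_eq_add_neg, this]
    ring
  simp only [e]
  have h3 : Integrable (fun y => (Real.negMulLog (1 + 1 * clamp y) +
      Real.negMulLog (1 + -1 * clamp y)) / 2) (symmLaw c) := (h1.add h2).div_const 2
  rw [integral_add h3 (integrable_const _), integral_div,
    integral_add h1 h2]
  change (biasEntropy c 1 + biasEntropy c (-1)) / 2 + _ = _
  rw [biasEntropy_neg, hc.biasEntropy_one]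
  simp
  ring

/-- The mean of the binary entropy of (1 + y) / 2 reaches its maximum log 2, which forces y = 0
almost surely. -/
theorem IsBMS.eq_dirac_zero {c : Measure ℝ} (hc : IsBMS c) (h : entropy c = 1) :
    c = Measure.dirac 0 := by
  have := hc.prob
  have := hc.symmLaw_prob
  have hcont : Measurable fun y => Real.binEntropy ((1 + clamp y) / 2) :=
    Real.binEntropy_continuous.measurable.comp (by fun_prop)
  have hint : Integrable (fun y => Real.binEntropy ((1 + clamp y) / 2)) (symmLaw c) := by
    refine Integrable.of_bound (C := Real.log 2) hcont.aestronglyMeasurable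
      (Eventually.of_forall fun y => ?_)
    have h1 := abs_le.1 (abs_clamp_le y)
    rw [Real.norm_eq_abs, abs_of_nonneg (Real.binEntropy_nonneg (by linarith) (by linarith))]
    exact Real.binEntropy_le_log_two
  have h0 : ∫ y, (Real.log 2 - Real.binEntropy ((1 + clamp y) / 2)) ∂(symmLaw c) = 0 := by
    rw [integral_sub (integrable_const _) hint, hc.integral_binEntropy, h]
    simp
  have h1 := (integral_eq_zero_iff_of_nonneg (fun y => sub_nonneg.2 Real.binEntropy_le_log_two)
    ((integrable_const _).sub hint)).1 h0
  refine eq_dirac_of_ae_eq ?_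
  refine (ae_symmLaw_iff (c := c).1 ?_).1
  filter_upwards [h1, hc.ae_symmLaw_mem] with y hy hy'
  have h2 : Real.binEntropy ((1 + clamp y) / 2) = Real.log 2 := by
    simp only [Pi.zero_apply] at hy; linarith
  rw [Real.binEntropy_eq_log_two, clamp_of_mem hy'] at h2
  linarith

/-- Zero mean binary entropy forces y = ±1 under the symmetrized law, and c gives y = −1 the weight
1 + y = 0. -/
theorem IsBMS.eq_dirac_one {c : Measure ℝ} (hc : IsBMS c) (h : entropy c = 0) :
    c = Measure.dirac 1 := by
  have := hc.prob
  have := hc.symmLaw_prob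
  have hcont : Measurable fun y => Real.binEntropy ((1 + clamp y) / 2) :=
    Real.binEntropy_continuous.measurable.comp (by fun_prop)
  have hnn : ∀ y, 0 ≤ Real.binEntropy ((1 + clamp y) / 2) := fun y => by
    have h1 := abs_le.1 (abs_clamp_le y)
    exact Real.binEntropy_nonneg (by linarith) (by linarith)
  have hint : Integrable (fun y => Real.binEntropy ((1 + clamp y) / 2)) (symmLaw c) := by
    refine Integrable.of_bound (C := Real.log 2) hcont.aestronglyMeasurable
      (Eventually.of_forall fun y => ?_)
    rw [Real.norm_eq_abs, abs_of_nonneg (hnn y)]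
    exact Real.binEntropy_le_log_two
  have h0 : ∫ y, Real.binEntropy ((1 + clamp y) / 2) ∂(symmLaw c) = 0 := by
    rw [hc.integral_binEntropy, h, mul_zero]
  have h1 := (integral_eq_zero_iff_of_nonneg hnn hint).1 h0
  refine eq_dirac_of_ae_eq ?_
  have e : c = (symmLaw c).withDensity fun y => ENNReal.ofReal (1 + clamp y) := by
    simpa using hc.outputLaw_eq 0
  rw [e, ae_withDensity_iff (by fun_prop)]
  filter_upwards [h1, hc.ae_symmLaw_mem] with y hy hy' h3
  simp only [Pi.zero_apply] at hy
  rw [clamp_of_mem hy', Real.binEntropy_eq_zero] at hy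
  rw [clamp_of_mem hy'] at h3
  rcases hy with hy | hy
  · exact absurd (by rw [show 1 + y = 0 by linarith, ENNReal.ofReal_zero]) h3
  · linarith

theorem condEntropy_eq_zero_of_ae_eq {Ω S T : Type*} [MeasurableSpace Ω] [MeasurableSpace S]
    [MeasurableSingletonClass S] [MeasurableSpace T] [Fintype S] (P : Measure Ω)
    [IsFiniteMeasure P] {X : Ω → S} {Y : Ω → T} {f : T → S} (hf : Measurable f) (hY : Measurable Y)
    (h : X =ᵐ[P] fun ω => f (Y ω)) : condEntropy P X Y = 0 := by
  refine Finset.sum_eq_zero fun s _ => ?_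
  rw [integral_eq_zero_of_ae, zero_div]
  have hs : MeasurableSet (f ⁻¹' {s}) := hf (measurableSet_singleton s)
  have h1 : (X ⁻¹' {s}).indicator (fun _ => (1 : ℝ)) =ᵐ[P]
      (Y ⁻¹' (f ⁻¹' {s})).indicator fun _ => (1 : ℝ) := by
    filter_upwards [h] with ω hω
    have hiff : ω ∈ X ⁻¹' {s} ↔ ω ∈ Y ⁻¹' (f ⁻¹' {s}) := by
      change X ω = s ↔ f (Y ω) = s
      rw [hω]
    by_cases hx : ω ∈ X ⁻¹' {s}
    · rw [Set.indicator_of_mem hx, Set.indicator_of_mem (hiff.1 hx)]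
    · rw [Set.indicator_of_notMem hx, Set.indicator_of_notMem (mt hiff.2 hx)]
  have hm : StronglyMeasurable[MeasurableSpace.comap Y inferInstance]
      ((Y ⁻¹' (f ⁻¹' {s})).indicator fun _ => (1 : ℝ)) :=
    stronglyMeasurable_const.indicator ⟨_, hs, rfl⟩
  have h2 := condExp_congr_ae (m := MeasurableSpace.comap Y inferInstance) h1
  rw [condExp_of_stronglyMeasurable hY.comap_le hm
    ((integrable_const _).indicator (hY hs))] at h2
  filter_upwards [h2] with ω hω
  rw [hω]
  by_cases hw : ω ∈ Y ⁻¹' (f ⁻¹' {s})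
  · rw [Set.indicator_of_mem hw]; simp
  · rw [Set.indicator_of_notMem hw]; simp

theorem pi_dirac {ι : Type*} [Fintype ι] (r : ι → ℝ) :
    Measure.pi (fun i => Measure.dirac (r i)) = Measure.dirac r :=
  Measure.pi_eq fun s hs => by
    rw [Measure.dirac_apply' _ (MeasurableSet.univ_pi hs)]
    simp_rw [Measure.dirac_apply' _ (hs _)]
    by_cases h : ∀ i, r i ∈ s i
    · rw [Set.indicator_of_mem (by simpa [Set.mem_pi] using h)]
      simp [h]
    · rw [Set.indicator_of_notMem (by simpa [Set.mem_pi] using h)]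
      obtain ⟨i, hi⟩ := not_forall.1 h
      exact (Finset.prod_eq_zero (Finset.mem_univ i) (Set.indicator_of_notMem hi _)).symm

theorem outputLaw_dirac_one (b : ZMod 2) :
    outputLaw (Measure.dirac (1 : ℝ)) b = Measure.dirac (sgn b) := by
  rcases zmod_two_cases b with rfl | rfl
  · simp
  · rw [outputLaw_one, Measure.map_dirac' (by fun_prop), sgn_one]

section Extreme

variable {c : ℝ → Measure ℝ} {n : ℕ} (C : Submodule (ZMod 2) (Fin n → ZMod 2))

theorem wordEntropy_zero (hc : IsBMSFamily c) : wordEntropy c C 0 = 0 := by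
  classical
  have h0 : (0 : ℝ) ∈ Set.Icc (0 : ℝ) 1 := by norm_num
  have hd : c 0 = Measure.dirac 1 := (hc 0 h0).1.eq_dirac_one (hc 0 h0).2
  have hp := isProbabilityMeasure_jointLaw C (c := fun _ => c 0) fun _ => (hc 0 h0).1.prob
  have hm : Measurable fun (y : Fin n → ℝ) (j : Fin n) => if y j = 1 then (0 : ZMod 2) else 1 := by
    refine measurable_pi_iff.2 fun j => ?_
    exact Measurable.ite (measurableSet_eq_fun (measurable_pi_apply j) measurable_const)
      measurable_const measurable_const
  refine condEntropy_eq_zero_of_ae_eq _ hm measurable_snd ?_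
  have hset : MeasurableSet {ω : (Fin n → ZMod 2) × (Fin n → ℝ) |
      ω.1 = fun j => if ω.2 j = 1 then (0 : ZMod 2) else 1} :=
    measurableSet_eq_fun measurable_fst (hm.comp measurable_snd)
  rw [Filter.EventuallyEq, ae_iff]
  simp only [jointLaw, Measure.smul_apply, Measure.coe_finsetSum, Finset.sum_apply, smul_eq_mul]
  rw [Finset.sum_eq_zero, mul_zero]
  intro x _
  have e : (Measure.pi fun i => outputLaw (c 0) (x.1 i)) =
      Measure.dirac fun i => sgn (x.1 i) := by
    simp_rw [hd, outputLaw_dirac_one]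
    exact pi_dirac _
  rw [e, Measure.dirac_prod_dirac]
  refine (Measure.dirac_apply' _ hset.compl).trans (Set.indicator_of_notMem ?_ _)
  simp only [Set.mem_compl_iff, not_not, Set.mem_ofPred_eq]
  funext j
  rcases zmod_two_cases (x.1 j) with h | h
  · simp [h]
  · have hs : sgn (x.1 j) ≠ 1 := by rw [h, sgn_one]; norm_num
    exact h.trans (if_neg hs).symm

/-- The output is constant, so the posterior stays uniform on C and the entropy is log₂ |C|. -/
theorem wordEntropy_one (hc : IsBMSFamily c) :
    wordEntropy c C 1 = Module.finrank (ZMod 2) C := by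
  classical
  have h1 : (1 : ℝ) ∈ Set.Icc (0 : ℝ) 1 := by norm_num
  have hd : c 1 = Measure.dirac 0 := (hc 1 h1).1.eq_dirac_zero (hc 1 h1).2
  have hp := isProbabilityMeasure_jointLaw C (c := fun _ => c 1) fun _ => (hc 1 h1).1.prob
  set N : ℝ := (Fintype.card C : ℝ) with hN
  have hN1 : 1 ≤ N := by
    rw [hN]; exact_mod_cast Fintype.card_pos
  have hword : ∀ x : Fin n → ZMod 2, wordLaw (fun _ => c 1) x = Measure.dirac 0 := by
    intro x
    simp_rw [wordLaw, hd, outputLaw_dirac_zero]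
    exact pi_dirac _
  have hlog : Real.log 2 ≠ 0 := (Real.log_pos (by norm_num)).ne'
  rw [wordEntropy, condEntropy_eq_integral (jointLaw C fun _ => c 1) measurable_fst measurable_snd
    (Measure.dirac 0) (fun x _ => if x ∈ C then N⁻¹ else 0) (fun _ => measurable_const)
    (fun x _ => by split_ifs <;> positivity) 1 (fun x _ => by
      split_ifs
      · exact inv_le_one_of_one_le₀ hN1
      · exact zero_le_one)]
  · have hs : ∑ x : Fin n → ZMod 2, (if x ∈ C then N⁻¹ else 0) = 1 := by
      rw [← Finset.sum_filter, Finset.sum_const, nsmul_eq_mul, ← Fintype.card_subtype]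
      exact mul_inv_cancel₀ (by positivity)
    have hs2 : ∑ x : Fin n → ZMod 2, Real.negMulLog (if x ∈ C then N⁻¹ else 0) = Real.log N := by
      have : ∀ x : Fin n → ZMod 2, Real.negMulLog (if x ∈ C then N⁻¹ else 0) =
          (if x ∈ C then N⁻¹ else 0) * Real.log N := by
        intro x
        split_ifs <;> simp [Real.negMulLog]
      rw [Finset.sum_congr rfl fun x _ => this x, ← Finset.sum_mul, hs, one_mul]
    simp only [hs, hs2, Real.negMulLog_one, sub_zero, integral_const, probReal_univ, smul_eq_mul,
      one_mul]
    have hcard : N = 2 ^ Module.finrank (ZMod 2) C := by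
      rw [hN, Module.card_eq_pow_finrank (K := ZMod 2) (V := C)]
      simp [ZMod.card]
    rw [hcard, Real.log_pow]
    field_simp
  · intro s
    have h2 := restrict_map_jointLaw C (c := fun _ => c 1) (fun _ => (hc 1 h1).1.prob)
      (fun x => x) (V := fun y => y) measurable_id s
    simp only [Measure.map_id', hword] at h2
    rw [h2, withDensity_const]
    have hinv : ENNReal.ofReal N⁻¹ = (Fintype.card C : ENNReal)⁻¹ := by
      rw [ENNReal.ofReal_inv_of_pos (by positivity), hN, ENNReal.ofReal_natCast]
    by_cases hs : s ∈ C
    · rw [if_pos hs, hinv]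
      rw [Finset.sum_filter, Finset.sum_eq_single (⟨s, hs⟩ : C)]
      · rw [if_pos rfl]
      · exact fun x _ hx => if_neg fun h => hx (Subtype.ext h)
      · simp
    · rw [if_neg hs, ENNReal.ofReal_zero, zero_smul]
      rw [Finset.sum_filter, Finset.sum_eq_zero, smul_zero]
      refine fun x _ => if_neg ?_
      rintro rfl
      exact hs x.2

end Extreme

/-! ### Functions on `(0, 1)` with values in a bounded interval -/

/-- `f` is almost everywhere strongly measurable on `(0, 1)`, with values in `[0, B]`. -/
structure IsBoundedOnUnit (f : ℝ → ℝ) (B : ℝ) : Prop where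
  meas : AEStronglyMeasurable f (volume.restrict (Set.Ioo (0 : ℝ) 1))
  mem : ∀ u ∈ Set.Ioo (0 : ℝ) 1, f u ∈ Set.Icc 0 B

theorem IsBoundedOnUnit.integrableOn {f : ℝ → ℝ} {B : ℝ} (hf : IsBoundedOnUnit f B) :
    IntegrableOn f (Set.Ioo 0 1) := by
  refine Integrable.of_bound (C := B) hf.meas ?_
  rw [ae_restrict_iff' measurableSet_Ioo]
  refine Eventually.of_forall fun u hu => ?_
  rw [Real.norm_eq_abs, abs_of_nonneg (hf.mem u hu).1]
  exact (hf.mem u hu).2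

theorem IsBoundedOnUnit.intervalIntegrable {f : ℝ → ℝ} {B : ℝ} (hf : IsBoundedOnUnit f B) {h : ℝ}
    (hh : h ∈ Set.Icc (0 : ℝ) 1) : IntervalIntegrable f volume h 1 := by
  rw [intervalIntegrable_iff_integrableOn_Ioo_of_le hh.2]
  exact hf.integrableOn.mono_set (Set.Ioo_subset_Ioo_left hh.1)

theorem intervalIntegral_eq_Ioo (f : ℝ → ℝ) {h : ℝ} (hh : h ∈ Set.Icc (0 : ℝ) 1) :
    ∫ u in h..1, f u = ∫ u in Set.Ioo h 1, f u := by
  rw [intervalIntegral.integral_of_le hh.2, integral_Ioc_eq_integral_Ioo]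

theorem IsBoundedOnUnit.integral_mem {f : ℝ → ℝ} {B : ℝ} (hf : IsBoundedOnUnit f B) (hB : 0 ≤ B)
    {h : ℝ} (hh : h ∈ Set.Icc (0 : ℝ) 1) : ∫ u in h..1, f u ∈ Set.Icc 0 B := by
  have hsub : Set.Ioo h 1 ⊆ Set.Ioo 0 1 := Set.Ioo_subset_Ioo_left hh.1
  rw [intervalIntegral_eq_Ioo f hh]
  constructor
  · exact setIntegral_nonneg measurableSet_Ioo fun u hu => (hf.mem u (hsub hu)).1
  · calc ∫ u in Set.Ioo h 1, f u ≤ ∫ _ in Set.Ioo h 1, B :=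
          setIntegral_mono_on (hf.integrableOn.mono_set hsub) (by simp) measurableSet_Ioo
            fun u hu => (hf.mem u (hsub hu)).2
      _ = (1 - h) * B := by
          rw [setIntegral_const, Real.volume_real_Ioo_of_le hh.2, smul_eq_mul]
      _ ≤ B := by nlinarith [hh.1]

theorem intervalIntegrable_sum {ι : Type*} (s : Finset ι) {f : ι → ℝ → ℝ} {a b : ℝ}
    (hf : ∀ i ∈ s, IntervalIntegrable (f i) volume a b) :
    IntervalIntegrable (fun u => ∑ i ∈ s, f i u) volume a b := by
  simp only [intervalIntegrable_iff] at hf ⊢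
  exact integrable_finsetSum s hf

theorem limsup_mem_Icc {a : ℕ → ℝ} {B : ℝ} (ha : ∀ k, a k ∈ Set.Icc 0 B) :
    limsup a atTop ∈ Set.Icc 0 B := by
  have h1 : IsBoundedUnder (· ≤ ·) atTop a := isBoundedUnder_of ⟨B, fun k => (ha k).2⟩
  have h2 : IsBoundedUnder (· ≥ ·) atTop a := isBoundedUnder_of ⟨0, fun k => (ha k).1⟩
  exact ⟨le_limsup_of_frequently_le (Frequently.of_forall fun k => (ha k).1) h1,
    limsup_le_of_le h2.isCoboundedUnder_flip (Eventually.of_forall fun k => (ha k).2)⟩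

theorem ofReal_limsup {a : ℕ → ℝ} {B : ℝ} (ha : ∀ k, a k ∈ Set.Icc 0 B) :
    ENNReal.ofReal (limsup a atTop) = limsup (fun k => ENNReal.ofReal (a k)) atTop := by
  have h1 : IsBoundedUnder (· ≤ ·) atTop a := isBoundedUnder_of ⟨B, fun k => (ha k).2⟩
  have h2 : IsBoundedUnder (· ≥ ·) atTop a := isBoundedUnder_of ⟨0, fun k => (ha k).1⟩
  exact Monotone.map_limsup_of_continuousAt (fun x y hxy => ENNReal.ofReal_le_ofReal hxy) a
    ENNReal.continuous_ofReal.continuousAt h1 h2.isCoboundedUnder_flip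

theorem isBoundedOnUnit_limsup {f : ℕ → ℝ → ℝ} {B : ℝ} (hf : ∀ k, IsBoundedOnUnit (f k) B) :
    IsBoundedOnUnit (fun u => limsup (fun k => f k u) atTop) B := by
  refine ⟨?_, fun u hu => limsup_mem_Icc fun k => (hf k).mem u hu⟩
  refine ⟨fun u => limsup (fun k => (hf k).meas.mk (f k) u) atTop,
    (Measurable.limsup fun k => (hf k).meas.stronglyMeasurable_mk.measurable).stronglyMeasurable, ?_⟩
  filter_upwards [ae_all_iff.2 fun k => (hf k).meas.ae_eq_mk] with u hu
  simp only [hu]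

/-- The reverse Fatou lemma. -/
theorem limsup_integral_le {f : ℕ → ℝ → ℝ} {B : ℝ} (hB : 0 ≤ B)
    (hf : ∀ k, IsBoundedOnUnit (f k) B) {h : ℝ} (hh : h ∈ Set.Icc (0 : ℝ) 1) :
    limsup (fun k => ∫ u in h..1, f k u) atTop ≤
      ∫ u in h..1, limsup (fun k => f k u) atTop := by
  have hF := isBoundedOnUnit_limsup hf
  have hsub : Set.Ioo h 1 ⊆ Set.Ioo 0 1 := Set.Ioo_subset_Ioo_left hh.1
  have hof : ∀ {g : ℝ → ℝ}, IsBoundedOnUnit g B →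
      ENNReal.ofReal (∫ u in h..1, g u) = ∫⁻ u in Set.Ioo h 1, ENNReal.ofReal (g u) := by
    intro g hg
    rw [intervalIntegral_eq_Ioo g hh]
    refine ofReal_integral_eq_lintegral_ofReal (hg.integrableOn.mono_set hsub) ?_
    rw [Filter.EventuallyLE, ae_restrict_iff' measurableSet_Ioo]
    exact Eventually.of_forall fun u hu => (hg.mem u (hsub hu)).1
  have hm : ∀ k, AEStronglyMeasurable (f k) (volume.restrict (Set.Ioo h 1)) := fun k =>
    (hf k).meas.mono_measure (Measure.restrict_mono hsub le_rfl)
  have hmem : ∀ᵐ u ∂(volume.restrict (Set.Ioo h 1)), u ∈ Set.Ioo h 1 :=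
    ae_restrict_mem measurableSet_Ioo
  -- The inequality is moved to extended nonnegative integrals, where reverse Fatou is available; it
  -- asks for measurable functions, so each f k is replaced by a measurable version, and countably
  -- many null sets are harmless.
  rw [← ENNReal.ofReal_le_ofReal_iff (hF.integral_mem hB hh).1,
    ofReal_limsup (fun k => (hf k).integral_mem hB hh), hof hF]
  simp_rw [hof (hf _)]
  have e1 : ∀ k, ∫⁻ u in Set.Ioo h 1, ENNReal.ofReal (f k u) =
      ∫⁻ u in Set.Ioo h 1, ENNReal.ofReal ((hm k).mk (f k) u) := fun k =>
    lintegral_congr_ae (by filter_upwards [(hm k).ae_eq_mk] with u hu; rw [hu])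
  have e2 : ∫⁻ u in Set.Ioo h 1, ENNReal.ofReal (limsup (fun k => f k u) atTop) =
      ∫⁻ u in Set.Ioo h 1, limsup (fun k => ENNReal.ofReal ((hm k).mk (f k) u)) atTop := by
    refine lintegral_congr_ae ?_
    filter_upwards [ae_all_iff.2 fun k => (hm k).ae_eq_mk, hmem] with u hu hu'
    rw [ofReal_limsup fun k => (hf k).mem u (hsub hu')]
    simp only [hu]
  simp_rw [e1]
  rw [e2]
  refine limsup_lintegral_le (fun _ => ENNReal.ofReal B)
    (fun k => (hm k).stronglyMeasurable_mk.measurable.ennreal_ofReal) (fun k => ?_) ?_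
  · filter_upwards [(hm k).ae_eq_mk, hmem] with u hu hu'
    rw [← hu]
    exact ENNReal.ofReal_le_ofReal ((hf k).mem u (hsub hu')).2
  · rw [lintegral_const]
    simp [ENNReal.mul_eq_top]

/-! ### The area bound for a fixed graph -/

section Graph

variable {c : ℝ → Measure ℝ} {n : ℕ} (C : Submodule (ZMod 2) (Fin n → ZMod 2))
  {ψ : Fin n → (Fin n → ℝ) → ℝ}

theorem isBoundedOnUnit_deriv_bitEntropy (hc : IsBMSFamily c) (hdeg : IsDegradedFamily c)
    (hsmooth : IsSmoothFamilyOn c (Set.Ioo 0 1)) (i : Fin n) (hψ : Measurable (ψ i)) :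
    IsBoundedOnUnit (fun u => deriv (bitEntropy c C (ψ i) i u) u) 1 :=
  ⟨aestronglyMeasurable_deriv_bitEntropy hc hdeg hsmooth C i hψ, fun _ hu =>
    deriv_bitEntropy_mem C i hc hdeg hsmooth hψ hu⟩

/-- The Lipschitz word entropy is absolutely continuous, so it is the integral of its almost
everywhere derivative, and the derivative bound is needed only at points of differentiability. -/
theorem finrank_sub_wordEntropy_le (hc : IsBMSFamily c) (hdeg : IsDegradedFamily c)
    (hsmooth : IsSmoothFamilyOn c (Set.Ioo 0 1)) (hψ : ∀ i, Measurable (ψ i)) {h : ℝ}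
    (hh : h ∈ Set.Icc (0 : ℝ) 1) :
    Module.finrank (ZMod 2) C - wordEntropy c C h ≤
      ∫ u in h..1, ∑ i, deriv (bitEntropy c C (ψ i) i u) u := by
  have hsub : Set.uIcc h 1 ⊆ Set.Icc 0 1 := by
    rw [Set.uIcc_of_le hh.2]; exact Set.Icc_subset_Icc_left hh.1
  have hac : AbsolutelyContinuousOnInterval (wordEntropy c C) h 1 :=
    ((lipschitzOnWith_wordEntropy C hc hdeg).mono hsub).absolutelyContinuousOnInterval
  rw [← wordEntropy_one C hc, ← hac.integral_deriv_eq_sub]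
  have hint : IntervalIntegrable (fun u => ∑ i, deriv (bitEntropy c C (ψ i) i u) u) volume h 1 :=
    intervalIntegrable_sum _ fun i _ =>
      (isBoundedOnUnit_deriv_bitEntropy C hc hdeg hsmooth i (hψ i)).intervalIntegrable hh
  rw [intervalIntegral_eq_Ioo _ hh, intervalIntegral_eq_Ioo _ hh]
  refine setIntegral_mono_on_ae
    ((intervalIntegrable_iff_integrableOn_Ioo_of_le hh.2).1 hac.intervalIntegrable_deriv)
    ((intervalIntegrable_iff_integrableOn_Ioo_of_le hh.2).1 hint) measurableSet_Ioo ?_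
  filter_upwards [hac.ae_differentiableAt] with u hu hu'
  refine deriv_wordEntropy_le C hc hdeg hsmooth hψ ⟨hh.1.trans_lt hu'.1, hu'.2⟩ (hu ?_)
  rw [Set.uIcc_of_le hh.2]
  exact Set.Ioo_subset_Icc_self hu'

/-- The entropy is monotone in h, from 0 at h = 0 to dim C ≤ n at h = 1. -/
theorem wordEntropy_mem (hc : IsBMSFamily c) (hdeg : IsDegradedFamily c) {h : ℝ}
    (hh : h ∈ Set.Icc (0 : ℝ) 1) : wordEntropy c C h ∈ Set.Icc (0 : ℝ) n := by
  have h0 := wordEntropy_sub_le C hc hdeg (ψ := fun _ (y : Fin n → ℝ) => y)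
    (fun _ => measurable_id) (by norm_num : (0 : ℝ) ∈ Set.Icc (0 : ℝ) 1) hh hh.1
  have h1 := wordEntropy_sub_le C hc hdeg (ψ := fun _ (y : Fin n → ℝ) => y)
    (fun _ => measurable_id) hh (by norm_num : (1 : ℝ) ∈ Set.Icc (0 : ℝ) 1) hh.2
  have h2 : Module.finrank (ZMod 2) C ≤ n := by
    simpa using Submodule.finrank_le C
  have h3 : (Module.finrank (ZMod 2) C : ℝ) ≤ n := by exact_mod_cast h2
  rw [wordEntropy_zero C hc] at h0
  rw [wordEntropy_one C hc] at h1
  exact ⟨by linarith [h0.1], by linarith [h1.1]⟩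

end Graph

/-! ### Averages over the ensemble -/

theorem DegreeProfile.expect_mono (E : DegreeProfile) {f g : E.Graph → ℝ} (h : ∀ G, f G ≤ g G) :
    E.expect f ≤ E.expect g :=
  div_le_div_of_nonneg_right (Finset.sum_le_sum fun G _ => h G) (Nat.cast_nonneg _)

theorem DegreeProfile.expect_mem (E : DegreeProfile) {f : E.Graph → ℝ}
    (h : ∀ G, f G ∈ Set.Icc (0 : ℝ) 1) : E.expect f ∈ Set.Icc (0 : ℝ) 1 := by
  refine ⟨div_nonneg (Finset.sum_nonneg fun G _ => (h G).1) (Nat.cast_nonneg _),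
    div_le_one_of_le₀ ?_ (Nat.cast_nonneg _)⟩
  calc ∑ G, f G ≤ ∑ _G : E.Graph, (1 : ℝ) := Finset.sum_le_sum fun G _ => (h G).2
    _ = _ := by simp

section Ensemble

variable {c : ℝ → Measure ℝ}

theorem avgMapEntropy_eq (E : DegreeProfile) (h : ℝ) :
    avgMapEntropy c E h = E.expect fun G => wordEntropy c (code G) h / E.n := by
  rw [avgMapEntropy, DegreeProfile.expect, DegreeProfile.expect, ← Finset.sum_div, div_right_comm]
  rfl

theorem avgMapEntropy_mem (hc : IsBMSFamily c) (hdeg : IsDegradedFamily c) (E : DegreeProfile)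
    {h : ℝ} (hh : h ∈ Set.Icc (0 : ℝ) 1) : avgMapEntropy c E h ∈ Set.Icc (0 : ℝ) 1 := by
  rw [avgMapEntropy_eq]
  refine E.expect_mem fun G => ?_
  have := wordEntropy_mem (code G) hc hdeg hh
  exact ⟨div_nonneg this.1 (Nat.cast_nonneg _), div_le_one_of_le₀ this.2 (Nat.cast_nonneg _)⟩

theorem avgMapEntropy_zero (hc : IsBMSFamily c) (E : DegreeProfile) :
    avgMapEntropy c E 0 = 0 := by
  rw [avgMapEntropy_eq, DegreeProfile.expect]
  simp [wordEntropy_zero _ hc]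

theorem isBoundedOnUnit_bpGexitBit (hc : IsBMSFamily c) (hdeg : IsDegradedFamily c)
    (hsmooth : IsSmoothFamilyOn c (Set.Ioo 0 1)) {E : DegreeProfile} (G : E.Graph) (l : ℕ)
    (i : Fin E.n) : IsBoundedOnUnit (bpGexitBit c G l i) 1 := by
  have h := isBoundedOnUnit_deriv_bitEntropy (code G) (ψ := bpExtrinsic G l) hc hdeg hsmooth i
    (measurable_bpExtrinsic G l i)
  simp only [← bpGexitBit_eq] at h
  exact h

theorem isBoundedOnUnit_avgBpGexit (hc : IsBMSFamily c) (hdeg : IsDegradedFamily c)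
    (hsmooth : IsSmoothFamilyOn c (Set.Ioo 0 1)) (E : DegreeProfile) (l : ℕ) :
    IsBoundedOnUnit (avgBpGexit c E l) 1 := by
  have hb := fun (G : E.Graph) i => isBoundedOnUnit_bpGexitBit hc hdeg hsmooth G l i
  constructor
  · unfold avgBpGexit DegreeProfile.expect
    simp only [div_eq_mul_inv]
    refine AEStronglyMeasurable.mul_const ?_ _
    refine Finset.aestronglyMeasurable_fun_sum _ fun G _ => ?_
    refine AEStronglyMeasurable.mul_const ?_ _
    exact Finset.aestronglyMeasurable_fun_sum _ fun i _ => (hb G i).meas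
  · intro u hu
    refine E.expect_mem fun G => ⟨div_nonneg (Finset.sum_nonneg fun i _ => ((hb G i).mem u hu).1)
      (Nat.cast_nonneg _), div_le_one_of_le₀ ?_ (Nat.cast_nonneg _)⟩
    calc ∑ i, bpGexitBit c G l i u ≤ ∑ _i : Fin E.n, (1 : ℝ) :=
          Finset.sum_le_sum fun i _ => ((hb G i).mem u hu).2
      _ = _ := by simp

theorem expect_rate_sub_avgMapEntropy_le (hc : IsBMSFamily c) (hdeg : IsDegradedFamily c)
    (hsmooth : IsSmoothFamilyOn c (Set.Ioo 0 1)) (E : DegreeProfile) (l : ℕ) {h : ℝ}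
    (hh : h ∈ Set.Icc (0 : ℝ) 1) :
    (E.expect fun G => rate G) - avgMapEntropy c E h ≤ ∫ u in h..1, avgBpGexit c E l u := by
  have hi := fun (G : E.Graph) i =>
    (isBoundedOnUnit_bpGexitBit hc hdeg hsmooth G l i).intervalIntegrable hh
  have hs : ∀ G : E.Graph,
      IntervalIntegrable (fun u => ∑ i, bpGexitBit c G l i u) volume h 1 := fun G =>
    intervalIntegrable_sum _ fun i _ => hi G i
  have e : ∫ u in h..1, avgBpGexit c E l u =
      E.expect fun G => (∫ u in h..1, ∑ i, bpGexitBit c G l i u) / E.n := by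
    unfold avgBpGexit DegreeProfile.expect
    rw [intervalIntegral.integral_div, intervalIntegral.integral_finsetSum fun G _ =>
      (hs G).div_const _]
    simp only [intervalIntegral.integral_div]
  rw [e, avgMapEntropy_eq, sub_le_iff_le_add]
  have h1 : ∀ f g : E.Graph → ℝ, E.expect f + E.expect g = E.expect fun G => f G + g G := by
    intro f g
    rw [DegreeProfile.expect, DegreeProfile.expect, DegreeProfile.expect, ← add_div,
      Finset.sum_add_distrib]
  rw [h1]
  refine E.expect_mono fun G => ?_
  have h2 := finrank_sub_wordEntropy_le (code G) (ψ := bpExtrinsic G l) hc hdeg hsmooth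
    (measurable_bpExtrinsic G l) hh
  simp only [← bpGexitBit_eq] at h2
  rw [rate, ← add_div]
  exact div_le_div_of_nonneg_right (by linarith) (Nat.cast_nonneg _)

theorem rate_nonneg {E : DegreeProfile} (G : E.Graph) : 0 ≤ rate G := by
  unfold rate; positivity

theorem isBoundedOnUnit_bpGexit (hc : IsBMSFamily c) (hdeg : IsDegradedFamily c)
    (hsmooth : IsSmoothFamilyOn c (Set.Ioo 0 1)) (E : ℕ → DegreeProfile) :
    IsBoundedOnUnit (bpGexit c E) 1 :=
  isBoundedOnUnit_limsup fun l => isBoundedOnUnit_limsup fun k =>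
    isBoundedOnUnit_avgBpGexit hc hdeg hsmooth (E k) l

theorem sub_limsup_le_liminf {a r f : ℕ → ℝ} {R : ℝ} (ha : ∀ k, a k ∈ Set.Icc (0 : ℝ) 1)
    (hf : ∀ k, f k ∈ Set.Icc (0 : ℝ) 1) (hr : Tendsto r atTop (𝓝 R))
    (h : ∀ k, r k - a k ≤ f k) : R - limsup f atTop ≤ liminf a atTop := by
  have hfb : IsBoundedUnder (· ≤ ·) atTop f := isBoundedUnder_of ⟨1, fun k => (hf k).2⟩
  have hab : IsBoundedUnder (· ≤ ·) atTop a := isBoundedUnder_of ⟨1, fun k => (ha k).2⟩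
  refine le_of_forall_pos_le_add fun ε hε => ?_
  rw [← sub_le_iff_le_add]
  refine le_liminf_of_le hab.isCoboundedUnder_flip ?_
  filter_upwards [hr.eventually_const_lt (show R - ε / 2 < R by linarith),
    eventually_lt_of_limsup_lt (show limsup f atTop < limsup f atTop + ε / 2 by linarith) hfb]
    with k h1 h2
  linarith [h k]

/-- The finite-length area bound holds for every number l of rounds. Reverse Fatou in the
blocklength gives a bound for each l, whose left side is free of l; a second reverse Fatou in l
finishes. -/
theorem designRate_sub_integral_le (D : DegreePair) (E : ℕ → DegreeProfile)
    (hrate : Tendsto (fun k => (E k).expect fun G => rate G) atTop (𝓝 D.designRate))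
    (hc : IsBMSFamily c) (hsmooth : IsSmoothFamilyOn c (Set.Ioo 0 1)) (hdeg : IsDegradedFamily c)
    {h : ℝ} (hh : h ∈ Set.Icc (0 : ℝ) 1) :
    D.designRate - ∫ u in h..1, bpGexit c E u ≤
      liminf (fun k => avgMapEntropy c (E k) h) atTop := by
  have hb := fun l k => isBoundedOnUnit_avgBpGexit hc hdeg hsmooth (E k) l
  have h1 : ∀ l, D.designRate - liminf (fun k => avgMapEntropy c (E k) h) atTop ≤
      ∫ u in h..1, limsup (fun k => avgBpGexit c (E k) l u) atTop := fun l => by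
    have h2 := sub_limsup_le_liminf (fun k => avgMapEntropy_mem hc hdeg (E k) hh)
      (fun k => (hb l k).integral_mem zero_le_one hh) hrate
      (fun k => expect_rate_sub_avgMapEntropy_le hc hdeg hsmooth (E k) l hh)
    have h3 := limsup_integral_le zero_le_one (hb l) hh
    linarith
  have hb' := fun l => isBoundedOnUnit_limsup (hb l)
  have h2 : D.designRate - liminf (fun k => avgMapEntropy c (E k) h) atTop ≤
      limsup (fun l => ∫ u in h..1, limsup (fun k => avgBpGexit c (E k) l u) atTop) atTop :=
    le_limsup_of_frequently_le (Frequently.of_forall h1)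
      (isBoundedUnder_of ⟨1, fun l => ((hb' l).integral_mem zero_le_one hh).2⟩)
  have h3 := limsup_integral_le zero_le_one hb' hh
  have h4 : ∫ u in h..1, limsup (fun l => limsup (fun k => avgBpGexit c (E k) l u) atTop) atTop =
      ∫ u in h..1, bpGexit c E u := rfl
  linarith

end Ensemble

end

end GEXIT

/-! ### The theorem: area bound and MAP threshold -/

open GEXIT in
theorem mainTheorem2 (D : GEXIT.DegreePair) (E : ℕ → GEXIT.DegreeProfile)
    (hE : GEXIT.IsLDPCSequence D E)
    (hrate : Tendsto (fun k => (E k).expect fun G => GEXIT.rate G) atTop (𝓝 D.designRate))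
    (c : ℝ → Measure ℝ) (hc : GEXIT.IsBMSFamily c)
    (hsmooth : GEXIT.IsSmoothFamilyOn c (Set.Ioo 0 1))
    (hdeg : GEXIT.IsDegradedFamily c) :
    IntervalIntegrable (GEXIT.bpGexit c E) volume 0 1 ∧
    (∀ h ∈ Set.Icc (0 : ℝ) 1,
      D.designRate - ∫ u in h..1, GEXIT.bpGexit c E u ≤
        liminf (fun k => GEXIT.avgMapEntropy c (E k) h) atTop) ∧
    ∃ hbar : ℝ,
      IsGreatest {h : ℝ | h ∈ Set.Icc (0 : ℝ) 1 ∧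
        ∫ u in h..1, GEXIT.bpGexit c E u = D.designRate} hbar ∧
      GEXIT.mapThreshold c E ≤ hbar := by
  have hb := isBoundedOnUnit_bpGexit hc hdeg hsmooth E
  have h0 : (0 : ℝ) ∈ Set.Icc (0 : ℝ) 1 := by norm_num
  have hint := hb.intervalIntegrable h0
  have hbound := fun h hh => designRate_sub_integral_le D E hrate hc hsmooth hdeg (h := h) hh
  refine ⟨hint, hbound, ?_⟩
  set I : ℝ → ℝ := fun h => ∫ u in h..1, bpGexit c E u with hI
  set r := D.designRate with hr
  have hr0 : 0 ≤ r := ge_of_tendsto' hrate fun k =>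
    div_nonneg (Finset.sum_nonneg fun G _ => rate_nonneg G) (Nat.cast_nonneg _)
  have hI1 : I 1 = 0 := by simp [hI]
  -- This is the area bound at h = 0, where the word entropy vanishes.
  have hI0 : r ≤ I 0 := by
    have := hbound 0 h0
    simp only [avgMapEntropy_zero hc, liminf_const] at this
    linarith
  have hcont : ContinuousOn I (Set.Icc 0 1) := by
    have := intervalIntegral.continuousOn_primitive_interval_left
      (f := bpGexit c E) (μ := volume) (a := 0) (b := 1)
      (by rwa [Set.uIcc_of_le zero_le_one, ← intervalIntegrable_iff_integrableOn_Icc_of_le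
        zero_le_one])
    rwa [Set.uIcc_of_le zero_le_one] at this
  -- I 1 = 0 ≤ r ≤ I h, so the continuous I takes the value r to the right of h. At h = 0 this gives
  -- existence of a solution; later it excludes I h ≥ r beyond the largest one.
  have hivt : ∀ h ∈ Set.Icc (0 : ℝ) 1, r ≤ I h →
      ∃ h' ∈ Set.Icc h 1, h' ∈ Set.Icc (0 : ℝ) 1 ∧ I h' = r := by
    intro h hh hle
    obtain ⟨h', hh', he⟩ := intermediate_value_Icc' hh.2
      (hcont.mono (Set.Icc_subset_Icc_left hh.1)) ⟨hI1.le.trans hr0, hle⟩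
    exact ⟨h', hh', ⟨hh.1.trans hh'.1, hh'.2⟩, he⟩
  set S : Set ℝ := {h : ℝ | h ∈ Set.Icc (0 : ℝ) 1 ∧ I h = r} with hS
  have hclosed : IsClosed S := hcont.preimage_isClosed_of_isClosed isClosed_Icc isClosed_singleton
  have hcompact : IsCompact S := isCompact_Icc.of_isClosed_subset hclosed fun h hh => hh.1
  have hne : S.Nonempty := by
    obtain ⟨h', -, hh'⟩ := hivt 0 h0 hI0
    exact ⟨h', hh'⟩
  obtain ⟨hbar, hgreat⟩ := hcompact.exists_isGreatest hne
  refine ⟨hbar, hgreat, ?_⟩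
  have hbdd : BddBelow (insert 1 {h : ℝ | h ∈ Set.Icc (0 : ℝ) 1 ∧
      0 < liminf (fun k => avgMapEntropy c (E k) h) atTop}) := by
    refine ⟨0, ?_⟩
    rintro x (rfl | hx)
    · exact zero_le_one
    · exact hx.1.1
  -- It suffices to bound the threshold by every h > hbar. For h < 1 maximality of hbar gives I h <
  -- r, and the area bound then makes the lower limit of the entropy positive at h.
  refine le_of_forall_gt_imp_ge_of_dense fun h hh => ?_
  rcases le_or_gt 1 h with h1 | h1
  · exact (csInf_le hbdd (Set.mem_insert _ _)).trans h1
  · have hmem : h ∈ Set.Icc (0 : ℝ) 1 := ⟨hgreat.1.1.1.trans hh.le, h1.le⟩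
    refine csInf_le hbdd (Set.mem_insert_of_mem _ ⟨hmem, ?_⟩)
    have hlt : I h < r := by
      by_contra hcon
      obtain ⟨h', hh', hS'⟩ := hivt h hmem (not_lt.1 hcon)
      exact absurd (hgreat.2 hS') (not_le.2 (hh.trans_le hh'.1))
    have := hbound h hmem
    simp only [hI] at hlt
    linarith
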